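/- Setting. Let $G=\mathrm{Sp}(1)^3$ act on $\mathbb H^2$ by $(q_1,q_2,q_3)\cdot(p,v)=(q_1p\bar q_3,\,q_2v\bar q_3)$, and let $K^+=\{(q,q',q)\}\subset G$, acting on $\mathbb H$ by $(q,q',q)\cdot v=q'v\bar q$. For $T>0$ let $B_T\subset\mathbb H$ be the open ball of radius $T$ and $M=G\times_{K^+}B_T$, which is $G$-equivariantly diffeomorphic to $G\times_{K^+}\mathbb H\cong S^3\times\mathbb R^4$ and is identified with $S^3\times B_T\subset\mathbb H^2$ by $[g,v]\mapsto g\cdot(1,v)$. Let $\gamma(t)=(1,t)$. Along $\gamma$ put $e_1=\gamma'$, and let $e_2,e_3,e_4$ (resp. $e_5,e_6,e_7$) be the values of the vector fields induced by $(X,-2X,X)$ (resp. $(-2X,X,X)$) in $\mathfrak{sp}(1)^3$ for $X=i,j,k$; let $e^1,\dots,e^7$ be the dual coframe for $t>0$. Fix $\lambda\in\mathbb R$, $\lambda\neq0$. A nearly parallel $G_2$-structure (NP-structure) with constant $\lambda$ on $M$ is a smooth positive $3$-form $\varphi$ with $d\varphi=\lambda *_\varphi\varphi$, where $*_\varphi$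 is the Hodge star of the metric $g_\varphi$ and the orientation determined by $\varphi$. We say that functions $f_0,\dots,f_4$ on $(0,T)$ define a $G$-invariant NP-structure on $M$ with constant $\lambda$ if there is a $G$-invariant NP-structure $\varphi$ on $M$ with constant $\lambda$ such that $g_\varphi(e_1,e_1)=1$ along $\gamma$ (that is, $t$ is the arc length parameter) and, for $0<t<T$, $$\varphi|_{\gamma(t)}=f_0(e^{125}+e^{136}+e^{147})+f_1e^{234}+f_2e^{567}+f_3(e^{237}-e^{246}+e^{345})+f_4(e^{267}-e^{357}+e^{456}).$$ For $h=(h_0,h_1,h_2,h_3)$ with $h_0\ne0$ put $h_4=-h_3-\frac\lambda6h_0^2$, $$A(h)=\Big(-h_0-\frac{3h_2h_3^2}{h_0^4},\ -4h_1+\frac{\lambda h_3^3}{h_0^3},\ 0,\ -2h_3+6h_0\Big),$$ $$B(h,t)=\begin{pmatrix}-\frac{3}{2h_0^4}\big(t(h_3-h_4)(h_1h_2+h_3h_4)-2t^3h_1h_4^2\big)\\ \frac{\lambda t}{2h_0^3}\big(h_1^2h_2-3h_1h_3h_4\big)\\ \frac{\lambda t}{h_0^3}\big(h_4(h_2h_3-t^2h_4^2)-\frac12h_2(h_1h_2-h_3h_4)\big)\\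 \frac{\lambda t}{2h_0^3}\big(h_1h_2h_3+h_3^2h_4-2t^2h_1h_4^2\big)\end{pmatrix}.$$ For $a\ne0$ and $\varepsilon>0$ consider smooth $h:(-\varepsilon,\varepsilon)\to\mathbb R^4$ with $h_0\neq0$ everywhere and $$h'(t)=\tfrac1tA(h(t))+B(h(t),t)\quad(t\ne0),\qquad h(0)=\Big(a,\ \tfrac{27}4\lambda,\ -\tfrac{a^3}{27},\ 3a\Big).\qquad(*)$$ Proposition. (1) For every $T>0$, functions $f_0,\dots,f_4$ on $(0,T)$ define a $G$-invariant NP-structure on $M=G\times_{K^+}B_T$ with constant $\lambda$ if and only if there are $a\neq0$ and a smooth even solution $h$ of $(*)$ on $(-T,T)$ such that on $(0,T)$ $$f_0=t\,h_0,\quad f_1=t^4h_1,\quad f_2=h_2,\quad f_3=t^2h_3,\quad f_4=t^2h_4=t^2\big(-h_3-\tfrac\lambda6h_0^2\big).$$ (2) For every $a\neq0$: there are an $\varepsilon>0$ and a smooth solution $h$ of $(*)$ on $(-\varepsilon,\varepsilon)$; for every $\varepsilon>0$, any two smooth solutions of $(*)$ on $(-\varepsilon,\varepsilon)$ coincide;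 and every smooth solution of $(*)$ on $(-\varepsilon,\varepsilon)$ is even. -/

import Mathlib

open scoped Quaternion ContDiff
open Set

noncomputable section

namespace NearlyParallel

/-! ### The manifold and the group action

`G = Sp(1)³` acts on `ℍ²` by `(q₁, q₂, q₃) · (p, v) = (q₁ p q̄₃, q₂ v q̄₃)`.  The isotropy group of
`(1, 0)` is `K⁺ = {(q, q', q)}`, and `K⁺` acts on the slice `ℍ` by `(q, q', q) · v = q' v q̄`.
The homogeneous bundle `G ×_{K⁺} B_T`, with `B_T ⊆ ℍ` the open ball of radius `T`, is identified
with `S³ × B_T ⊆ ℍ²` by the `G`-equivariant map `[g, v] ↦ g · (1, v)`; see `mem_tube_iff` and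
`act_slice_eq_iff`.  For every `T > 0` it is `G`-equivariantly diffeomorphic to `G ×_{K⁺} ℍ`. -/

/-- The ambient space `ℍ²`. -/
abbrev Amb : Type := ℍ[ℝ] × ℍ[ℝ]

/-- The group `Sp(1)` of unit quaternions. -/
abbrev Sp1 : Type := unitary ℍ[ℝ]

/-- The group `G = Sp(1)³`. -/
abbrev G : Type := Sp1 × Sp1 × Sp1

/-- The action of `G` on `ℍ²`.  For fixed `g` it is real linear in `x`, so `act g` is also the
differential of `act g`. -/
def act (g : G) (x : Amb) : Amb :=
  ((g.1 : ℍ[ℝ]) * x.1 * star (g.2.2 : ℍ[ℝ]), (g.2.1 : ℍ[ℝ]) * x.2 * star (g.2.2 : ℍ[ℝ]))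

/-- The manifold `M = G ×_{K⁺} B_T ≅ S³ × B_T`, as a submanifold of `ℍ²`. -/
def tube (T : ℝ) : Set Amb := {x | ‖x.1‖ = 1 ∧ ‖x.2‖ < T}

/-- An open neighbourhood of `tube T` in `ℍ²`, which retracts smoothly onto `tube T` by
`(p, v) ↦ (p / |p|, v)`. -/
def nhd (T : ℝ) : Set Amb := {x | x.1 ≠ 0 ∧ ‖x.2‖ < T}

/-- The tangent space at `x = (p, v)` of `S³ × B_T`, namely `p^⊥ × ℍ`. -/
def tangent (x : Amb) : Submodule ℝ Amb := (Submodule.span ℝ {x.1})ᗮ.prod ⊤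

/-- The transversal curve `γ(t) = (1, t)`. -/
def gam (t : ℝ) : Amb := (1, (t : ℍ[ℝ]))

theorem norm_sp1 (q : Sp1) : ‖(q : ℍ[ℝ])‖ = 1 := CStarRing.norm_coe_unitary q

/-- `S³ × B_T` is the image of `G × B_T` under `(g, v) ↦ g · (1, v)`. -/
theorem mem_tube_iff (T : ℝ) (x : Amb) :
    x ∈ tube T ↔ ∃ (g : G) (v : ℍ[ℝ]), ‖v‖ < T ∧ act g (1, v) = x := by
  constructor
  · rintro ⟨h1, h2⟩
    have hn : Quaternion.normSq x.1 = 1 := by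
      rw [Quaternion.normSq_eq_norm_mul_self, h1, one_mul]
    have hu : x.1 ∈ unitary ℍ[ℝ] := by
      rw [Unitary.mem_iff]
      constructor
      · rw [Quaternion.star_mul_self, hn]; rfl
      · rw [Quaternion.self_mul_star, hn]; rfl
    exact ⟨(⟨x.1, hu⟩, 1, 1), x.2, h2, by ext1 <;> simp [act]⟩
  · rintro ⟨g, v, hv, rfl⟩
    simpa [tube, act, norm_sp1] using hv

/-- Two pairs in `G × ℍ` have the same image under `(g, v) ↦ g · (1, v)` if and only if they differ
by an element `k = (q, q', q)` of `K⁺`, acting by `(g, k · v) ∼ (g k, v)`. -/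
theorem act_slice_eq_iff (g g' : G) (v v' : ℍ[ℝ]) :
    act g (1, v) = act g' (1, v') ↔
      ∃ q q' : Sp1, g' = g * (q, q', q) ∧ v = (q' : ℍ[ℝ]) * v' * star (q : ℍ[ℝ]) := by
  obtain ⟨a, b, c⟩ := g
  obtain ⟨a', b', c'⟩ := g'
  have hs : ∀ u : Sp1, star (u : ℍ[ℝ]) * u = 1 := fun u => Unitary.star_mul_self_of_mem u.2
  have hs' : ∀ u : Sp1, (u : ℍ[ℝ]) * star (u : ℍ[ℝ]) = 1 :=
    fun u => Unitary.mul_star_self_of_mem u.2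
  constructor
  · intro h
    simp only [act, Prod.mk.injEq, mul_one] at h
    obtain ⟨h1, h2⟩ := h
    have e1 : (a : Sp1) * c⁻¹ = a' * c'⁻¹ := Subtype.ext h1
    refine ⟨c⁻¹ * c', b⁻¹ * b', ?_, ?_⟩
    · have : a' = a * (c⁻¹ * c') := by
        rw [← mul_assoc, e1]; group
      simp [this]
    · have : v = star (b : ℍ[ℝ]) * ((b : ℍ[ℝ]) * v * star (c : ℍ[ℝ])) * (c : ℍ[ℝ]) := by
        calc v = (star (b : ℍ[ℝ]) * b) * v * (star (c : ℍ[ℝ]) * c) := by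
              rw [hs, hs, one_mul, mul_one]
          _ = _ := by simp only [mul_assoc]
      have hb : ((b⁻¹ : Sp1) : ℍ[ℝ]) = star (b : ℍ[ℝ]) := rfl
      have hc : ((c⁻¹ : Sp1) : ℍ[ℝ]) = star (c : ℍ[ℝ]) := rfl
      rw [this, h2]
      simp [mul_assoc, hb, hc]
  · rintro ⟨q, q', h, rfl⟩
    simp only [Prod.mk_mul_mk, Prod.mk.injEq] at h
    obtain ⟨rfl, rfl, rfl⟩ := h
    have : (q : ℍ[ℝ]) * (star (q : ℍ[ℝ]) * star (c : ℍ[ℝ])) = star (c : ℍ[ℝ]) := by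
      rw [← mul_assoc, hs', one_mul]
    simp [act, mul_assoc, this]

/-! ### The frame along `γ` -/

/-- The value at `x` of the vector field induced on `ℍ²` by `X = (X₁, X₂, X₃) ∈ sp(1)³`, that is,
the derivative at `s = 0` of `exp(sX) · x` (recall that `X̄₃ = -X₃`). -/
def fundamental (X : ℍ[ℝ] × ℍ[ℝ] × ℍ[ℝ]) (x : Amb) : Amb :=
  (X.1 * x.1 - x.1 * X.2.2, X.2.1 * x.2 - x.2 * X.2.2)

/-- The standard basis `i, j, k` of `sp(1)`; it satisfies `[i, j] = 2k`, `[i, k] = -2j`,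
`[j, k] = 2i`. -/
def imUnit : Fin 3 → ℍ[ℝ] := fun n =>
  ⟨0, if n = 0 then 1 else 0, if n = 1 then 1 else 0, if n = 2 then 1 else 0⟩

/-- `j₊(X) = (X, -2X, X)`. -/
def jPlus (X : ℍ[ℝ]) : ℍ[ℝ] × ℍ[ℝ] × ℍ[ℝ] := (X, (-2 : ℝ) • X, X)

/-- `j₋(X) = (-2X, X, X)`. -/
def jMinus (X : ℍ[ℝ]) : ℍ[ℝ] × ℍ[ℝ] × ℍ[ℝ] := ((-2 : ℝ) • X, X, X)

/-- The vectors `e₁ = γ'(t)`, `e₂, e₃, e₄` (induced by `j₊` of the basis of `sp(1)`) and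
`e₅, e₆, e₇` (induced by `j₋`) at `γ(t)`.  The index `i : Fin 7` stands for `e_{i+1}`. -/
def frameVec (t : ℝ) : Fin 7 → Amb :=
  ![(0, 1),
    fundamental (jPlus (imUnit 0)) (gam t),
    fundamental (jPlus (imUnit 1)) (gam t),
    fundamental (jPlus (imUnit 2)) (gam t),
    fundamental (jMinus (imUnit 0)) (gam t),
    fundamental (jMinus (imUnit 1)) (gam t),
    fundamental (jMinus (imUnit 2)) (gam t)]

/-- The linear map `ℝ⁷ → ℍ²`, `y ↦ ∑ yᵢ eᵢ`, given by the frame at `γ(t)`. -/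
def frame (t : ℝ) : (Fin 7 → ℝ) →ₗ[ℝ] Amb := Fintype.linearCombination ℝ (frameVec t)

/-! ### Alternating forms on `ℝ⁷` and `G₂`-structures -/

/-- The elementary form `e^{i₁} ∧ … ∧ e^{iₖ}` on `ℝ⁷`, that is
`(y₁, …, yₖ) ↦ det (y_a)_{i_b}`.  Indices are shifted by one: `0, …, 6` stand for `1, …, 7`. -/
def elem {k : ℕ} (I : Fin k → Fin 7) : (Fin 7 → ℝ) [⋀^Fin k]→ₗ[ℝ] ℝ :=
  Matrix.detRowAlternating.compLinearMap (LinearMap.funLeft ℝ ℝ I)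

/-- The `3`-form
`f₀(e¹²⁵+e¹³⁶+e¹⁴⁷) + f₁e²³⁴ + f₂e⁵⁶⁷ + f₃(e²³⁷-e²⁴⁶+e³⁴⁵) + f₄(e²⁶⁷-e³⁵⁷+e⁴⁵⁶)`. -/
def invForm (f₀ f₁ f₂ f₃ f₄ : ℝ) : (Fin 7 → ℝ) [⋀^Fin 3]→ₗ[ℝ] ℝ :=
  f₀ • (elem ![0, 1, 4] + elem ![0, 2, 5] + elem ![0, 3, 6])
    + f₁ • elem ![1, 2, 3] + f₂ • elem ![4, 5, 6]
    + f₃ • (elem ![1, 2, 6] - elem ![1, 3, 5] + elem ![2, 3, 4])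
    + f₄ • (elem ![1, 5, 6] - elem ![2, 4, 6] + elem ![3, 4, 5])

/-- The standard `G₂`-form
`e¹²³+e¹⁴⁵+e¹⁶⁷+e²⁴⁶-e²⁵⁷-e³⁴⁷-e³⁵⁶` on `ℝ⁷`.  It induces the standard metric and orientation. -/
def stdPhi : (Fin 7 → ℝ) [⋀^Fin 3]→ₗ[ℝ] ℝ :=
  elem ![0, 1, 2] + elem ![0, 3, 4] + elem ![0, 5, 6] + elem ![1, 3, 5]
    - elem ![1, 4, 6] - elem ![2, 3, 6] - elem ![2, 4, 5]

/-- The Hodge dual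
`e⁴⁵⁶⁷+e²³⁶⁷+e²³⁴⁵+e¹³⁵⁷-e¹³⁴⁶-e¹²⁵⁶-e¹²⁴⁷` of `stdPhi` for the standard metric and
orientation. -/
def stdPsi : (Fin 7 → ℝ) [⋀^Fin 4]→ₗ[ℝ] ℝ :=
  elem ![3, 4, 5, 6] + elem ![1, 2, 5, 6] + elem ![1, 2, 3, 4] + elem ![0, 2, 4, 6]
    - elem ![0, 2, 3, 5] - elem ![0, 1, 4, 5] - elem ![0, 1, 3, 6]

/-- The pull-back to `ℝ⁷` of a `k`-form on `ℍ²` along a linear isomorphism `L` of `ℝ⁷` with the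
tangent space of `S³ × B_T` at `x`. -/
def pull {k : ℕ} {x : Amb} (L : (Fin 7 → ℝ) ≃ₗ[ℝ] tangent x) (α : Amb [⋀^Fin k]→L[ℝ] ℝ) :
    (Fin 7 → ℝ) [⋀^Fin k]→ₗ[ℝ] ℝ :=
  α.toAlternatingMap.compLinearMap ((tangent x).subtype ∘ₗ L.toLinearMap)

/-- `L` is an adapted frame at `x` for the `3`-form `φ`: it identifies `φ`, restricted to the
tangent space, with `stdPhi`.  The form is positive at `x` if and only if such an `L` exists; then
the metric `g_φ` and the form `*_φ φ` on the tangent space are those which `L` identifies with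
the standard metric of `ℝ⁷` and with `stdPsi`.  They do not depend on `L`, since the stabilizer
`G₂` of `stdPhi` lies in `SO(7)`. -/
def IsAdapted {x : Amb} (φ : Amb [⋀^Fin 3]→L[ℝ] ℝ) (L : (Fin 7 → ℝ) ≃ₗ[ℝ] tangent x) : Prop :=
  pull L φ = stdPhi

/-- The restriction to the submanifold `tube T` of the `3`-form `φ` on its neighbourhood `nhd T` is
a `G`-invariant nearly parallel `G₂`-structure with constant `lam`.  Every smooth form on `tube T`
is such a restriction, and the exterior derivative commutes with restriction.  All conditions but
smoothness concern the restriction only. -/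
structure IsInvariantNP (lam T : ℝ) (φ : Amb → Amb [⋀^Fin 3]→L[ℝ] ℝ) : Prop where
  /-- `φ` is smooth -/
  smooth : ContDiffOn ℝ ∞ φ (nhd T)
  /-- `g^* φ = φ` for all `g ∈ G` -/
  invariant : ∀ g : G, ∀ x ∈ tube T, ∀ u : Fin 3 → Amb, (∀ i, u i ∈ tangent x) →
    φ (act g x) (fun i => act g (u i)) = φ x u
  /-- `φ` is a positive `3`-form -/
  positive : ∀ x ∈ tube T, ∃ L : (Fin 7 → ℝ) ≃ₗ[ℝ] tangent x, IsAdapted (φ x) L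
  /-- `dφ = lam *_φ φ` -/
  nearly_parallel : ∀ x ∈ tube T, ∀ L : (Fin 7 → ℝ) ≃ₗ[ℝ] tangent x, IsAdapted (φ x) L →
    pull L (extDeriv φ x) = lam • stdPsi

/-- The functions `f₀, …, f₄` on `(0, T)` define a `G`-invariant nearly parallel `G₂`-structure
with constant `lam` on `M = G ×_{K⁺} B_T`, with arc length parameter `t` along `γ`: there is such
a structure `φ` on `M` whose restriction along `γ` is `invForm (f₀ t) … (f₄ t)` in the frame
`e₁, …, e₇`, and `g_φ(γ', γ') = 1`. -/
def DefinesNP (lam T : ℝ) (f : Fin 5 → ℝ → ℝ) : Prop :=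
  ∃ φ : Amb → Amb [⋀^Fin 3]→L[ℝ] ℝ, IsInvariantNP lam T φ ∧
    (∀ t ∈ Ioo 0 T, (φ (gam t)).toAlternatingMap.compLinearMap (frame t) =
      invForm (f 0 t) (f 1 t) (f 2 t) (f 3 t) (f 4 t)) ∧
    (∀ t ∈ Ioo 0 T, ∀ L : (Fin 7 → ℝ) ≃ₗ[ℝ] tangent (gam t), IsAdapted (φ (gam t)) L →
      ∀ y : Fin 7 → ℝ, (L y : Amb) = (0, 1) → ∑ i, y i ^ 2 = 1)

/-! ### The singular initial value problem -/

/-- `h₄ = -h₃ - (lam / 6) h₀²`. -/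
def hFour (lam : ℝ) (h : Fin 4 → ℝ) : ℝ := -h 3 - lam / 6 * h 0 ^ 2

/-- The singular part `A(h)`. -/
def singA (lam : ℝ) (h : Fin 4 → ℝ) : Fin 4 → ℝ :=
  ![-h 0 - 3 * h 2 * h 3 ^ 2 / h 0 ^ 4,
    -4 * h 1 + lam * h 3 ^ 3 / h 0 ^ 3,
    0,
    -2 * h 3 + 6 * h 0]

/-- The regular part `B(h, t)`. -/
def regB (lam : ℝ) (h : Fin 4 → ℝ) (t : ℝ) : Fin 4 → ℝ :=
  let h₄ := hFour lam h
  ![-(3 / (2 * h 0 ^ 4)) *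
      (t * (h 3 - h₄) * (h 1 * h 2 + h 3 * h₄) - 2 * t ^ 3 * h 1 * h₄ ^ 2),
    lam * t / (2 * h 0 ^ 3) * (h 1 ^ 2 * h 2 - 3 * h 1 * h 3 * h₄),
    lam * t / h 0 ^ 3 *
      (h₄ * (h 2 * h 3 - t ^ 2 * h₄ ^ 2) - 1 / 2 * h 2 * (h 1 * h 2 - h 3 * h₄)),
    lam * t / (2 * h 0 ^ 3) *
      (h 1 * h 2 * h 3 + h 3 ^ 2 * h₄ - 2 * t ^ 2 * h 1 * h₄ ^ 2)]

/-- `h = (h₀, h₁, h₂, h₃)` is a smooth solution on `(-ε, ε)` of `h' = A(h)/t + B(h, t)`, `t ≠ 0`,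
with `h(0) = (a, 27 lam / 4, -a³ / 27, 3a)`.  (The equation makes sense only where `h₀ ≠ 0`.) -/
structure IsSingularSolution (lam a ε : ℝ) (h : ℝ → Fin 4 → ℝ) : Prop where
  smooth : ContDiffOn ℝ ∞ h (Ioo (-ε) ε)
  ne_zero : ∀ t ∈ Ioo (-ε) ε, h t 0 ≠ 0
  ode : ∀ t ∈ Ioo (-ε) ε, t ≠ 0 →
    HasDerivAt h ((1 / t) • singA lam (h t) + regB lam (h t) t) t
  init : h 0 = ![a, 27 / 4 * lam, -(a ^ 3 / 27), 3 * a]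

/-- `h` is even on `(-ε, ε)`. -/
def IsEvenOn (ε : ℝ) (h : ℝ → Fin 4 → ℝ) : Prop := ∀ t ∈ Ioo (-ε) ε, h (-t) = h t

end NearlyParallel

end

noncomputable section
namespace NearlyParallel

/-! ### Weighted means along rays and division by the variable -/

/-! Every point of the tube is a translate of some point of `gam`, so an invariant form is
determined by its values along that curve. These are best written in the constant frame `efr`, which
unlike `frameVec` stays a frame at t = 0; the two differ by the factors -3 and -3t (`frame_eq`).

Geometry to equations. The fields x ↦ x a of the algebra ℍ × ℍ commute with left multiplication, so
on them an invariant form has coefficients depending only on the radius. The formula for d in terms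
of vector fields and brackets gives dφ along `gam` (`IsInvariant.extDeriv_gam`). For the dual form,
φ is read as e¹ ∧ ω + Re Ω with complex coordinates a y + b y': its coefficients are those of the
binary cubic Re((ax + by)³), and those of the dual form come from Im((ax + by)³). Positivity with
|γ'| = 1 amounts to f₀ ≠ 0 and a discriminant condition (`NormalEq`), by `exists_normal` and
`positive_invForm`; independence of the adapted frame rests on G₂ ⊂ O(7) (`dot_of_stdPhi_comp`,
`stdPsi_comp`). Then dφ = λ∗φ splits into one algebraic equation, which defines h₄, and four
differential equations, equivalent to the system for h (`ode_iff`).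

The singular orbit. The element (1, -1, 1) reflects `gam` and fixes the parity of each coefficient,
so a smooth φ yields a smooth even h; boundedness of h' at 0 forces A(h(0)) = 0, that is, the
initial value with a = h₀(0). Conversely, even functions of |v| are smooth on ℍ, and h₃(0) = 3h₀(0)
is what is needed to assemble a smooth invariant `radialForm`. The discriminant condition is not
imposed: t⁶ times its defect is a first integral which vanishes at t = 0
(`IsSingularSolution.normalPoly_eq_zero`). The equation at t = 0 itself follows by continuity.

The initial value problem. Writing h = h(0) + t y turns the system into t y' = (dA - 1) y + t R(t,
y). The eigenvalues -1, -6, 0, -4 of dA become -2, -7, -1, -5, all negative. In eigenvector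
coordinates u' = K - n u / t is equivalent, for solutions regular at 0, to u = t ∫₀¹ sⁿ K(st, u(st))
ds. A contraction solves this, the smoothness of weighted means gives regularity, and the sign of
-n/t makes an energy estimate give uniqueness. Evenness follows since h(-t) solves the same problem.
-/

/-- The weighted mean `∫₀¹ sⁿ g(st) ds`. -/
def scaledMean (n : ℕ) (g : ℝ → ℝ) (t : ℝ) : ℝ := ∫ s in (0 : ℝ)..1, s ^ n * g (s * t)

theorem continuous_scaledMean (n : ℕ) {g : ℝ → ℝ} (hg : Continuous g) :
    Continuous (scaledMean n g) := by
  unfold scaledMean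
  apply intervalIntegral.continuous_parametric_intervalIntegral_of_continuous'
  fun_prop

/-- Near a point of `(-T, T)`, a function continuous on `(-T, T)` may be replaced by one continuous
on `ℝ`, without changing its weighted means. -/
theorem exists_continuous_eqOn {T t : ℝ} {g : ℝ → ℝ} (hg : ContinuousOn g (Ioo (-T) T))
    (ht : t ∈ Ioo (-T) T) :
    ∃ (b : ℝ) (g' : ℝ → ℝ), Continuous g' ∧ t ∈ Ioo (-b) b ∧ b < T ∧
      (∀ s ∈ Ioo (-b) b, g' s = g s) ∧
      ∀ (n : ℕ), ∀ s ∈ Ioo (-b) b, scaledMean n g' s = scaledMean n g s := by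
  obtain ⟨b, hb1, hb2⟩ := exists_between (abs_lt.2 ht)
  have hb0 : 0 ≤ b := (abs_nonneg t).trans hb1.le
  have key : ∀ s ∈ Ioo (-b) b, g (max (-b) (min b s)) = g s := fun s hs => by
    rw [min_eq_right hs.2.le, max_eq_right hs.1.le]
  refine ⟨b, fun s => g (max (-b) (min b s)), ?_, abs_lt.1 hb1, hb2, key, ?_⟩
  · refine hg.comp_continuous (by fun_prop) fun s => ⟨?_, ?_⟩
    · exact lt_of_lt_of_le (by linarith) (le_max_left _ _)
    · exact max_lt (by linarith) ((min_le_left _ _).trans_lt hb2)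
  · intro n s hs
    refine intervalIntegral.integral_congr fun r hr => ?_
    rw [uIcc_of_le zero_le_one] at hr
    have : |r * s| < b := by
      rw [abs_mul, abs_of_nonneg hr.1]
      calc r * |s| ≤ 1 * |s| := by gcongr; exact hr.2
        _ < b := by rw [one_mul]; exact abs_lt.2 hs
    simp only [key _ (abs_lt.1 this)]

theorem continuousOn_scaledMean (n : ℕ) {T : ℝ} {g : ℝ → ℝ} (hg : ContinuousOn g (Ioo (-T) T)) :
    ContinuousOn (scaledMean n g) (Ioo (-T) T) := by
  intro t ht
  obtain ⟨b, g', hg', htb, -, -, h⟩ := exists_continuous_eqOn hg ht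
  refine ((continuous_scaledMean n hg').continuousAt.congr ?_).continuousWithinAt
  filter_upwards [isOpen_Ioo.mem_nhds htb] with s hs using h n s hs

theorem scaledMean_zero (n : ℕ) (g : ℝ → ℝ) : scaledMean n g 0 = g 0 / (n + 1) := by
  simp [scaledMean, integral_pow, div_eq_inv_mul]

theorem pow_mul_scaledMean (n : ℕ) (g : ℝ → ℝ) (t : ℝ) :
    t ^ (n + 1) * scaledMean n g t = ∫ s in (0 : ℝ)..t, s ^ n * g s := by
  have := intervalIntegral.smul_integral_comp_mul_right (a := 0) (b := 1)
    (fun s => s ^ n * g s) t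
  simp only [zero_mul, one_mul, smul_eq_mul] at this
  rw [← this, pow_succ', mul_assoc, scaledMean, ← intervalIntegral.integral_const_mul]
  congr 1
  refine intervalIntegral.integral_congr fun s _ => ?_
  simp only [mul_pow]; ring

/-- Variation of constants: away from 0 the function is t⁻ⁿ ∫₀ᵗ sⁿ g, so it solves u' + n u / t = g,
and it is the solution that stays regular at 0. At 0 the derivative is the limit of the difference
quotients, the value g(0)/(n + 1) of the continuous mean. -/
theorem hasDerivAt_mul_scaledMean (n : ℕ) {T t : ℝ} {g : ℝ → ℝ}
    (hg : ContinuousOn g (Ioo (-T) T)) (ht : t ∈ Ioo (-T) T) :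
    HasDerivAt (fun t => t * scaledMean n g t) (g t - n * scaledMean n g t) t := by
  wlog hc : Continuous g generalizing g
  · obtain ⟨b, g', hg', htb, -, h1, h2⟩ := exists_continuous_eqOn hg ht
    rw [← h1 t htb, ← h2 n t htb]
    refine (this hg'.continuousOn hg').congr_of_eventuallyEq ?_
    filter_upwards [isOpen_Ioo.mem_nhds htb] with s hs
    rw [h2 n s hs]
  rcases eq_or_ne t 0 with rfl | h0
  · rw [hasDerivAt_iff_tendsto_slope_zero]
    have h := (continuous_scaledMean n hc).tendsto 0
    have e : g 0 - n * scaledMean n g 0 = scaledMean n g 0 := by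
      rw [scaledMean_zero]; field_simp; ring
    rw [e]
    refine (h.mono_left nhdsWithin_le_nhds).congr' ?_
    filter_upwards [self_mem_nhdsWithin] with s hs
    have hs' : s ≠ 0 := hs
    simp [hs']
  · have hJ : HasDerivAt (fun t => ∫ s in (0 : ℝ)..t, s ^ n * g s) (t ^ n * g t) t := by
      have hc' : Continuous fun s : ℝ => s ^ n * g s := by fun_prop
      exact intervalIntegral.integral_hasDerivAt_right (hc'.intervalIntegrable _ _)
        (hc'.stronglyMeasurableAtFilter _ _) hc'.continuousAt
    have hd := hJ.div (hasDerivAt_pow n t) (pow_ne_zero n h0)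
    have e : (fun t => t * scaledMean n g t) =ᶠ[nhds t]
        fun t => (∫ s in (0 : ℝ)..t, s ^ n * g s) / t ^ n := by
      filter_upwards [isOpen_ne.mem_nhds h0] with s hs
      have hs' : s ≠ 0 := hs
      rw [← pow_mul_scaledMean]; field_simp; ring
    refine (hd.congr_of_eventuallyEq e).congr_deriv ?_
    rw [← pow_mul_scaledMean]
    rcases n with _ | n
    · simp
    · field_simp
      simp only [Nat.add_sub_cancel]
      ring

/-- Integration by parts, from the derivative of s^(n+1) g(st) in s. It reduces the derivative of a
weighted mean to `hasDerivAt_mul_scaledMean` applied to g', avoiding differentiation under the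
integral. -/
theorem scaledMean_eq_sub (n : ℕ) {T t : ℝ} {g : ℝ → ℝ} (hg : ContDiffOn ℝ 1 g (Ioo (-T) T))
    (ht : t ∈ Ioo (-T) T) :
    scaledMean n g t = (g t - t * scaledMean (n + 1) (deriv g) t) / (n + 1) := by
  have hmem : ∀ s ∈ uIcc (0 : ℝ) 1, s * t ∈ Ioo (-T) T := by
    intro r hr
    rw [uIcc_of_le zero_le_one] at hr
    refine abs_lt.1 ?_
    rw [abs_mul, abs_of_nonneg hr.1]
    calc r * |t| ≤ 1 * |t| := by gcongr; exact hr.2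
      _ < T := by rw [one_mul]; exact abs_lt.2 ht
  have hd : ContinuousOn (deriv g) (Ioo (-T) T) :=
    hg.continuousOn_deriv_of_isOpen isOpen_Ioo le_rfl
  have h1 : ∀ s ∈ uIcc (0 : ℝ) 1, HasDerivAt (fun s => s ^ (n + 1) * g (s * t))
      ((n + 1) * (s ^ n * g (s * t)) + t * (s ^ (n + 1) * deriv g (s * t))) s := by
    intro s hs
    have hgs : HasDerivAt g (deriv g (s * t)) (s * t) :=
      ((hg.differentiableOn one_ne_zero).differentiableAt
        (isOpen_Ioo.mem_nhds (hmem s hs))).hasDerivAt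
    have := (hasDerivAt_pow (n + 1) s).mul (hgs.comp s ((hasDerivAt_id s).mul_const t))
    refine this.congr_deriv ?_
    simp; ring
  have hm : ContinuousOn (fun s : ℝ => s * t) (uIcc (0 : ℝ) 1) := by fun_prop
  have c1 : ContinuousOn (fun s => s ^ n * g (s * t)) (uIcc (0 : ℝ) 1) :=
    (continuousOn_pow n).mul (hg.continuousOn.comp hm hmem)
  have c2 : ContinuousOn (fun s => s ^ (n + 1) * deriv g (s * t)) (uIcc (0 : ℝ) 1) :=
    (continuousOn_pow (n + 1)).mul (hd.comp hm hmem)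
  have i1 := c1.intervalIntegrable (μ := MeasureTheory.volume)
  have i2 := c2.intervalIntegrable (μ := MeasureTheory.volume)
  have h2 := intervalIntegral.integral_eq_sub_of_hasDerivAt h1
    ((i1.const_mul _).add (i2.const_mul _))
  rw [intervalIntegral.integral_add (i1.const_mul _) (i2.const_mul _),
    intervalIntegral.integral_const_mul, intervalIntegral.integral_const_mul] at h2
  simp only [one_pow, one_mul, ne_eq, Nat.add_eq_zero_iff, one_ne_zero, and_false,
    not_false_eq_true, zero_pow, zero_mul, sub_zero] at h2
  rw [eq_div_iff (by positivity), scaledMean, scaledMean]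
  linarith

theorem hasDerivAt_scaledMean (n : ℕ) {T t : ℝ} {g : ℝ → ℝ} (hg : ContDiffOn ℝ 1 g (Ioo (-T) T))
    (ht : t ∈ Ioo (-T) T) :
    HasDerivAt (scaledMean n g) (scaledMean (n + 1) (deriv g) t) t := by
  have hd : ContinuousOn (deriv g) (Ioo (-T) T) :=
    hg.continuousOn_deriv_of_isOpen isOpen_Ioo le_rfl
  have hgs : HasDerivAt g (deriv g t) t :=
    ((hg.differentiableOn one_ne_zero).differentiableAt (isOpen_Ioo.mem_nhds ht)).hasDerivAt
  have h := (hgs.sub (hasDerivAt_mul_scaledMean (n + 1) hd ht)).div_const ((n : ℝ) + 1)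
  have e : scaledMean n g =ᶠ[nhds t]
      fun t => (g t - t * scaledMean (n + 1) (deriv g) t) / (n + 1) := by
    filter_upwards [isOpen_Ioo.mem_nhds ht] with s hs using scaledMean_eq_sub n hg hs
  refine (h.congr_of_eventuallyEq e).congr_deriv ?_
  push_cast
  field_simp
  ring

/-- Each derivative passes to g and raises the weight by one, so the induction must run over all
weights at once. -/
theorem contDiffOn_scaledMean_nat (k : ℕ) : ∀ (n : ℕ) {T : ℝ} {g : ℝ → ℝ},
    ContDiffOn ℝ k g (Ioo (-T) T) → ContDiffOn ℝ k (scaledMean n g) (Ioo (-T) T) := by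
  induction k with
  | zero =>
    intro n T g hg
    exact contDiffOn_zero.2 (continuousOn_scaledMean n hg.continuousOn)
  | succ k ih =>
    intro n T g hg
    push_cast at hg ⊢
    have hg1 : ContDiffOn ℝ 1 g (Ioo (-T) T) := hg.of_le (by simp)
    rw [contDiffOn_succ_iff_deriv_of_isOpen isOpen_Ioo] at hg ⊢
    refine ⟨fun t ht => (hasDerivAt_scaledMean n hg1 ht).differentiableAt.differentiableWithinAt,
      by simp, ?_⟩
    exact (ih (n + 1) hg.2.2).congr fun t ht => (hasDerivAt_scaledMean n hg1 ht).deriv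

theorem contDiffOn_scaledMean (n : ℕ) {T : ℝ} {g : ℝ → ℝ} (hg : ContDiffOn ℝ ∞ g (Ioo (-T) T)) :
    ContDiffOn ℝ ∞ (scaledMean n g) (Ioo (-T) T) :=
  contDiffOn_infty.2 fun k => contDiffOn_scaledMean_nat k n (contDiffOn_infty.1 hg k)

/-- A smooth function vanishing at `0` is the product of the variable and of a smooth function. -/
theorem exists_eq_mul_of_zero {T : ℝ} {g : ℝ → ℝ} (hg : ContDiffOn ℝ ∞ g (Ioo (-T) T))
    (h0 : g 0 = 0) :
    ∃ k : ℝ → ℝ, ContDiffOn ℝ ∞ k (Ioo (-T) T) ∧ ∀ t ∈ Ioo (-T) T, g t = t * k t := by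
  refine ⟨scaledMean 0 (deriv g), contDiffOn_scaledMean 0
    ((contDiffOn_infty_iff_deriv_of_isOpen isOpen_Ioo).1 hg).2, fun t ht => ?_⟩
  have hg1 : ContDiffOn ℝ 1 g (Ioo (-T) T) := hg.of_le (by exact_mod_cast le_top)
  have hd : ContinuousOn (deriv g) (Ioo (-T) T) :=
    hg1.continuousOn_deriv_of_isOpen isOpen_Ioo le_rfl
  have hcd : ∀ s ∈ Ioo (-T) T, HasDerivAt (fun s => g s - s * scaledMean 0 (deriv g) s) 0 s := by
    intro s hs
    have hgs : HasDerivAt g (deriv g s) s :=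
      ((hg1.differentiableOn one_ne_zero).differentiableAt (isOpen_Ioo.mem_nhds hs)).hasDerivAt
    have h := hgs.sub (hasDerivAt_mul_scaledMean 0 hd hs)
    simp only [Nat.cast_zero, zero_mul, sub_zero, sub_self] at h
    exact h
  have hT : (0 : ℝ) ∈ Ioo (-T) T := by
    constructor <;> linarith [ht.1, ht.2]
  have := (convex_Ioo (-T) T).is_const_of_fderivWithin_eq_zero
    (f := fun s => g s - s * scaledMean 0 (deriv g) s) (𝕜 := ℝ)
    (fun s hs => (hcd s hs).differentiableAt.differentiableWithinAt)
    (fun s hs => by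
      rw [fderivWithin_of_isOpen isOpen_Ioo hs]
      ext; simpa using (hcd s hs).deriv) ht hT
  simp only [h0, zero_mul, sub_zero] at this
  linarith

/-- An odd smooth function is the product of the variable and of an even smooth function. -/
theorem exists_eq_mul_of_odd {T : ℝ} {g : ℝ → ℝ} (hg : ContDiffOn ℝ ∞ g (Ioo (-T) T))
    (hodd : ∀ t ∈ Ioo (-T) T, g (-t) = -g t) :
    ∃ k : ℝ → ℝ, ContDiffOn ℝ ∞ k (Ioo (-T) T) ∧ (∀ t ∈ Ioo (-T) T, g t = t * k t) ∧
      ∀ t ∈ Ioo (-T) T, k (-t) = k t := by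
  rcases le_or_gt T 0 with hT | hT
  · rw [Ioo_eq_empty (by linarith)] at *
    exact ⟨g, hg, by simp, by simp⟩
  have h0 : g 0 = 0 := by
    have := hodd 0 ⟨by linarith, hT⟩
    rw [neg_zero] at this; linarith
  obtain ⟨k, hk, hgk⟩ := exists_eq_mul_of_zero hg h0
  refine ⟨k, hk, hgk, fun t ht => ?_⟩
  rcases eq_or_ne t 0 with rfl | ht0
  · rw [neg_zero]
  have h1 := hodd t ht
  rw [hgk t ht, hgk (-t) ⟨by linarith [ht.2], by linarith [ht.1]⟩] at h1
  have : t * k (-t) = t * k t := by linarith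
  exact mul_left_cancel₀ ht0 this

theorem exists_eq_sq_mul_of_even {T : ℝ} {g : ℝ → ℝ} (hg : ContDiffOn ℝ ∞ g (Ioo (-T) T))
    (heven : ∀ t ∈ Ioo (-T) T, g (-t) = g t) (h0 : g 0 = 0) :
    ∃ k : ℝ → ℝ, ContDiffOn ℝ ∞ k (Ioo (-T) T) ∧ (∀ t ∈ Ioo (-T) T, g t = t ^ 2 * k t) ∧
      ∀ t ∈ Ioo (-T) T, k (-t) = k t := by
  obtain ⟨k, hk, hgk⟩ := exists_eq_mul_of_zero hg h0
  have hneg : ∀ t ∈ Ioo (-T) T, -t ∈ Ioo (-T) T :=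
    fun t ht => ⟨by linarith [ht.2], by linarith [ht.1]⟩
  have hodd' : ∀ t ∈ Ioo (-T) T, t ≠ 0 → k (-t) = -k t := by
    intro t ht ht0
    have h1 := heven t ht
    rw [hgk t ht, hgk (-t) (hneg t ht)] at h1
    have : t * k (-t) = t * -k t := by linarith
    exact mul_left_cancel₀ ht0 this
  have hodd : ∀ t ∈ Ioo (-T) T, k (-t) = -k t := by
    intro t ht
    -- At t = 0 oddness means k(0) = 0, which cancelling t cannot give; it follows by continuity
    -- from t ≠ 0.
    have hc : ContinuousOn (fun s => k (-s) + k s) (Ioo (-T) T) :=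
      (hk.continuousOn.comp continuousOn_neg hneg).add hk.continuousOn
    rcases eq_or_ne t 0 with rfl | ht0
    · have hca := hc.continuousAt (isOpen_Ioo.mem_nhds ht)
      have h2 : Filter.Tendsto (fun s => k (-s) + k s) (nhdsWithin 0 {0}ᶜ) (nhds 0) := by
        refine tendsto_const_nhds.congr' ?_
        filter_upwards [self_mem_nhdsWithin,
          mem_nhdsWithin_of_mem_nhds (isOpen_Ioo.mem_nhds ht)] with s hs hs'
        rw [hodd' s hs' hs]; ring
      have := tendsto_nhds_unique (hca.tendsto.mono_left nhdsWithin_le_nhds) h2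
      linarith
    · exact hodd' t ht ht0
  obtain ⟨l, hl, hkl, hle⟩ := exists_eq_mul_of_odd hk hodd
  exact ⟨l, hl, fun t ht => by rw [hgk t ht, hkl t ht]; ring, hle⟩

/-! ### Radial functions -/

theorem deriv_neg_of_even {T : ℝ} {g : ℝ → ℝ}
    (heven : ∀ t ∈ Ioo (-T) T, g (-t) = g t) {t : ℝ} (ht : t ∈ Ioo (-T) T) :
    deriv g (-t) = -deriv g t := by
  have e : (fun s => g (-s)) =ᶠ[nhds t] g := by
    filter_upwards [isOpen_Ioo.mem_nhds ht] with s hs using heven s hs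
  have := e.deriv_eq
  rw [deriv_comp_neg] at this
  linarith

/-- The gradient of g(|v|) is (g'(r)/r) v, and g'(r)/r is again smooth and even because g' is odd.
The class of functions is therefore stable and the induction closes. -/
theorem contDiffOn_radial_nat {V : Type*} [NormedAddCommGroup V] [InnerProductSpace ℝ V] {T : ℝ}
    (k : ℕ) : ∀ {g : ℝ → ℝ}, ContDiffOn ℝ ∞ g (Ioo (-T) T) →
      (∀ t ∈ Ioo (-T) T, g (-t) = g t) →
      ContDiffOn ℝ k (fun v : V => g ‖v‖) {v | ‖v‖ < T} := by
  have hopen : IsOpen {v : V | ‖v‖ < T} := isOpen_lt continuous_norm continuous_const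
  have hmem : ∀ v ∈ {v : V | ‖v‖ < T}, ‖v‖ ∈ Ioo (-T) T := fun v hv =>
    ⟨by have := norm_nonneg v; have : ‖v‖ < T := hv; linarith, hv⟩
  induction k with
  | zero =>
    intro g hg _
    exact contDiffOn_zero.2 (hg.continuousOn.comp continuous_norm.continuousOn hmem)
  | succ k ih =>
    intro g hg heven
    obtain ⟨-, hd⟩ := (contDiffOn_infty_iff_deriv_of_isOpen isOpen_Ioo).1 hg
    obtain ⟨l, hl, hgl, hle⟩ := exists_eq_mul_of_odd hd fun t ht => deriv_neg_of_even heven ht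
    have hder : ∀ v ∈ {v : V | ‖v‖ < T},
        HasFDerivAt (fun v : V => g ‖v‖) (l ‖v‖ • innerSL ℝ v) v := by
      intro v hv
      rcases eq_or_ne v 0 with rfl | hv0
      -- At the origin the norm is not differentiable, but g'(0) = 0 makes g(|v|) - g(0) of order
      -- o(|v|).
      · have h0 : (0 : ℝ) ∈ Ioo (-T) T := by simpa using hmem 0 hv
        have hg0 : HasDerivAt g 0 0 := by
          have := (hg.differentiableOn (by simp)).differentiableAt (isOpen_Ioo.mem_nhds h0)
          have h := this.hasDerivAt
          rwa [hgl 0 h0, zero_mul] at h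
        have ho := hg0.isLittleO
        simp only [map_zero, smul_zero]
        rw [hasFDerivAt_iff_isLittleO_nhds_zero]
        have h1 : Filter.Tendsto (fun v : V => ‖v‖) (nhds 0) (nhds 0) := by
          simpa using (continuous_norm (E := V)).tendsto 0
        have := (ho.comp_tendsto h1).congr' (f₂ := fun v : V => g ‖0 + v‖ - g ‖(0 : V)‖ - 0)
          (g₂ := fun v : V => ‖v‖)
          (by filter_upwards with v; simp) (by filter_upwards with v; simp)
        simpa using this.of_norm_right
      · have hg' : HasDerivAt g (‖v‖ * l ‖v‖) ‖v‖ := by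
          rw [← hgl _ (hmem v hv)]
          exact ((hg.differentiableOn (by simp)).differentiableAt
            (isOpen_Ioo.mem_nhds (hmem v hv))).hasDerivAt
        have hn : HasFDerivAt (fun v : V => ‖v‖) (‖v‖⁻¹ • innerSL ℝ v) v := by
          have h2 := (hasStrictFDerivAt_norm_sq v).hasFDerivAt.sqrt
            (pow_ne_zero 2 (norm_ne_zero_iff.2 hv0))
          simp only [Real.sqrt_sq (norm_nonneg _)] at h2
          refine h2.congr_fderiv ?_
          ext w
          have := norm_ne_zero_iff.2 hv0
          simp
          field_simp
        refine (hg'.comp_hasFDerivAt v hn).congr_fderiv ?_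
        rw [smul_smul]
        congr 1
        have := norm_ne_zero_iff.2 hv0
        field_simp
    push_cast
    rw [contDiffOn_succ_iff_fderiv_of_isOpen hopen]
    refine ⟨fun v hv => (hder v hv).differentiableAt.differentiableWithinAt, by simp, ?_⟩
    refine ContDiffOn.congr ?_ fun v hv => (hder v hv).fderiv
    exact (ih hl hle).smul (innerSL ℝ).contDiff.contDiffOn

/-- A smooth even function of the norm is smooth. -/
theorem contDiffOn_radial {V : Type*} [NormedAddCommGroup V] [InnerProductSpace ℝ V] {T : ℝ}
    {g : ℝ → ℝ} (hg : ContDiffOn ℝ ∞ g (Ioo (-T) T)) (heven : ∀ t ∈ Ioo (-T) T, g (-t) = g t) :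
    ContDiffOn ℝ ∞ (fun v : V => g ‖v‖) {v | ‖v‖ < T} :=
  contDiffOn_infty.2 fun k => contDiffOn_radial_nat k hg heven

end NearlyParallel
end

noncomputable section
namespace NearlyParallel

/-! ### Singular systems `t u' = t K(t, u) - N u` with a diagonal matrix `N` -/

theorem abs_scaledMean_le (n : ℕ) {g : ℝ → ℝ} (t : ℝ) {B : ℝ} (hB : ∀ s, |g s| ≤ B) :
    |scaledMean n g t| ≤ B := by
  have h := intervalIntegral.norm_integral_le_of_norm_le_const (a := (0 : ℝ)) (b := 1) (C := B)
    (f := fun s => s ^ n * g (s * t)) fun s hs => by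
      rw [uIoc_of_le zero_le_one] at hs
      rw [norm_mul, norm_pow, Real.norm_eq_abs, Real.norm_eq_abs, abs_of_pos hs.1]
      calc s ^ n * |g (s * t)| ≤ 1 * B :=
            mul_le_mul (pow_le_one₀ hs.1.le hs.2) (hB _) (abs_nonneg _) zero_le_one
        _ = B := one_mul B
  simpa [scaledMean] using h

theorem scaledMean_sub (n : ℕ) {f g : ℝ → ℝ} (hf : Continuous f) (hg : Continuous g) (t : ℝ) :
    scaledMean n f t - scaledMean n g t = scaledMean n (fun s => f s - g s) t := by
  unfold scaledMean
  rw [← intervalIntegral.integral_sub]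
  · simp only [mul_sub]
  · exact Continuous.intervalIntegrable (by fun_prop) _ _
  · exact Continuous.intervalIntegrable (by fun_prop) _ _

/-- The integral equation equivalent to the singular system has a continuous solution, if the
right-hand side is globally Lipschitz in the unknown. -/
theorem exists_integral_solution {ι : Type*} [Fintype ι] (n : ι → ℕ)
    (K : ℝ × (ι → ℝ) → ι → ℝ) (hK : Continuous K) {C ε : ℝ} (hC : 0 ≤ C) (hε : 0 ≤ ε)
    (hlip : ∀ t u v, ‖K (t, u) - K (t, v)‖ ≤ C * ‖u - v‖) (hεC : ε * C ≤ 1 / 2) :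
    ∃ u : ℝ → ι → ℝ, Continuous u ∧
      ∀ t ∈ Icc (-ε) ε, ∀ i, u t i = t * scaledMean (n i) (fun s => K (s, u s) i) t := by
  have hle : -ε ≤ ε := by linarith
  let ext : C(Icc (-ε) ε, ι → ℝ) → ℝ → ι → ℝ := fun u => IccExtend hle u
  have hext : ∀ u, Continuous (ext u) := fun u => u.continuous.Icc_extend'
  have hg : ∀ u i, Continuous fun s => K (s, ext u s) i := fun u i =>
    (continuous_apply i).comp (hK.comp (continuous_id.prodMk (hext u)))
  let Φ : C(Icc (-ε) ε, ι → ℝ) → C(Icc (-ε) ε, ι → ℝ) := fun u =>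
    ⟨fun t i => (t : ℝ) * scaledMean (n i) (fun s => K (s, ext u s) i) t,
      continuous_pi fun i => continuous_subtype_val.mul
        ((continuous_scaledMean (n i) (hg u i)).comp continuous_subtype_val)⟩
  -- The weighted mean does not increase the supremum, so the factor |t| ≤ ε together with the
  -- Lipschitz constant C gives contraction by εC ≤ 1/2.
  have hΦ : ContractingWith (1 / 2) Φ := by
    refine ⟨by rw [← NNReal.coe_lt_coe]; norm_num, LipschitzWith.of_dist_le_mul fun u v => ?_⟩
    rw [ContinuousMap.dist_le (by positivity)]
    intro t
    rw [dist_pi_le_iff (by positivity)]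
    intro i
    have h1 : ∀ s, |K (s, ext u s) i - K (s, ext v s) i| ≤ C * dist u v := fun s =>
      calc |K (s, ext u s) i - K (s, ext v s) i|
          ≤ ‖K (s, ext u s) - K (s, ext v s)‖ := norm_le_pi_norm (K (s, ext u s) - K (s, ext v s)) i
        _ ≤ C * ‖ext u s - ext v s‖ := hlip _ _ _
        _ ≤ C * dist u v := by
            gcongr
            rw [← dist_eq_norm]
            exact ContinuousMap.dist_apply_le_dist _
    have ht : |(t : ℝ)| ≤ ε := abs_le.2 t.2
    change |(t : ℝ) * scaledMean (n i) (fun s => K (s, ext u s) i) t -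
      (t : ℝ) * scaledMean (n i) (fun s => K (s, ext v s) i) t| ≤ _
    rw [← mul_sub, scaledMean_sub _ (hg u i) (hg v i), abs_mul]
    calc |(t : ℝ)| * |scaledMean (n i) (fun s => K (s, ext u s) i - K (s, ext v s) i) t|
        ≤ ε * (C * dist u v) :=
          mul_le_mul ht (abs_scaledMean_le _ _ h1) (abs_nonneg _) hε
      _ = ε * C * dist u v := by ring
      _ ≤ 1 / 2 * dist u v := by gcongr
      _ = _ := by norm_num
  obtain ⟨u, hu⟩ : ∃ u, Φ u = u := ⟨_, hΦ.fixedPoint_isFixedPt⟩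
  refine ⟨ext u, hext u, fun t ht i => ?_⟩
  have : ext u t = u ⟨t, ht⟩ := IccExtend_of_mem hle u ht
  rw [this]
  conv_lhs => rw [← hu]
  rfl

/-- Bootstrapping: if u is of class Cᵏ then so are K(s, u(s)) and its weighted means, hence u' is,
and u is of class Cᵏ⁺¹. -/
theorem contDiffOn_integral_solution {ι : Type*} [Fintype ι] (n : ι → ℕ)
    {K : ℝ × (ι → ℝ) → ι → ℝ} {U : Set (ℝ × (ι → ℝ))} (hK : ContDiffOn ℝ ∞ K U) {ε : ℝ}
    {u : ℝ → ι → ℝ} (hu : ContinuousOn u (Ioo (-ε) ε)) (hU : ∀ t ∈ Ioo (-ε) ε, (t, u t) ∈ U)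
    (heq : ∀ t ∈ Ioo (-ε) ε, ∀ i, u t i = t * scaledMean (n i) (fun s => K (s, u s) i) t) :
    ContDiffOn ℝ ∞ u (Ioo (-ε) ε) ∧ ∀ t ∈ Ioo (-ε) ε, ∀ i, HasDerivAt (fun s => u s i)
      (K (t, u t) i - n i * scaledMean (n i) (fun s => K (s, u s) i) t) t := by
  have hg : ∀ k : ℕ, ContDiffOn ℝ k u (Ioo (-ε) ε) →
      ∀ i, ContDiffOn ℝ k (fun s => K (s, u s) i) (Ioo (-ε) ε) := by
    intro k hk i
    have h1 : ContDiffOn ℝ k (fun s => K (s, u s)) (Ioo (-ε) ε) :=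
      (hK.of_le (by exact_mod_cast le_top)).comp (contDiffOn_id.prodMk hk) hU
    exact contDiffOn_pi.1 h1 i
  have hder : ∀ t ∈ Ioo (-ε) ε, ∀ i, HasDerivAt (fun s => u s i)
      (K (t, u t) i - n i * scaledMean (n i) (fun s => K (s, u s) i) t) t := by
    intro t ht i
    have h0 := (hg 0 (contDiffOn_zero.2 hu) i).continuousOn
    refine (hasDerivAt_mul_scaledMean (n i) h0 ht).congr_of_eventuallyEq ?_
    filter_upwards [isOpen_Ioo.mem_nhds ht] with s hs using heq s hs i
  refine ⟨contDiffOn_infty.2 fun k => ?_, hder⟩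
  induction k with
  | zero => exact contDiffOn_zero.2 hu
  | succ k ih =>
    refine contDiffOn_pi.2 fun i => ?_
    push_cast
    rw [contDiffOn_succ_iff_deriv_of_isOpen isOpen_Ioo]
    refine ⟨fun t ht => (hder t ht i).differentiableAt.differentiableWithinAt, by simp, ?_⟩
    refine ContDiffOn.congr ?_ fun t ht => (hder t ht i).deriv
    exact (hg k ih i).sub (contDiffOn_const.mul (contDiffOn_scaledMean_nat k _ (hg k ih i)))

/-- Local existence of smooth solutions of `t u' = t K(t, u) - N u`. -/
theorem exists_singular_solution {ι : Type*} [Fintype ι] (n : ι → ℕ)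
    {K : ℝ × (ι → ℝ) → ι → ℝ} {U : Set (ℝ × (ι → ℝ))} (hUo : IsOpen U) (h0 : 0 ∈ U)
    (hK : ContDiffOn ℝ ∞ K U) :
    ∃ ε > 0, ∃ u : ℝ → ι → ℝ, ContDiffOn ℝ ∞ u (Ioo (-ε) ε) ∧ u 0 = 0 ∧
      (∀ t ∈ Ioo (-ε) ε, (t, u t) ∈ U) ∧
      ∀ t ∈ Ioo (-ε) ε, t ≠ 0 → ∀ i, HasDerivAt (fun s => u s i)
        (K (t, u t) i - n i * (u t i / t)) t := by
  obtain ⟨C, s, hs, hCs⟩ := ((hK.contDiffAt (hUo.mem_nhds h0)).of_le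
    (show (1 : WithTop ℕ∞) ≤ ∞ by exact_mod_cast le_top)).exists_lipschitzOnWith
  obtain ⟨r, hr, hrs⟩ := Metric.nhds_basis_closedBall.mem_iff.1
    (Filter.inter_mem hs (hUo.mem_nhds h0))
  -- Clamping both arguments to a ball where K is Lipschitz produces a globally Lipschitz bounded
  -- right-hand side. For small ε the solution stays in the ball, so the clamp is inactive along it.
  let cl : ℝ → ℝ := fun x => max (-r) (min r x)
  have hcl : ∀ x, |cl x| ≤ r := fun x =>
    abs_le.2 ⟨le_max_left _ _, max_le (by linarith) (min_le_left _ _)⟩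
  have hclid : ∀ x, |x| ≤ r → cl x = x := fun x hx => by
    rw [abs_le] at hx
    simp only [cl]
    rw [min_eq_right hx.2, max_eq_right hx.1]
  have hclc : Continuous cl := by fun_prop
  have hcll : ∀ x y, |cl x - cl y| ≤ |x - y| := fun x y => by
    refine (abs_max_sub_max_le_max _ _ _ _).trans ?_
    refine max_le (by simp) ((abs_min_sub_min_le_max _ _ _ _).trans ?_)
    exact max_le (by simp) le_rfl
  let ρ : ℝ × (ι → ℝ) → ℝ × (ι → ℝ) := fun p => (cl p.1, fun i => cl (p.2 i))
  have hρ : ∀ p, ρ p ∈ Metric.closedBall (0 : ℝ × (ι → ℝ)) r := fun p => by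
    rw [mem_closedBall_zero_iff, Prod.norm_def]
    exact max_le (hcl _) ((pi_norm_le_iff_of_nonneg hr.le).2 fun i => hcl _)
  have hρid : ∀ p, ‖p.1‖ ≤ r → ‖p.2‖ ≤ r → ρ p = p := fun p h1 h2 =>
    Prod.ext (hclid _ h1) (funext fun i => hclid _ ((norm_le_pi_norm p.2 i).trans h2))
  have hρc : Continuous ρ := by
    refine (hclc.comp continuous_fst).prodMk (continuous_pi fun i => hclc.comp ?_)
    fun_prop
  have hKρ : Continuous (K ∘ ρ) :=
    hK.continuousOn.comp_continuous hρc fun p => (hrs (hρ p)).2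
  have hlip : ∀ t u v, ‖(K ∘ ρ) (t, u) - (K ∘ ρ) (t, v)‖ ≤ C * ‖u - v‖ := by
    intro t u v
    have h1 := hCs.dist_le_mul _ (hrs (hρ (t, u))).1 _ (hrs (hρ (t, v))).1
    rw [dist_eq_norm, dist_eq_norm] at h1
    refine h1.trans ?_
    gcongr
    rw [Prod.norm_def]
    refine max_le (by simp [ρ]) ((pi_norm_le_iff_of_nonneg (norm_nonneg _)).2 fun i => ?_)
    exact (hcll _ _).trans (norm_le_pi_norm (u - v) i)
  obtain ⟨B, hB0, hB⟩ : ∃ B : ℝ, 0 ≤ B ∧ ∀ p, ‖(K ∘ ρ) p‖ ≤ B := by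
    refine ⟨‖K 0‖ + C * r, by positivity, fun p => ?_⟩
    have h1 := hCs.dist_le_mul _ (hrs (hρ p)).1 0 (hrs (Metric.mem_closedBall_self hr.le)).1
    rw [dist_eq_norm, dist_eq_norm, sub_zero] at h1
    have h2 : ‖ρ p‖ ≤ r := by simpa using hρ p
    calc ‖(K ∘ ρ) p‖ = ‖K 0 + (K (ρ p) - K 0)‖ := by simp
      _ ≤ ‖K 0‖ + ‖K (ρ p) - K 0‖ := norm_add_le _ _
      _ ≤ ‖K 0‖ + C * r := by
        gcongr
        exact h1.trans (by gcongr)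
  -- The three bounds keep the time in the ball, keep the solution in the ball, and make the
  -- integral operator a contraction; adding 1 avoids zero denominators.
  set ε := min r (min (r / (B + 1)) (1 / (2 * (C + 1)))) with hεdef
  have hε : 0 < ε := by positivity
  have hεr : ε ≤ r := min_le_left _ _
  have hεB : ε * B ≤ r := by
    have : ε ≤ r / (B + 1) := (min_le_right _ _).trans (min_le_left _ _)
    rw [le_div_iff₀ (by positivity)] at this
    nlinarith
  have hεC : ε * C ≤ 1 / 2 := by
    have : ε ≤ 1 / (2 * (C + 1)) := (min_le_right _ _).trans (min_le_right _ _)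
    rw [le_div_iff₀ (by positivity)] at this
    nlinarith
  obtain ⟨u, huc, hu⟩ := exists_integral_solution n (K ∘ ρ) hKρ C.coe_nonneg hε.le hlip hεC
  have hub : ∀ t ∈ Icc (-ε) ε, ‖u t‖ ≤ r := by
    intro t ht
    refine (pi_norm_le_iff_of_nonneg hr.le).2 fun i => ?_
    rw [hu t ht i, Real.norm_eq_abs, abs_mul]
    refine le_trans ?_ hεB
    exact mul_le_mul (abs_le.2 ht) (abs_scaledMean_le _ _ fun s =>
      (norm_le_pi_norm ((K ∘ ρ) (s, u s)) i).trans (hB _)) (abs_nonneg _) hε.le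
  have hρu : ∀ t ∈ Icc (-ε) ε, ρ (t, u t) = (t, u t) := fun t ht =>
    hρid _ ((abs_le.2 ht).trans hεr) (hub t ht)
  have hU : ∀ t ∈ Ioo (-ε) ε, (t, u t) ∈ U := fun t ht => by
    rw [← hρu t (Ioo_subset_Icc_self ht)]
    exact (hrs (hρ _)).2
  have heq : ∀ t ∈ Ioo (-ε) ε, ∀ i,
      u t i = t * scaledMean (n i) (fun s => K (s, u s) i) t := by
    intro t ht i
    rw [hu t (Ioo_subset_Icc_self ht) i]
    congr 1
    refine intervalIntegral.integral_congr fun s hs => ?_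
    rw [uIcc_of_le zero_le_one] at hs
    have hst : s * t ∈ Icc (-ε) ε := by
      refine abs_le.1 ?_
      rw [abs_mul, abs_of_nonneg hs.1]
      calc s * |t| ≤ 1 * |t| := by gcongr; exact hs.2
        _ ≤ ε := by rw [one_mul]; exact abs_le.2 (Ioo_subset_Icc_self ht)
    simp only [Function.comp, hρu _ hst]
  obtain ⟨hsm, hder⟩ := contDiffOn_integral_solution n hK huc.continuousOn hU heq
  refine ⟨ε, hε, u, hsm, ?_, hU, fun t ht ht0 i => ?_⟩
  · funext i
    rw [heq 0 ⟨by linarith, hε⟩ i]; simp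
  · refine (hder t ht i).congr_deriv ?_
    rw [heq t ht i, mul_div_cancel_left₀ _ ht0]

/-- Uniqueness for `t u' = t K(t, u) - N u` with the initial value `u(0) = 0`. -/
theorem singular_solution_unique {ι : Type*} [Fintype ι] (n : ι → ℕ)
    {K : ℝ × (ι → ℝ) → ι → ℝ} {U : Set (ℝ × (ι → ℝ))} (hUo : IsOpen U)
    (hK : ContDiffOn ℝ ∞ K U) {ε : ℝ} {u v : ℝ → ι → ℝ}
    (huc : ContinuousOn u (Ico 0 ε)) (hvc : ContinuousOn v (Ico 0 ε)) (h0 : u 0 = v 0)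
    (hU : ∀ t ∈ Ico 0 ε, ∀ s ∈ Icc (0 : ℝ) 1, (t, v t + s • (u t - v t)) ∈ U)
    (hu : ∀ t ∈ Ioo 0 ε, ∀ i, HasDerivAt (fun s => u s i) (K (t, u t) i - n i * (u t i / t)) t)
    (hv : ∀ t ∈ Ioo 0 ε, ∀ i, HasDerivAt (fun s => v s i) (K (t, v t) i - n i * (v t i / t)) t) :
    EqOn u v (Ico 0 ε) := by
  intro b hb
  have hIcc : Icc 0 b ⊆ Ico 0 ε := fun t ht => ⟨ht.1, ht.2.trans_lt hb.2⟩
  have huc' := huc.mono hIcc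
  have hvc' := hvc.mono hIcc
  -- a Lipschitz constant along the segments between the two solutions
  obtain ⟨C, hC0, hC⟩ : ∃ C : ℝ, 0 ≤ C ∧ ∀ t ∈ Icc 0 b,
      ‖K (t, u t) - K (t, v t)‖ ≤ C * ‖u t - v t‖ := by
    let σ : ℝ × ℝ → ℝ × (ι → ℝ) := fun p => (p.1, v p.1 + p.2 • (u p.1 - v p.1))
    have hσ : ContinuousOn σ (Icc 0 b ×ˢ Icc (0 : ℝ) 1) := by
      have h1 : ContinuousOn (fun p : ℝ × ℝ => u p.1) (Icc 0 b ×ˢ Icc (0 : ℝ) 1) :=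
        huc'.comp continuousOn_fst fun p hp => hp.1
      have h2 : ContinuousOn (fun p : ℝ × ℝ => v p.1) (Icc 0 b ×ˢ Icc (0 : ℝ) 1) :=
        hvc'.comp continuousOn_fst fun p hp => hp.1
      exact continuousOn_fst.prodMk (h2.add (continuousOn_snd.smul (h1.sub h2)))
    have hσU : MapsTo σ (Icc 0 b ×ˢ Icc (0 : ℝ) 1) U := fun p hp =>
      hU p.1 (hIcc hp.1) p.2 hp.2
    have hcf : ContinuousOn (fderiv ℝ K) U := hK.continuousOn_fderiv_of_isOpen hUo (by simp)
    have hcomp := (isCompact_Icc (a := 0) (b := b)).prod (isCompact_Icc (a := (0 : ℝ)) (b := 1))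
    obtain ⟨C, hC⟩ := hcomp.exists_bound_of_continuousOn (hcf.comp hσ hσU)
    refine ⟨max C 0, le_max_right _ _, fun t ht => ?_⟩
    have hseg : ∀ p ∈ segment ℝ (t, v t) (t, u t), p ∈ U ∧ ‖fderiv ℝ K p‖ ≤ max C 0 := by
      intro p hp
      rw [segment_eq_image'] at hp
      obtain ⟨s, hs, rfl⟩ := hp
      have : (t, v t) + s • ((t, u t) - (t, v t)) = σ (t, s) := by simp [σ]
      beta_reduce
      rw [this]
      exact ⟨hσU ⟨ht, hs⟩, (hC (t, s) ⟨ht, hs⟩).trans (le_max_left _ _)⟩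
    have := (convex_segment (𝕜 := ℝ) (t, v t) (t, u t)).norm_image_sub_le_of_norm_fderiv_le
      (f := K) (fun p hp => (hK.differentiableOn (by simp)).differentiableAt
        (hUo.mem_nhds (hseg p hp).1)) (fun p hp => (hseg p hp).2)
      (left_mem_segment ℝ _ _) (right_mem_segment ℝ _ _)
    refine this.trans (le_of_eq ?_)
    simp [Prod.norm_def]
  -- Energy of the difference: the singular terms contribute -2 (n/t)(u - v)² ≤ 0, so they can be
  -- dropped and a Gronwall inequality E' ≤ D E remains although the equation is singular at 0.
  let E : ℝ → ℝ := fun t => ∑ i, (u t i - v t i) ^ 2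
  have hEc : ContinuousOn E (Icc 0 b) := by
    refine continuousOn_finsetSum _ fun i _ => ContinuousOn.pow ?_ 2
    exact ((continuous_apply i).comp_continuousOn huc').sub
      ((continuous_apply i).comp_continuousOn hvc')
  let D : ℝ := 2 * (Fintype.card ι * C)
  have hE' : ∀ t ∈ Ioo 0 b, HasDerivAt E (∑ i, 2 * (u t i - v t i) *
      ((K (t, u t) i - n i * (u t i / t)) - (K (t, v t) i - n i * (v t i / t)))) t := by
    intro t ht
    have ht' : t ∈ Ioo 0 ε := ⟨ht.1, ht.2.trans hb.2⟩
    refine HasDerivAt.fun_sum fun i _ => ?_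
    have := ((hu t ht' i).sub (hv t ht' i)).pow 2
    refine this.congr_deriv ?_
    simp
  have hbound : ∀ t ∈ Ioo 0 b, ∑ i, 2 * (u t i - v t i) *
      ((K (t, u t) i - n i * (u t i / t)) - (K (t, v t) i - n i * (v t i / t))) ≤ D * E t := by
    intro t ht
    have hnorm : ‖u t - v t‖ ^ 2 ≤ E t := by
      have : ‖u t - v t‖ ≤ Real.sqrt (E t) := by
        refine (pi_norm_le_iff_of_nonneg (Real.sqrt_nonneg _)).2 fun i => ?_
        refine Real.abs_le_sqrt ?_
        exact Finset.single_le_sum (f := fun i => (u t i - v t i) ^ 2)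
          (fun j _ => sq_nonneg _) (Finset.mem_univ i)
      calc ‖u t - v t‖ ^ 2 ≤ Real.sqrt (E t) ^ 2 := by gcongr
        _ = E t := Real.sq_sqrt (Finset.sum_nonneg fun i _ => sq_nonneg _)
    have hterm : ∀ i, 2 * (u t i - v t i) *
        ((K (t, u t) i - n i * (u t i / t)) - (K (t, v t) i - n i * (v t i / t))) ≤
        2 * (C * E t) := by
      intro i
      have h1 : 0 ≤ (n i : ℝ) / t * (u t i - v t i) ^ 2 :=
        mul_nonneg (div_nonneg (Nat.cast_nonneg _) ht.1.le) (sq_nonneg _)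
      have h2 : (u t i - v t i) * (K (t, u t) i - K (t, v t) i) ≤ C * E t := by
        calc (u t i - v t i) * (K (t, u t) i - K (t, v t) i)
            ≤ |u t i - v t i| * |K (t, u t) i - K (t, v t) i| := by
              rw [← abs_mul]; exact le_abs_self _
          _ ≤ ‖u t - v t‖ * (C * ‖u t - v t‖) :=
              mul_le_mul (norm_le_pi_norm (u t - v t) i)
                ((norm_le_pi_norm (K (t, u t) - K (t, v t)) i).trans
                  (hC t (Ioo_subset_Icc_self ht))) (abs_nonneg _) (norm_nonneg _)
          _ = C * ‖u t - v t‖ ^ 2 := by ring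
          _ ≤ C * E t := by gcongr
      have h3 : 2 * (u t i - v t i) *
          ((K (t, u t) i - n i * (u t i / t)) - (K (t, v t) i - n i * (v t i / t))) =
          2 * ((u t i - v t i) * (K (t, u t) i - K (t, v t) i)) -
            2 * (n i / t * (u t i - v t i) ^ 2) := by ring
      rw [h3]; linarith
    calc _ ≤ ∑ _i : ι, 2 * (C * E t) := Finset.sum_le_sum fun i _ => hterm i
      _ = D * E t := by simp [D]; ring
  -- Gronwall with an integrating factor. Only continuity is needed at t = 0, where E vanishes.
  have hanti : AntitoneOn (fun t => Real.exp (-D * t) * E t) (Icc 0 b) := by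
    refine antitoneOn_of_hasDerivWithinAt_nonpos (convex_Icc 0 b) (by fun_prop)
      (f' := fun t => Real.exp (-D * t) * (∑ i, 2 * (u t i - v t i) *
      ((K (t, u t) i - n i * (u t i / t)) - (K (t, v t) i - n i * (v t i / t))) - D * E t)) ?_ ?_
    · intro t ht
      rw [interior_Icc] at ht
      have h1 : HasDerivAt (fun t => Real.exp (-D * t)) (Real.exp (-D * t) * -D) t := by
        simpa using ((hasDerivAt_id t).const_mul (-D)).exp
      refine ((h1.mul (hE' t ht)).congr_deriv ?_).hasDerivWithinAt
      ring
    · intro t ht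
      rw [interior_Icc] at ht
      exact mul_nonpos_of_nonneg_of_nonpos (Real.exp_pos _).le (by linarith [hbound t ht])
  have hEb := hanti (left_mem_Icc.2 hb.1) (right_mem_Icc.2 hb.1) hb.1
  have hE0 : E 0 = 0 := by simp [E, h0]
  simp only [hE0, mul_zero] at hEb
  have hEb' : E b ≤ 0 := nonpos_of_mul_nonpos_right hEb (Real.exp_pos _)
  have hEb0 : E b = 0 := le_antisymm hEb' (Finset.sum_nonneg fun i _ => sq_nonneg _)
  funext i
  have := (Finset.sum_eq_zero_iff_of_nonneg (fun i _ => sq_nonneg (u b i - v b i))).1 hEb0 i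
    (Finset.mem_univ i)
  exact sub_eq_zero.1 (pow_eq_zero_iff two_ne_zero |>.1 this)

end NearlyParallel
end

noncomputable section
namespace NearlyParallel

/-! ### The singular initial value problem -/

/-- The initial value of the singular initial value problem. -/
def initVal (lam a : ℝ) : Fin 4 → ℝ := ![a, 27 / 4 * lam, -(a ^ 3 / 27), 3 * a]

/-- The vector with given coordinates in a basis of eigenvectors, with eigenvalues `-1, -6, 0, -4`,
of the linearization of `singA` at the initial value. -/
def ofEigen (lam a : ℝ) (u : Fin 4 → ℝ) : Fin 4 → ℝ :=
  ![u 0 + u 1 - 9 * u 2 / a ^ 2, 27 * lam / a * u 0 + 243 / 4 * lam / a * u 1 + u 3, u 2,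
    6 * u 0 - 3 / 2 * u 1 - 27 * u 2 / a ^ 2]

/-- The coordinates of a vector in the basis of eigenvectors used in `ofEigen`. -/
def toEigen (lam a : ℝ) (y : Fin 4 → ℝ) : Fin 4 → ℝ :=
  ![(3 * (y 0 + 9 * y 2 / a ^ 2) + 2 * (y 3 + 27 * y 2 / a ^ 2)) / 15,
    (12 * (y 0 + 9 * y 2 / a ^ 2) - 2 * (y 3 + 27 * y 2 / a ^ 2)) / 15,
    y 2,
    y 1 - 27 * lam / a * ((3 * (y 0 + 9 * y 2 / a ^ 2) + 2 * (y 3 + 27 * y 2 / a ^ 2)) / 15)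
      - 243 / 4 * lam / a *
        ((12 * (y 0 + 9 * y 2 / a ^ 2) - 2 * (y 3 + 27 * y 2 / a ^ 2)) / 15)]

/-- One minus the eigenvalues of the linearization of `singA` at the initial value. -/
def eigenWeight : Fin 4 → ℕ := ![2, 7, 1, 5]

/-- The linearization of `singA` at the initial value. -/
def linA (lam a : ℝ) (y : Fin 4 → ℝ) : Fin 4 → ℝ :=
  ![-5 * y 0 - 27 / a ^ 2 * y 2 + 2 / 3 * y 3,
    -81 * lam / a * y 0 - 4 * y 1 + 27 * lam / a * y 3, 0, 6 * y 0 - 2 * y 3]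

/-- The quadratic remainder of `singA` plus `regB`, divided by `t`, at `initVal + t y`; the last
argument stands for `1 / h₀`. -/
def remainder (lam a t : ℝ) (y : Fin 4 → ℝ) (w : ℝ) : Fin 4 → ℝ :=
  let h₁ := 27 / 4 * lam + t * y 1
  let h₂ := -(a ^ 3 / 27) + t * y 2
  let h₃ := 3 * a + t * y 3
  let h₄ := -h₃ - lam / 6 * (a + t * y 0) ^ 2
  ![(-(10 * a ^ 3 * y 0 ^ 2 + 10 * a ^ 2 * t * y 0 ^ 3 + 5 * a * t ^ 2 * y 0 ^ 4 +
        t ^ 3 * y 0 ^ 5) - (18 * a * y 2 * y 3 - a ^ 3 * y 3 ^ 2 / 9) - 3 * t * y 2 * y 3 ^ 2 -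
        (-5 * y 0 - 27 / a ^ 2 * y 2 + 2 / 3 * y 3) *
          (4 * a ^ 3 * y 0 + 6 * a ^ 2 * t * y 0 ^ 2 + 4 * a * t ^ 2 * y 0 ^ 3 +
            t ^ 3 * y 0 ^ 4)) * w ^ 4 -
      3 / 2 * w ^ 4 * ((h₃ - h₄) * (h₁ * h₂ + h₃ * h₄) - 2 * t ^ 2 * h₁ * h₄ ^ 2),
    lam * (9 * a * y 3 ^ 2 + t * y 3 ^ 3 - 27 * (3 * a * y 0 ^ 2 + t * y 0 ^ 3) -
        (-81 * y 0 + 27 * y 3) / a *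
          (3 * a ^ 2 * y 0 + 3 * a * t * y 0 ^ 2 + t ^ 2 * y 0 ^ 3)) * w ^ 3 +
      lam / 2 * w ^ 3 * (h₁ ^ 2 * h₂ - 3 * h₁ * h₃ * h₄),
    lam * w ^ 3 * (h₄ * (h₂ * h₃ - t ^ 2 * h₄ ^ 2) - 1 / 2 * h₂ * (h₁ * h₂ - h₃ * h₄)),
    lam / 2 * w ^ 3 * (h₁ * h₂ * h₃ + h₃ ^ 2 * h₄ - 2 * t ^ 2 * h₁ * h₄ ^ 2)]

theorem ofEigen_toEigen (lam a : ℝ) (y : Fin 4 → ℝ) : ofEigen lam a (toEigen lam a y) = y := by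
  funext i
  fin_cases i <;> simp [ofEigen, toEigen] <;> ring

theorem toEigen_ofEigen (lam a : ℝ) (u : Fin 4 → ℝ) : toEigen lam a (ofEigen lam a u) = u := by
  funext i
  fin_cases i <;> simp [ofEigen, toEigen] <;> ring

/-- The weights are one minus the eigenvalues since differentiating h = h(0) + t y produces the
extra term y; all of them are positive. -/
theorem linA_ofEigen {lam a : ℝ} (u : Fin 4 → ℝ) :
    linA lam a (ofEigen lam a u) = ofEigen lam a fun i => u i - eigenWeight i * u i := by
  funext i
  fin_cases i <;> simp [ofEigen, linA, eigenWeight] <;> ring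

/-- `singA` vanishes at the initial value, so dividing it by t leaves its linear part plus t times a
quadratic remainder, while `regB` has an explicit factor t. With 1/h₀ as a separate argument the
remainder is polynomial in t, y and w, hence smooth at t = 0. -/
theorem rhs_eq {lam a t : ℝ} (ha : a ≠ 0) (ht : t ≠ 0) (y h : Fin 4 → ℝ)
    (hy : h = initVal lam a + t • y) (hh : h 0 ≠ 0) :
    (1 / t) • singA lam h + regB lam h t =
      linA lam a y + t • remainder lam a t y (h 0)⁻¹ := by
  have e0 : h 0 = a + t * y 0 := by rw [hy]; rfl
  have e1 : h 1 = 27 / 4 * lam + t * y 1 := by rw [hy]; rfl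
  have e2 : h 2 = -(a ^ 3 / 27) + t * y 2 := by rw [hy]; rfl
  have e3 : h 3 = 3 * a + t * y 3 := by rw [hy]; rfl
  rw [e0] at hh
  funext i
  fin_cases i <;> simp [singA, regB, linA, remainder, hFour, e0, e1, e2, e3] <;> field_simp <;> ring

/-- The right-hand side of the singular system in the eigenvector coordinates. -/
def eigenRhs (lam a : ℝ) (p : ℝ × (Fin 4 → ℝ)) : Fin 4 → ℝ :=
  toEigen lam a (remainder lam a p.1 (ofEigen lam a p.2) (a + p.1 * ofEigen lam a p.2 0)⁻¹)

/-- The domain of `eigenRhs`. -/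
def eigenDom (lam a : ℝ) : Set (ℝ × (Fin 4 → ℝ)) := {p | a + p.1 * ofEigen lam a p.2 0 ≠ 0}

theorem contDiff_ofEigen (lam a : ℝ) : ContDiff ℝ ∞ (ofEigen lam a) := by
  refine contDiff_pi.2 fun i => ?_
  fin_cases i <;> simp [ofEigen] <;> fun_prop

theorem contDiff_toEigen (lam a : ℝ) : ContDiff ℝ ∞ (toEigen lam a) := by
  refine contDiff_pi.2 fun i => ?_
  fin_cases i <;> simp [toEigen] <;> fun_prop

theorem isOpen_eigenDom (lam a : ℝ) : IsOpen (eigenDom lam a) := by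
  refine isOpen_ne_fun ?_ continuous_const
  have := (contDiff_ofEigen lam a).continuous
  fun_prop

theorem contDiff_remainder (lam a : ℝ) :
    ContDiff ℝ ∞ fun p : ℝ × (Fin 4 → ℝ) × ℝ => remainder lam a p.1 p.2.1 p.2.2 := by
  refine contDiff_pi.2 fun i => ?_
  fin_cases i <;> simp [remainder] <;> fun_prop

attribute [local irreducible] remainder toEigen ofEigen in
theorem contDiffOn_eigenRhs (lam a : ℝ) : ContDiffOn ℝ ∞ (eigenRhs lam a) (eigenDom lam a) := by
  have h1 : ContDiff ℝ ∞ fun p : ℝ × (Fin 4 → ℝ) => ofEigen lam a p.2 :=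
    (contDiff_ofEigen lam a).comp contDiff_snd
  have h2 : ContDiffOn ℝ ∞ (fun p : ℝ × (Fin 4 → ℝ) => (a + p.1 * ofEigen lam a p.2 0)⁻¹)
      (eigenDom lam a) := by
    have h0 : ContDiff ℝ ∞ fun p : ℝ × (Fin 4 → ℝ) => ofEigen lam a p.2 0 := contDiff_pi.1 h1 0
    have h0' : ContDiff ℝ ∞ fun p : ℝ × (Fin 4 → ℝ) => a + p.1 * ofEigen lam a p.2 0 :=
      contDiff_const.add (contDiff_fst.mul h0)
    exact h0'.contDiffOn.inv fun p hp => hp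
  have h3 : ContDiffOn ℝ ∞ (fun p : ℝ × (Fin 4 → ℝ) =>
      (p.1, ofEigen lam a p.2, (a + p.1 * ofEigen lam a p.2 0)⁻¹)) (eigenDom lam a) :=
    contDiffOn_fst.prodMk (h1.contDiffOn.prodMk h2)
  have h4 : ContDiffOn ℝ ∞ (fun p : ℝ × (Fin 4 → ℝ) => remainder lam a p.1 (ofEigen lam a p.2)
      (a + p.1 * ofEigen lam a p.2 0)⁻¹) (eigenDom lam a) :=
    (contDiff_remainder lam a).comp_contDiffOn h3
  have h5 := (contDiff_toEigen lam a).comp_contDiffOn h4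
  exact h5

theorem ofEigen_add_smul (lam a c : ℝ) (u v : Fin 4 → ℝ) :
    ofEigen lam a (u + c • v) = ofEigen lam a u + c • ofEigen lam a v := by
  funext i
  fin_cases i <;> simp [ofEigen] <;> ring

theorem toEigen_add_smul (lam a c : ℝ) (u v : Fin 4 → ℝ) :
    toEigen lam a (u + c • v) = toEigen lam a u + c • toEigen lam a v := by
  funext i
  fin_cases i <;> simp [toEigen] <;> ring

theorem hasDerivAt_ofEigen (lam a : ℝ) {u : ℝ → Fin 4 → ℝ} {u' : Fin 4 → ℝ} {t : ℝ}
    (hu : ∀ i, HasDerivAt (fun s => u s i) (u' i) t) :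
    ∀ i, HasDerivAt (fun s => ofEigen lam a (u s) i) (ofEigen lam a u' i) t := by
  intro i
  fin_cases i <;> simp only [ofEigen, Fin.zero_eta, Fin.mk_one, Fin.reduceFinMk,
    Matrix.cons_val]
  · exact ((hu 0).add (hu 1)).sub (((hu 2).const_mul 9).div_const _)
  · exact (((hu 0).const_mul _).add ((hu 1).const_mul _)).add (hu 3)
  · exact hu 2
  · exact (((hu 0).const_mul _).sub ((hu 1).const_mul _)).sub (((hu 2).const_mul _).div_const _)

theorem hasDerivAt_toEigen (lam a : ℝ) {u : ℝ → Fin 4 → ℝ} {u' : Fin 4 → ℝ} {t : ℝ}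
    (hu : ∀ i, HasDerivAt (fun s => u s i) (u' i) t) :
    ∀ i, HasDerivAt (fun s => toEigen lam a (u s) i) (toEigen lam a u' i) t := by
  have h0 := (((hu 0).add (((hu 2).const_mul 9).div_const (a ^ 2))).const_mul 3).add
    (((hu 3).add (((hu 2).const_mul 27).div_const (a ^ 2))).const_mul 2) |>.div_const 15
  have h1 := (((hu 0).add (((hu 2).const_mul 9).div_const (a ^ 2))).const_mul 12).sub
    (((hu 3).add (((hu 2).const_mul 27).div_const (a ^ 2))).const_mul 2) |>.div_const 15
  intro i
  fin_cases i <;> simp only [toEigen, Fin.zero_eta, Fin.mk_one, Fin.reduceFinMk,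
    Matrix.cons_val]
  · exact h0
  · exact h1
  · exact hu 2
  · exact ((hu 1).sub (h0.const_mul _)).sub (h1.const_mul _)

/-- The substitution h = h(0) + t y in eigenvector coordinates reduces the claim to
`exists_singular_solution`. -/
theorem exists_isSingularSolution {lam a : ℝ} (ha : a ≠ 0) :
    ∃ ε : ℝ, 0 < ε ∧ ∃ h : ℝ → Fin 4 → ℝ, IsSingularSolution lam a ε h := by
  obtain ⟨ε, hε, u, hus, hu0, hU, hu⟩ := exists_singular_solution eigenWeight
    (isOpen_eigenDom lam a) (by simpa [eigenDom] using ha) (contDiffOn_eigenRhs lam a)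
  have h00 : ∀ t, (initVal lam a + t • ofEigen lam a (u t)) 0 =
      a + t * ofEigen lam a (u t) 0 := fun t => by simp [initVal]
  refine ⟨ε, hε, fun t => initVal lam a + t • ofEigen lam a (u t), ?_, ?_, ?_, ?_⟩
  · exact contDiffOn_const.add (contDiffOn_id.smul ((contDiff_ofEigen lam a).comp_contDiffOn hus))
  · intro t ht
    rw [h00]
    exact hU t ht
  · intro t ht ht0
    rw [rhs_eq ha ht0 (ofEigen lam a (u t)) _ rfl (by rw [h00]; exact hU t ht), hasDerivAt_pi]
    intro i
    have h1 := ((hasDerivAt_id t).mul (hasDerivAt_ofEigen lam a (hu t ht ht0) i)).const_add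
      (initVal lam a i)
    refine h1.congr_deriv ?_
    have e : (fun i => eigenRhs lam a (t, u t) i - eigenWeight i * (u t i / t)) =
        eigenRhs lam a (t, u t) + t⁻¹ • fun i => -(eigenWeight i * u t i) := by
      funext j; simp; ring
    have e2 : (fun i => u t i - eigenWeight i * u t i) =
        u t + (1 : ℝ) • fun i => -(eigenWeight i * u t i) := by
      funext j; simp; ring
    have e3 : ofEigen lam a (eigenRhs lam a (t, u t)) =
        remainder lam a t (ofEigen lam a (u t)) (a + t * ofEigen lam a (u t) 0)⁻¹ :=
      ofEigen_toEigen _ _ _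
    rw [e, ofEigen_add_smul, e3, linA_ofEigen, e2, ofEigen_add_smul, h00]
    simp only [id, Pi.add_apply, Pi.smul_apply, smul_eq_mul]
    field_simp
    ring
  · simp [initVal]

namespace IsSingularSolution

variable {lam a ε : ℝ} {h h' : ℝ → Fin 4 → ℝ}

/-- Since h₀ keeps the sign of a, the first components of two solutions can be joined by a segment
avoiding 0, as the Lipschitz estimate in the uniqueness proof requires. -/
theorem sign (hh : IsSingularSolution lam a ε h) {t : ℝ} (ht : t ∈ Ioo (-ε) ε) :
    0 < a * h t 0 := by
  have hε : (0 : ℝ) ∈ Ioo (-ε) ε := by constructor <;> linarith [ht.1, ht.2]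
  have hc : ContinuousOn (fun t => a * h t 0) (Ioo (-ε) ε) :=
    continuousOn_const.mul ((continuous_apply 0).comp_continuousOn hh.smooth.continuousOn)
  have h0 : h 0 0 = a := by simp [hh.init]
  have ha : a ≠ 0 := by
    have := hh.ne_zero 0 hε
    rwa [h0] at this
  by_contra hneg
  push Not at hneg
  have : (0 : ℝ) ∈ (fun t => a * h t 0) '' Ioo (-ε) ε :=
    isPreconnected_Ioo.intermediate_value ht hε hc ⟨hneg, by rw [h0]; exact (mul_self_pos.2 ha).le⟩
  obtain ⟨s, hs, hs0⟩ := this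
  exact (mul_ne_zero ha (hh.ne_zero s hs)) hs0

/-- In eigenvector coordinates, a solution satisfies a system to which
`singular_solution_unique` applies. -/
theorem exists_eigen (hh : IsSingularSolution lam a ε h) (hε : 0 < ε) :
    ∃ u : ℝ → Fin 4 → ℝ, ContDiffOn ℝ ∞ u (Ioo (-ε) ε) ∧ u 0 = 0 ∧
      (∀ t ∈ Ioo (-ε) ε, h t = initVal lam a + t • ofEigen lam a (u t)) ∧
      ∀ t ∈ Ioo (-ε) ε, t ≠ 0 → ∀ i, HasDerivAt (fun s => u s i)
        (eigenRhs lam a (t, u t) i - eigenWeight i * (u t i / t)) t := by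
  have hε0 : (0 : ℝ) ∈ Ioo (-ε) ε := ⟨by linarith, hε⟩
  have ha : a ≠ 0 := by
    have := hh.ne_zero 0 hε0
    rw [hh.init] at this
    simpa using this
  have hy : ∀ i, ∃ k : ℝ → ℝ, ContDiffOn ℝ ∞ k (Ioo (-ε) ε) ∧
      ∀ t ∈ Ioo (-ε) ε, h t i - initVal lam a i = t * k t := fun i =>
    exists_eq_mul_of_zero ((contDiffOn_pi.1 hh.smooth i).sub contDiffOn_const)
      (by rw [hh.init]; exact sub_self _)
  choose y hys hy using hy
  set Y : ℝ → Fin 4 → ℝ := fun t i => y i t with hY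
  have hYs : ContDiffOn ℝ ∞ Y (Ioo (-ε) ε) := contDiffOn_pi.2 hys
  set u : ℝ → Fin 4 → ℝ := fun t => toEigen lam a (Y t) with hu
  have hus : ContDiffOn ℝ ∞ u (Ioo (-ε) ε) := (contDiff_toEigen lam a).comp_contDiffOn hYs
  have hrep : ∀ t ∈ Ioo (-ε) ε, h t = initVal lam a + t • Y t := fun t ht => by
    funext i
    have := hy i t ht
    simp only [Pi.add_apply, Pi.smul_apply, smul_eq_mul, hY]
    linarith
  have hYu : ∀ t, ofEigen lam a (u t) = Y t := fun t => ofEigen_toEigen _ _ _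
  have hder : ∀ t ∈ Ioo (-ε) ε, t ≠ 0 → ∀ i, HasDerivAt (fun s => u s i)
        (eigenRhs lam a (t, u t) i - eigenWeight i * (u t i / t)) t := by
    intro t ht ht0
    have hode := hh.ode t ht ht0
    rw [rhs_eq ha ht0 (Y t) _ (hrep t ht) (hh.ne_zero t ht), hasDerivAt_pi] at hode
    have hY' : ∀ i, HasDerivAt (fun s => Y s i)
        ((remainder lam a t (Y t) (h t 0)⁻¹ + t⁻¹ • (linA lam a (Y t) + (-1 : ℝ) • Y t)) i) t := by
      intro i
      have h1 := ((hode i).sub_const (initVal lam a i)).div (hasDerivAt_id t) ht0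
      have e : (fun s => Y s i) =ᶠ[nhds t] fun s => (h s i - initVal lam a i) / s := by
        filter_upwards [isOpen_Ioo.mem_nhds ht, isOpen_ne.mem_nhds ht0] with s hs hs0
        have hs0' : s ≠ 0 := hs0
        rw [hy i s hs, mul_div_cancel_left₀ _ hs0']
      refine (h1.congr_of_eventuallyEq e).congr_deriv ?_
      rw [hy i t ht]
      simp only [id, Pi.add_apply, Pi.smul_apply, smul_eq_mul, hY]
      field_simp
      ring
    have h2 := hasDerivAt_toEigen lam a hY'
    intro i
    refine (h2 i).congr_deriv ?_
    have e1 : h t 0 = a + t * ofEigen lam a (u t) 0 := by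
      rw [hrep t ht, hYu]; simp [initVal]
    have e2 : linA lam a (Y t) + (-1 : ℝ) • Y t =
        ofEigen lam a (fun i => -(eigenWeight i * u t i)) := by
      rw [← hYu t, linA_ofEigen, ← ofEigen_add_smul]
      congr 1
      funext j; simp; ring
    rw [toEigen_add_smul, e2, toEigen_ofEigen, eigenRhs, hYu, e1, hYu]
    simp only [Pi.add_apply, Pi.smul_apply, smul_eq_mul]
    field_simp
    ring
  refine ⟨u, hus, ?_, fun t ht => by rw [hrep t ht, hYu], hder⟩
  have hmem : ∀ t ∈ Ioo (-ε) ε, (t, u t) ∈ eigenDom lam a := fun t ht => by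
    have := hh.ne_zero t ht
    rw [hrep t ht, ← hYu] at this
    simpa [eigenDom, initVal] using this
  have hKc : ContinuousOn (fun t => eigenRhs lam a (t, u t)) (Ioo (-ε) ε) :=
    (contDiffOn_eigenRhs lam a).continuousOn.comp
      (continuousOn_id.prodMk hus.continuousOn) hmem
  funext i
  have hui := contDiffOn_pi.1 hus i
  have hdc : ContinuousOn (deriv fun s => u s i) (Ioo (-ε) ε) :=
    hui.continuousOn_deriv_of_isOpen isOpen_Ioo (by simp)
  -- Multiplying the equation by t and letting t → 0 leaves n_i u_i(0) = 0. Every weight is nonzero,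
  -- so smoothness alone forces u(0) = 0.
  have hG : ContinuousOn (fun t => t * (eigenRhs lam a (t, u t) i - deriv (fun s => u s i) t) -
      eigenWeight i * u t i) (Ioo (-ε) ε) :=
    (continuousOn_id.mul (((continuous_apply i).comp_continuousOn hKc).sub hdc)).sub
      (continuousOn_const.mul hui.continuousOn)
  have h1 : Filter.Tendsto (fun t => t * (eigenRhs lam a (t, u t) i - deriv (fun s => u s i) t) -
      eigenWeight i * u t i) (nhdsWithin 0 {0}ᶜ) (nhds 0) := by
    refine tendsto_const_nhds.congr' ?_
    filter_upwards [self_mem_nhdsWithin,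
      mem_nhdsWithin_of_mem_nhds (isOpen_Ioo.mem_nhds hε0)] with s hs hs'
    have hs0 : s ≠ 0 := hs
    rw [(hder s hs' hs0 i).deriv]
    field_simp
    ring
  have h2 := tendsto_nhds_unique
    ((hG.continuousAt (isOpen_Ioo.mem_nhds hε0)).tendsto.mono_left nhdsWithin_le_nhds) h1
  simp only [zero_mul, zero_sub, neg_eq_zero, mul_eq_zero, Nat.cast_eq_zero] at h2
  rcases h2 with h2 | h2
  · exfalso
    revert h2
    fin_cases i <;> simp [eigenWeight]
  · simpa using h2

theorem eqOn_Ico (hh : IsSingularSolution lam a ε h) (hh' : IsSingularSolution lam a ε h') :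
    EqOn h h' (Ico 0 ε) := by
  rcases le_or_gt ε 0 with hε | hε
  · rw [Ico_eq_empty (by linarith)]; exact eqOn_empty _ _
  obtain ⟨u, hus, hu0, hu, hud⟩ := hh.exists_eigen hε
  obtain ⟨v, hvs, hv0, hv, hvd⟩ := hh'.exists_eigen hε
  have hsub : Ico 0 ε ⊆ Ioo (-ε) ε := fun t ht => ⟨by linarith [ht.1], ht.2⟩
  have hsub' : Ioo 0 ε ⊆ Ioo (-ε) ε := fun t ht => ⟨by linarith [ht.1], ht.2⟩
  have key := singular_solution_unique eigenWeight (isOpen_eigenDom lam a)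
    (contDiffOn_eigenRhs lam a) (hus.continuousOn.mono hsub) (hvs.continuousOn.mono hsub)
    (by rw [hu0, hv0]) ?_ (fun t ht => hud t (hsub' ht) ht.1.ne')
    (fun t ht => hvd t (hsub' ht) ht.1.ne')
  · intro t ht
    rw [hu t (hsub ht), hv t (hsub ht), key ht]
  · intro t ht s hs
    have h1 := hh.sign (hsub ht)
    have h2 := hh'.sign (hsub ht)
    have e1 : h t 0 = a + t * ofEigen lam a (u t) 0 := by rw [hu t (hsub ht)]; simp [initVal]
    have e2 : h' t 0 = a + t * ofEigen lam a (v t) 0 := by rw [hv t (hsub ht)]; simp [initVal]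
    -- Along the segment the quantity that must not vanish is a convex combination of the two values
    -- of h₀, which have the same sign.
    have e3 : a + t * ofEigen lam a (v t + s • (u t - v t)) 0 =
        (1 - s) * h' t 0 + s * h t 0 := by
      have : u t - v t = u t + (-1 : ℝ) • v t := by rw [neg_one_smul]; rfl
      rw [this, ofEigen_add_smul, ofEigen_add_smul, e1, e2]
      simp; ring
    intro h0
    rw [e3] at h0
    have : (1 - s) * (a * h' t 0) + s * (a * h t 0) = 0 := by
      linear_combination a * h0
    rcases hs.1.eq_or_lt with rfl | hs0
    · simp at this; rcases this with h | h <;> simp [h] at h2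
    · have := mul_pos hs0 h1
      have := mul_nonneg (sub_nonneg.2 hs.2) h2.le
      linarith

/-- A does not depend on t and B is odd in t, so the right-hand side is odd under t ↦ -t for fixed
h. -/
theorem comp_neg (hh : IsSingularSolution lam a ε h) :
    IsSingularSolution lam a ε fun t => h (-t) := by
  have hneg : ∀ t ∈ Ioo (-ε) ε, -t ∈ Ioo (-ε) ε :=
    fun t ht => ⟨by linarith [ht.2], by linarith [ht.1]⟩
  refine ⟨hh.smooth.comp contDiff_neg.contDiffOn hneg, fun t ht => hh.ne_zero _ (hneg t ht), ?_,
    by simpa using hh.init⟩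
  intro t ht ht0
  have h1 := (hh.ode (-t) (hneg t ht) (neg_ne_zero.2 ht0)).scomp t (hasDerivAt_neg t)
  refine h1.congr_deriv ?_
  funext i
  fin_cases i <;> simp [singA, regB] <;> ring

theorem eqOn (hh : IsSingularSolution lam a ε h) (hh' : IsSingularSolution lam a ε h') :
    EqOn h h' (Ioo (-ε) ε) := by
  intro t ht
  rcases le_or_gt 0 t with h0 | h0
  · exact hh.eqOn_Ico hh' ⟨h0, ht.2⟩
  · have := hh.comp_neg.eqOn_Ico hh'.comp_neg (x := -t) ⟨by linarith, by linarith [ht.1]⟩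
    simpa using this

theorem isEvenOn (hh : IsSingularSolution lam a ε h) : IsEvenOn ε h :=
  fun _ ht => hh.comp_neg.eqOn hh ht

end IsSingularSolution

end NearlyParallel
end

noncomputable section
namespace NearlyParallel

open scoped Matrix

/-! ### The standard `G₂`-form and its stabilizer -/

theorem elem_three (i j k : Fin 7) (v : Fin 3 → Fin 7 → ℝ) :
    elem ![i, j, k] v =
      v 0 i * (v 1 j * v 2 k - v 1 k * v 2 j) - v 0 j * (v 1 i * v 2 k - v 1 k * v 2 i) +
        v 0 k * (v 1 i * v 2 j - v 1 j * v 2 i) := by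
  have : elem ![i, j, k] v = Matrix.det (Matrix.of fun a b => v a (![i, j, k] b)) := rfl
  rw [this, Matrix.det_fin_three]
  simp
  ring

theorem elem_four (i j k l : Fin 7) (v : Fin 4 → Fin 7 → ℝ) :
    elem ![i, j, k, l] v =
      v 0 i * elem ![j, k, l] ![v 1, v 2, v 3] - v 0 j * elem ![i, k, l] ![v 1, v 2, v 3] +
        v 0 k * elem ![i, j, l] ![v 1, v 2, v 3] - v 0 l * elem ![i, j, k] ![v 1, v 2, v 3] := by
  have : elem ![i, j, k, l] v = Matrix.det (Matrix.of fun a b => v a (![i, j, k, l] b)) := rfl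
  rw [this, Matrix.det_succ_row_zero]
  simp only [elem_three, Fin.sum_univ_four, Matrix.det_fin_three]
  simp [Fin.succAbove]
  ring

/-- The cross product on `ℝ⁷` defined by `stdPhi`. -/
def cross (u v : Fin 7 → ℝ) : Fin 7 → ℝ :=
  ![u 1 * v 2 - u 2 * v 1 + u 3 * v 4 - u 4 * v 3 + u 5 * v 6 - u 6 * v 5,
    u 2 * v 0 - u 0 * v 2 + u 3 * v 5 - u 5 * v 3 - u 4 * v 6 + u 6 * v 4,
    u 0 * v 1 - u 1 * v 0 - u 3 * v 6 + u 6 * v 3 - u 4 * v 5 + u 5 * v 4,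
    u 4 * v 0 - u 0 * v 4 + u 5 * v 1 - u 1 * v 5 - u 6 * v 2 + u 2 * v 6,
    u 0 * v 3 - u 3 * v 0 - u 6 * v 1 + u 1 * v 6 - u 5 * v 2 + u 2 * v 5,
    u 6 * v 0 - u 0 * v 6 + u 1 * v 3 - u 3 * v 1 - u 2 * v 4 + u 4 * v 2,
    u 0 * v 5 - u 5 * v 0 - u 1 * v 4 + u 4 * v 1 - u 2 * v 3 + u 3 * v 2]

theorem dot_seven (u v : Fin 7 → ℝ) :
    u ⬝ᵥ v = u 0 * v 0 + u 1 * v 1 + u 2 * v 2 + u 3 * v 3 + u 4 * v 4 + u 5 * v 5 + u 6 * v 6 := by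
  simp [dotProduct, Fin.sum_univ_seven]

theorem stdPhi_apply (v : Fin 3 → Fin 7 → ℝ) : stdPhi v = cross (v 0) (v 1) ⬝ᵥ v 2 := by
  simp only [stdPhi, AlternatingMap.add_apply, AlternatingMap.sub_apply, elem_three, dot_seven]
  simp [cross]
  ring

set_option maxRecDepth 4000 in
-- Writing the 4-form through the cross and dot products alone makes its invariance a consequence of
-- theirs.
theorem stdPsi_apply (v : Fin 4 → Fin 7 → ℝ) :
    stdPsi v = cross (v 0) (v 1) ⬝ᵥ cross (v 2) (v 3) - (v 0 ⬝ᵥ v 2) * (v 1 ⬝ᵥ v 3) +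
      (v 0 ⬝ᵥ v 3) * (v 1 ⬝ᵥ v 2) := by
  simp only [stdPsi, AlternatingMap.add_apply, AlternatingMap.sub_apply, elem_four, elem_three,
    dot_seven]
  simp [cross]
  ring

theorem cross_dot_cross (u v w : Fin 7 → ℝ) :
    cross u v ⬝ᵥ cross u w = (u ⬝ᵥ u) * (v ⬝ᵥ w) - (u ⬝ᵥ v) * (u ⬝ᵥ w) := by
  simp only [dot_seven]
  simp [cross]
  ring

/-- The matrix of `cross u`. -/
def crossMat (u : Fin 7 → ℝ) : Matrix (Fin 7) (Fin 7) ℝ :=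
  !![0, -u 2, u 1, -u 4, u 3, -u 6, u 5;
    u 2, 0, -u 0, -u 5, u 6, u 3, -u 4;
    -u 1, u 0, 0, u 6, u 5, -u 4, -u 3;
    u 4, u 5, -u 6, 0, -u 0, -u 1, u 2;
    -u 3, -u 6, -u 5, u 0, 0, u 2, u 1;
    u 6, -u 3, u 4, u 1, -u 2, 0, -u 0;
    -u 5, u 4, u 3, -u 2, -u 1, u 0, 0]

theorem crossMat_mulVec (u v : Fin 7 → ℝ) : crossMat u *ᵥ v = cross u v := by
  funext i
  rw [Matrix.mulVec, dot_seven]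
  fin_cases i <;> simp [crossMat, cross] <;> ring

theorem crossMat_mulVec_self (u : Fin 7 → ℝ) : crossMat u *ᵥ u = 0 := by
  rw [crossMat_mulVec]
  funext i
  fin_cases i <;> simp [cross] <;> ring

theorem transpose_crossMat (u : Fin 7 → ℝ) : (crossMat u)ᵀ = -crossMat u := by
  ext i j
  fin_cases i <;> fin_cases j <;> simp [crossMat]

theorem vecMul_crossMat_self (u : Fin 7 → ℝ) : u ᵥ* crossMat u = 0 := by
  have := Matrix.vecMul_transpose (crossMat u) u
  rw [transpose_crossMat, crossMat_mulVec_self, Matrix.vecMul_neg, neg_eq_zero] at this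
  exact this

/-- `crossMat u` is skew, so this is the identity `cross_dot_cross` in matrix form. -/
theorem crossMat_mul_self (u : Fin 7 → ℝ) :
    crossMat u * crossMat u = -(u ⬝ᵥ u) • (1 : Matrix (Fin 7) (Fin 7) ℝ) + Matrix.vecMulVec u u := by
  have key : ∀ v w, (crossMat u * crossMat u) *ᵥ v ⬝ᵥ w =
      (-(u ⬝ᵥ u) • (1 : Matrix (Fin 7) (Fin 7) ℝ) + Matrix.vecMulVec u u) *ᵥ v ⬝ᵥ w := by
    intro v w
    have h1 : (crossMat u * crossMat u) *ᵥ v ⬝ᵥ w = -(cross u v ⬝ᵥ cross u w) := by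
      rw [← Matrix.mulVec_mulVec, dotProduct_comm, Matrix.dotProduct_mulVec,
        ← Matrix.mulVec_transpose, transpose_crossMat, Matrix.neg_mulVec, neg_dotProduct,
        crossMat_mulVec, crossMat_mulVec, dotProduct_comm]
    rw [h1, cross_dot_cross, Matrix.add_mulVec, Matrix.smul_mulVec, Matrix.one_mulVec,
      Matrix.vecMulVec_mulVec, add_dotProduct, smul_dotProduct]
    simp only [smul_eq_mul, op_smul_eq_smul, smul_dotProduct]
    ring
  ext i j
  simpa using key (Pi.single j 1) (Pi.single i 1)

theorem det_one_add_vecMulVec (u v : Fin 7 → ℝ) :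
    (1 + Matrix.vecMulVec u v).det = 1 + v ⬝ᵥ u := by
  rw [Matrix.vecMulVec_eq (ι := Unit), Matrix.det_one_add_replicateCol_mul_replicateRow]

/-- The product of the matrix with its transpose is |u|² times a rank one perturbation of the
identity, since `crossMat u` and u uᵀ annihilate each other. -/
theorem det_crossMat_add_sq (u : Fin 7 → ℝ) (s : ℝ) (hu : u ⬝ᵥ u ≠ 0) :
    (crossMat u + s • Matrix.vecMulVec u u).det ^ 2 = s ^ 2 * (u ⬝ᵥ u) ^ 8 := by
  set U := Matrix.vecMulVec u u with hU
  set r := u ⬝ᵥ u with hr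
  have hXU : crossMat u * U = 0 := by
    rw [hU, Matrix.mul_vecMulVec, crossMat_mulVec_self, Matrix.zero_vecMulVec]
  have hUX : U * crossMat u = 0 := by
    rw [hU, Matrix.vecMulVec_mul, vecMul_crossMat_self, Matrix.vecMulVec_zero]
  have hUU : U * U = r • U := by
    rw [hU, Matrix.vecMulVec_mul_vecMulVec, ← hr, Matrix.vecMulVec_smul]
  have hprod : (crossMat u + s • U) * (crossMat u + s • U)ᵀ =
      r • (1 + Matrix.vecMulVec ((s ^ 2 - r⁻¹) • u) u) := by
    rw [Matrix.transpose_add, Matrix.transpose_smul, transpose_crossMat, hU,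
      Matrix.transpose_vecMulVec, ← hU, Matrix.add_mul, Matrix.mul_add, Matrix.mul_add,
      Matrix.mul_neg, Matrix.smul_mul, Matrix.smul_mul, Matrix.mul_neg, Matrix.mul_smul,
      Matrix.mul_smul, hXU, hUX, hUU, crossMat_mul_self, ← hr, ← hU, Matrix.smul_vecMulVec, ← hU,
      smul_add, smul_smul, smul_smul, smul_smul, mul_sub, mul_inv_cancel₀ hu, sub_smul, one_smul]
    simp only [smul_zero, neg_zero, neg_smul]
    rw [show r * s ^ 2 = s * s * r by ring, mul_assoc]
    abel
  have h := congrArg Matrix.det hprod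
  rw [Matrix.det_mul, Matrix.det_transpose, Matrix.det_smul, det_one_add_vecMulVec,
    dotProduct_smul, ← hr, Fintype.card_fin, smul_eq_mul] at h
  rw [sq, h]
  field_simp
  ring

/-- A shear 1 + u ζᵀ of determinant one leaves `crossMat u` unchanged, because u is in its kernel,
and ζ can be chosen so that its transpose carries w to the multiple α u. This reduces to w parallel
to u. -/
theorem det_crossMat_add_vecMulVec_sq (u w : Fin 7 → ℝ) (hw : u ⬝ᵥ w ≠ 0) :
    (crossMat u + Matrix.vecMulVec w w).det ^ 2 = (u ⬝ᵥ w) ^ 4 * (u ⬝ᵥ u) ^ 4 := by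
  have hu : u ⬝ᵥ u ≠ 0 := fun h => hw (by rw [dotProduct_self_eq_zero.1 h, zero_dotProduct])
  set α := (u ⬝ᵥ w) / (u ⬝ᵥ u) with hα
  set ζ := (u ⬝ᵥ w)⁻¹ • (α • u - w) with hζ
  set T := 1 + Matrix.vecMulVec u ζ with hT
  have hζu : ζ ⬝ᵥ u = 0 := by
    rw [hζ, smul_dotProduct, sub_dotProduct, smul_dotProduct, dotProduct_comm w, hα, smul_eq_mul,
      smul_eq_mul, div_mul_cancel₀ _ hu, sub_self, mul_zero]
  have hdT : T.det = 1 := by rw [hT, det_one_add_vecMulVec, hζu, add_zero]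
  have hXT : crossMat u * T = crossMat u := by
    rw [hT, Matrix.mul_add, Matrix.mul_one, Matrix.mul_vecMulVec, crossMat_mulVec_self,
      Matrix.zero_vecMulVec, add_zero]
  have hTX : Tᵀ * crossMat u = crossMat u := by
    have := congrArg Matrix.transpose hXT
    rw [Matrix.transpose_mul, transpose_crossMat, Matrix.mul_neg, neg_inj] at this
    exact this
  have hTw : Tᵀ *ᵥ w = α • u := by
    rw [hT, Matrix.transpose_add, Matrix.transpose_one, Matrix.transpose_vecMulVec,
      Matrix.add_mulVec, Matrix.one_mulVec, Matrix.vecMulVec_mulVec, hζ]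
    rw [op_smul_eq_smul, smul_smul, mul_inv_cancel₀ hw, one_smul]
    abel
  have hwT : w ᵥ* T = α • u := by rw [← hTw, Matrix.mulVec_transpose]
  clear_value T
  have hconj : Tᵀ * (crossMat u + Matrix.vecMulVec w w) * T =
      crossMat u + (α ^ 2) • Matrix.vecMulVec u u := by
    rw [Matrix.mul_add, Matrix.add_mul, hTX, hXT, Matrix.mul_vecMulVec, Matrix.vecMulVec_mul, hTw,
      hwT, Matrix.smul_vecMulVec, Matrix.vecMulVec_smul, smul_smul, sq]
  have h := congrArg Matrix.det hconj
  rw [Matrix.det_mul, Matrix.det_mul, Matrix.det_transpose, hdT, one_mul, mul_one] at h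
  rw [h, det_crossMat_add_sq u _ hu, hα]
  field_simp

/-- A linear endomorphism of `ℝ⁷` preserving `stdPhi` is orthogonal. -/
theorem dot_of_stdPhi_comp {A : (Fin 7 → ℝ) →ₗ[ℝ] (Fin 7 → ℝ)}
    (hA : stdPhi.compLinearMap A = stdPhi) (u v : Fin 7 → ℝ) : A u ⬝ᵥ A v = u ⬝ᵥ v := by
  have hc : ∀ u v w, cross (A u) (A v) ⬝ᵥ A w = cross u v ⬝ᵥ w := by
    intro u v w
    have := DFunLike.congr_fun hA ![u, v, w]
    rw [AlternatingMap.compLinearMap_apply, stdPhi_apply, stdPhi_apply] at this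
    simpa using this
  set a := LinearMap.toMatrix' A with ha
  have haA : ∀ u, a *ᵥ u = A u := fun u => LinearMap.toMatrix'_mulVec A u
  have hX : ∀ u, aᵀ * crossMat (A u) * a = crossMat u := by
    intro u
    ext i j
    have h := hc u (Pi.single j 1) (Pi.single i 1)
    rw [← crossMat_mulVec, ← crossMat_mulVec, ← haA (Pi.single j 1), ← haA (Pi.single i 1),
      Matrix.mulVec_mulVec, dotProduct_comm, ← Matrix.vecMul_transpose, ← Matrix.dotProduct_mulVec,
      Matrix.mulVec_mulVec, ← Matrix.mul_assoc] at h
    simpa using h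
  -- If A u = 0 then `crossMat u` vanishes, but the trace of its square is -6 |u|².
  have hAne : ∀ u, u ⬝ᵥ u ≠ 0 → A u ⬝ᵥ A u ≠ 0 := by
    intro u hu h
    have h0 : A u = 0 := dotProduct_self_eq_zero.1 h
    have h1 := hX u
    have h2 : crossMat (A u) = 0 := by
      rw [h0]; ext i j; fin_cases i <;> fin_cases j <;> simp [crossMat]
    rw [h2, Matrix.mul_zero, Matrix.zero_mul] at h1
    have h3 := crossMat_mul_self u
    rw [← h1, Matrix.mul_zero] at h3
    have h4 := congrArg Matrix.trace h3
    rw [Matrix.trace_add, Matrix.trace_smul, Matrix.trace_one, Matrix.trace_zero,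
      Matrix.trace_vecMulVec] at h4
    simp only [Fintype.card_fin, smul_eq_mul] at h4
    norm_num at h4
    apply hu; linarith
  -- Adding (A u)(A u)ᵀ makes the singular matrix of the cross product invertible. Comparing
  -- determinants after conjugation by A, with w = Aᵀ A u and u · w = |A u|², yields det(A)⁴ |A u|⁸
  -- = |u|⁸.
  have hnorm : ∀ u, |a.det| * (A u ⬝ᵥ A u) = u ⬝ᵥ u := by
    intro u
    have hpos : ∀ x : Fin 7 → ℝ, 0 ≤ x ⬝ᵥ x := fun x => by
      rw [dotProduct]; exact Finset.sum_nonneg fun i _ => mul_self_nonneg _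
    by_cases hu : u ⬝ᵥ u = 0
    · rw [dotProduct_self_eq_zero.1 hu]; simp
    have hAu := hAne u hu
    set w := aᵀ *ᵥ A u with hw
    have hwa : A u ᵥ* a = w := by rw [hw, Matrix.mulVec_transpose]
    have huw : u ⬝ᵥ w = A u ⬝ᵥ A u := by
      rw [hw, Matrix.dotProduct_mulVec, Matrix.vecMul_transpose, haA]
    have h1 : aᵀ * (crossMat (A u) + Matrix.vecMulVec (A u) (A u)) * a =
        crossMat u + Matrix.vecMulVec w w := by
      rw [Matrix.mul_add, Matrix.add_mul, hX, Matrix.mul_vecMulVec, Matrix.vecMulVec_mul, hwa]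
    have h2 := congrArg Matrix.det h1
    rw [Matrix.det_mul, Matrix.det_mul, Matrix.det_transpose] at h2
    have h3 := det_crossMat_add_vecMulVec_sq u w (by rwa [huw])
    rw [← h2, mul_pow, mul_pow, det_crossMat_add_vecMulVec_sq (A u) (A u) hAu, huw] at h3
    have h4 : (|a.det| * (A u ⬝ᵥ A u)) ^ 4 = (u ⬝ᵥ u) ^ 4 := by
      have h5 : |a.det| ^ 4 = a.det ^ 4 := by
        rw [show 4 = 2 * 2 by norm_num, pow_mul, sq_abs, ← pow_mul]
      rw [mul_pow, h5]
      refine mul_left_cancel₀ (pow_ne_zero 4 hAu) ?_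
      linear_combination h3
    exact (pow_left_inj₀ (mul_nonneg (abs_nonneg _) (hpos _)) (hpos _) (by norm_num)).1 h4
  have hinner : ∀ u v, |a.det| * (A u ⬝ᵥ A v) = u ⬝ᵥ v := by
    intro u v
    have h1 := hnorm (u + v)
    have h2 := hnorm u
    have h3 := hnorm v
    simp only [map_add, add_dotProduct, dotProduct_add] at h1
    rw [dotProduct_comm (A v), dotProduct_comm v u] at h1
    linarith
  have hmat : |a.det| • (aᵀ * a) = 1 := by
    ext i j
    have h := hinner (Pi.single i 1) (Pi.single j 1)
    rw [← haA, ← haA, Matrix.dotProduct_mulVec, ← Matrix.mulVec_transpose, Matrix.mulVec_mulVec,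
      dotProduct_comm, ← smul_eq_mul, ← dotProduct_smul, ← Matrix.smul_mulVec] at h
    have hs : (|a.det| • (aᵀ * a))ᵀ = |a.det| • (aᵀ * a) := by
      rw [Matrix.transpose_smul, Matrix.transpose_mul, Matrix.transpose_transpose]
    rw [← hs, Matrix.transpose_apply]
    simpa [Matrix.one_apply, Pi.single_apply, eq_comm] using h
  -- In dimension seven the determinant of |det A| AᵀA = 1 reads |det A|⁹ = 1.
  have hdet : |a.det| = 1 := by
    have h := congrArg Matrix.det hmat
    rw [Matrix.det_smul, Matrix.det_mul, Matrix.det_transpose, Matrix.det_one, Fintype.card_fin,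
      ← sq, ← sq_abs, ← pow_add] at h
    exact (pow_eq_one_iff_of_nonneg (abs_nonneg _) (by norm_num)).1 h
  have := hinner u v
  rwa [hdet, one_mul] at this

/-- A linear endomorphism of `ℝ⁷` preserving `stdPhi` preserves `stdPsi`. -/
theorem stdPsi_comp {A : (Fin 7 → ℝ) →ₗ[ℝ] (Fin 7 → ℝ)}
    (hA : stdPhi.compLinearMap A = stdPhi) : stdPsi.compLinearMap A = stdPsi := by
  have hdot := dot_of_stdPhi_comp hA
  have hinj : Function.Injective A := by
    rw [← LinearMap.ker_eq_bot, LinearMap.ker_eq_bot']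
    intro x hx
    have := hdot x x
    rw [hx, zero_dotProduct] at this
    exact dotProduct_self_eq_zero.1 this.symm
  have hsurj : Function.Surjective A := LinearMap.injective_iff_surjective.1 hinj
  -- Orthogonality identifies the 3-form with the cross product, so A commutes with the latter.
  have hcross : ∀ u v, cross (A u) (A v) = A (cross u v) := by
    intro u v
    obtain ⟨x, hx⟩ := hsurj (cross (A u) (A v))
    rw [← hx]
    congr 1
    have h1 : ∀ w, (x - cross u v) ⬝ᵥ w = 0 := by
      intro w
      have := DFunLike.congr_fun hA ![u, v, w]
      rw [AlternatingMap.compLinearMap_apply, stdPhi_apply, stdPhi_apply] at this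
      simp only [Matrix.cons_val] at this
      rw [← hx, hdot] at this
      rw [sub_dotProduct, this, sub_self]
    exact sub_eq_zero.1 (dotProduct_self_eq_zero.1 (h1 _))
  ext v
  rw [AlternatingMap.compLinearMap_apply, stdPsi_apply, stdPsi_apply]
  simp only [hcross, hdot]

end NearlyParallel
end

noncomputable section
namespace NearlyParallel

open scoped Matrix

/-! ### Normal form of the forms `invForm` -/

theorem invForm_apply (f₀ f₁ f₂ f₃ f₄ : ℝ) (v : Fin 3 → Fin 7 → ℝ) :
    invForm f₀ f₁ f₂ f₃ f₄ v =
      f₀ * (elem ![0, 1, 4] v + elem ![0, 2, 5] v + elem ![0, 3, 6] v) + f₁ * elem ![1, 2, 3] v +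
        f₂ * elem ![4, 5, 6] v +
        f₃ * (elem ![1, 2, 6] v - elem ![1, 3, 5] v + elem ![2, 3, 4] v) +
        f₄ * (elem ![1, 5, 6] v - elem ![2, 4, 6] v + elem ![3, 4, 5] v) := rfl

/-- The `4`-form dual to `invForm` for suitable values of the coefficients. -/
def fourForm (c g₁ g₂ g₃ g₄ : ℝ) : (Fin 7 → ℝ) [⋀^Fin 4]→ₗ[ℝ] ℝ :=
  c • (elem ![1, 4, 2, 5] + elem ![1, 4, 3, 6] + elem ![2, 5, 3, 6])
    - (g₁ • elem ![0, 1, 2, 3] + g₂ • elem ![0, 4, 5, 6]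
      + g₃ • (elem ![0, 1, 2, 6] - elem ![0, 1, 3, 5] + elem ![0, 2, 3, 4])
      + g₄ • (elem ![0, 1, 5, 6] - elem ![0, 2, 4, 6] + elem ![0, 3, 4, 5]))

theorem fourForm_apply (c g₁ g₂ g₃ g₄ : ℝ) (v : Fin 4 → Fin 7 → ℝ) :
    fourForm c g₁ g₂ g₃ g₄ v =
      c * (elem ![1, 4, 2, 5] v + elem ![1, 4, 3, 6] v + elem ![2, 5, 3, 6] v)
    - (g₁ * elem ![0, 1, 2, 3] v + g₂ * elem ![0, 4, 5, 6] v
      + g₃ * (elem ![0, 1, 2, 6] v - elem ![0, 1, 3, 5] v + elem ![0, 2, 3, 4] v)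
      + g₄ * (elem ![0, 1, 5, 6] v - elem ![0, 2, 4, 6] v + elem ![0, 3, 4, 5] v)) := rfl

/-- The linear map `y ↦ (y₀, z₁, z₂, z₃)`, with `zₖ = a yₖ + b y₃₊ₖ` in `ℂ = ℝ²`. -/
def normalMap (a b : ℂ) : (Fin 7 → ℝ) →ₗ[ℝ] (Fin 7 → ℝ) where
  toFun y := ![y 0, a.re * y 1 + b.re * y 4, a.im * y 1 + b.im * y 4,
    a.re * y 2 + b.re * y 5, a.im * y 2 + b.im * y 5,
    a.re * y 3 + b.re * y 6, a.im * y 3 + b.im * y 6]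
  map_add' x y := by
    funext i; fin_cases i <;> simp <;> ring
  map_smul' c y := by
    funext i; fin_cases i <;> simp <;> ring

theorem normalMap_apply (a b : ℂ) (y : Fin 7 → ℝ) :
    normalMap a b y = ![y 0, a.re * y 1 + b.re * y 4, a.im * y 1 + b.im * y 4,
      a.re * y 2 + b.re * y 5, a.im * y 2 + b.im * y 5,
      a.re * y 3 + b.re * y 6, a.im * y 3 + b.im * y 6] := rfl

/-- Here `stdPhi` is e¹ ∧ ω + Re(dz₁ ∧ dz₂ ∧ dz₃), while `stdPsi` is ω²/2 - e¹ ∧ Im(dz₁ ∧ dz₂ ∧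
dz₃). Substituting z = a y + b y' turns the coefficients into real and imaginary parts of cubic
monomials in a and b, and multiplies ω by Im(ā b). -/
theorem stdPhi_comp_normalMap (a b : ℂ) :
    stdPhi.compLinearMap (normalMap a b) =
      invForm (a.re * b.im - a.im * b.re) (a ^ 3).re (b ^ 3).re (a ^ 2 * b).re (a * b ^ 2).re := by
  ext v
  have h1 : (a ^ 3).re = a.re ^ 3 - 3 * a.re * a.im ^ 2 := by
    simp only [pow_succ, pow_zero, one_mul, Complex.mul_re, Complex.mul_im]; ring
  have h2 : (b ^ 3).re = b.re ^ 3 - 3 * b.re * b.im ^ 2 := by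
    simp only [pow_succ, pow_zero, one_mul, Complex.mul_re, Complex.mul_im]; ring
  have h3 : (a ^ 2 * b).re = (a.re ^ 2 - a.im ^ 2) * b.re - 2 * a.re * a.im * b.im := by
    simp only [pow_succ, pow_zero, one_mul, Complex.mul_re, Complex.mul_im]; ring
  have h4 : (a * b ^ 2).re = (b.re ^ 2 - b.im ^ 2) * a.re - 2 * b.re * b.im * a.im := by
    simp only [pow_succ, pow_zero, one_mul, Complex.mul_re, Complex.mul_im]; ring
  rw [h1, h2, h3, h4, AlternatingMap.compLinearMap_apply, invForm_apply]
  simp only [stdPhi, AlternatingMap.add_apply, AlternatingMap.sub_apply, elem_three,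
    normalMap_apply, Matrix.cons_val]
  ring

set_option maxHeartbeats 1000000 in
theorem stdPsi_comp_normalMap (a b : ℂ) :
    stdPsi.compLinearMap (normalMap a b) =
      fourForm ((a.re * b.im - a.im * b.re) ^ 2) (a ^ 3).im (b ^ 3).im (a ^ 2 * b).im
        (a * b ^ 2).im := by
  ext v
  have h1 : (a ^ 3).im = 3 * a.re ^ 2 * a.im - a.im ^ 3 := by
    simp only [pow_succ, pow_zero, one_mul, Complex.mul_re, Complex.mul_im]; ring
  have h2 : (b ^ 3).im = 3 * b.re ^ 2 * b.im - b.im ^ 3 := by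
    simp only [pow_succ, pow_zero, one_mul, Complex.mul_re, Complex.mul_im]; ring
  have h3 : (a ^ 2 * b).im = (a.re ^ 2 - a.im ^ 2) * b.im + 2 * a.re * a.im * b.re := by
    simp only [pow_succ, pow_zero, one_mul, Complex.mul_re, Complex.mul_im]; ring
  have h4 : (a * b ^ 2).im = (b.re ^ 2 - b.im ^ 2) * a.im + 2 * b.re * b.im * a.re := by
    simp only [pow_succ, pow_zero, one_mul, Complex.mul_re, Complex.mul_im]; ring
  rw [h1, h2, h3, h4, AlternatingMap.compLinearMap_apply, fourForm_apply]
  simp only [stdPsi, AlternatingMap.add_apply, AlternatingMap.sub_apply, elem_four, elem_three,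
    normalMap_apply, Matrix.cons_val]
  ring

theorem normalMap_injective {a b : ℂ} (h : a.re * b.im - a.im * b.re ≠ 0) :
    Function.Injective (normalMap a b) := by
  rw [← LinearMap.ker_eq_bot, LinearMap.ker_eq_bot']
  intro y hy
  have h0 := congrFun hy 0
  have h1 := congrFun hy 1
  have h2 := congrFun hy 2
  have h3 := congrFun hy 3
  have h4 := congrFun hy 4
  have h5 := congrFun hy 5
  have h6 := congrFun hy 6
  simp only [normalMap_apply, Matrix.cons_val, Pi.zero_apply] at h0 h1 h2 h3 h4 h5 h6
  have e1 : y 1 = 0 := mul_left_cancel₀ h (by linear_combination b.im * h1 - b.re * h2)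
  have e4 : y 4 = 0 := mul_left_cancel₀ h (by linear_combination a.re * h2 - a.im * h1)
  have e2 : y 2 = 0 := mul_left_cancel₀ h (by linear_combination b.im * h3 - b.re * h4)
  have e5 : y 5 = 0 := mul_left_cancel₀ h (by linear_combination a.re * h4 - a.im * h3)
  have e3 : y 3 = 0 := mul_left_cancel₀ h (by linear_combination b.im * h5 - b.re * h6)
  have e6 : y 6 = 0 := mul_left_cancel₀ h (by linear_combination a.re * h6 - a.im * h5)
  funext i
  fin_cases i <;> simp [h0, e1, e2, e3, e4, e5, e6]

/-- The coefficients of the `4`-form dual to `invForm f₀ f₁ f₂ f₃ f₄` are `dualCoeff f₀` evaluated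
at `(f₁, f₂, f₃, f₄)` and, up to sign, at `(f₂, f₁, f₄, f₃)`. -/
def dualCoeff (f₀ f₁ f₂ f₃ f₄ : ℝ) : ℝ :=
  -(f₁ ^ 2 * f₂ - 3 * f₁ * f₃ * f₄ + 2 * f₃ ^ 3) / (2 * f₀ ^ 3)

/-- See `dualCoeff`. -/
def dualCoeff' (f₀ f₁ f₂ f₃ f₄ : ℝ) : ℝ :=
  -(f₁ * f₂ * f₃ + f₃ ^ 2 * f₄ - 2 * f₁ * f₄ ^ 2) / (2 * f₀ ^ 3)

/-- The imaginary parts of the cubic monomials are, after multiplication by f₀³, polynomials in the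
real parts: they are the coefficients of the cubic covariant. Hence the dual form does not depend on
the choice of a and b. -/
theorem dualCoeff_normal {a b : ℂ} {f₀ f₁ f₂ f₃ f₄ : ℝ} (h0 : a.re * b.im - a.im * b.re = f₀)
    (h1 : (a ^ 3).re = f₁) (h2 : (b ^ 3).re = f₂) (h3 : (a ^ 2 * b).re = f₃)
    (h4 : (a * b ^ 2).re = f₄) (hf : f₀ ≠ 0) :
    dualCoeff f₀ f₁ f₂ f₃ f₄ = (a ^ 3).im ∧ -dualCoeff f₀ f₂ f₁ f₄ f₃ = (b ^ 3).im ∧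
      dualCoeff' f₀ f₁ f₂ f₃ f₄ = (a ^ 2 * b).im ∧
      -dualCoeff' f₀ f₂ f₁ f₄ f₃ = (a * b ^ 2).im := by
  subst h0 h1 h2 h3 h4
  obtain ⟨x, y⟩ := a
  obtain ⟨z, w⟩ := b
  simp only [dualCoeff, dualCoeff', ← neg_div] at *
  simp only [pow_succ, pow_zero, one_mul, Complex.mul_re, Complex.mul_im] at *
  refine ⟨?_, ?_, ?_, ?_⟩ <;> rw [div_eq_iff (by positivity)] <;> ring

/-- A real binary cubic form with definite Hessian is the real part of the cube of a complex
linear form. -/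
theorem exists_normal {f₀ f₁ f₂ f₃ f₄ : ℝ} (hf : f₀ ≠ 0)
    (hΔ : 4 * (f₃ ^ 2 - f₁ * f₄) * (f₄ ^ 2 - f₂ * f₃) - (f₃ * f₄ - f₁ * f₂) ^ 2 = 4 * f₀ ^ 6) :
    ∃ a b : ℂ, a.re * b.im - a.im * b.re = f₀ ∧ (a ^ 3).re = f₁ ∧ (b ^ 3).re = f₂ ∧
      (a ^ 2 * b).re = f₃ ∧ (a * b ^ 2).re = f₄ := by
  set p := f₃ ^ 2 - f₁ * f₄ with hp
  set q := f₄ ^ 2 - f₂ * f₃ with hq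
  set m := f₃ * f₄ - f₁ * f₂ with hm
  have hf6 : 0 < f₀ ^ 6 := by positivity
  have hpq : m ^ 2 < 4 * p * q := by linarith
  have hpq0 : 0 < p * q := by nlinarith [sq_nonneg m]
  -- The discriminant makes the Hessian definite. Were it negative, the syzygy p f₄ + q f₁ = m f₃
  -- would bound a square by 4 p² q < 0.
  have hpos : 0 < p := by
    by_contra hneg
    have hp' : p < 0 := lt_of_le_of_ne (not_lt.1 hneg) fun h => by rw [h] at hpq0; simp at hpq0
    have hq' : q < 0 := by nlinarith
    have hsyz : p * f₄ + q * f₁ = m * f₃ := by rw [hp, hq, hm]; ring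
    have h1 : (p * f₄ - q * f₁) ^ 2 + 4 * (p * q) * (f₁ * f₄) = (m * f₃) ^ 2 := by
      rw [← hsyz]; ring
    have h2 : (m * f₃) ^ 2 ≤ 4 * (p * q) * f₃ ^ 2 := by
      rw [mul_pow]; nlinarith [sq_nonneg f₃]
    have h3 : 4 * (p * q) * p = 4 * (p * q) * f₃ ^ 2 - 4 * (p * q) * (f₁ * f₄) := by rw [hp]; ring
    nlinarith [sq_nonneg (p * f₄ - q * f₁), mul_pos hpq0 (neg_pos.2 hp')]
  -- the Hessian
  set s := Real.sqrt p with hs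
  have hs0 : 0 < s := Real.sqrt_pos.2 hpos
  have hsp : s ^ 2 = p := Real.sq_sqrt hpos.le
  -- `α = (s / f₀)²`, `β = m / (2 f₀²)`
  set r := s / f₀ with hr
  have hr0 : r ≠ 0 := div_ne_zero hs0.ne' hf
  set β := m / (2 * f₀ ^ 2) with hβ
  -- For a cubic of the required type p = |a|² f₀² and m = 2 Re(ā b) f₀². Up to a common phase ζ
  -- this gives a = r and b = (β + i f₀)/r. The values f₁ and f₃ then determine ζ³ = c₁ + i c₂.
  set b₀ : ℂ := ⟨β / r, f₀ / r⟩ with hb₀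
  set c₁ := f₁ / r ^ 3 with hc₁
  set c₂ := (c₁ * β - f₃ / r) / f₀ with hc₂
  have hrp : r ^ 2 * f₀ ^ 2 = p := by rw [hr, div_pow, div_mul_cancel₀ _ (by positivity), hsp]
  have hβm : 2 * f₀ ^ 2 * β = m := by rw [hβ]; field_simp
  have e1 : c₁ * r ^ 3 = f₁ := by rw [hc₁]; field_simp
  have e2 : r * (c₁ * β - c₂ * f₀) = f₃ := by rw [hc₂]; field_simp; ring
  clear_value r β c₁ c₂
  have hf2 : f₀ ^ 2 ≠ 0 := pow_ne_zero 2 hf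
  have hr2 : r ^ 2 ≠ 0 := pow_ne_zero 2 hr0
  have hqr : q * r ^ 2 = f₀ ^ 2 * (β ^ 2 + f₀ ^ 2) := by
    refine mul_left_cancel₀ hf2 (mul_left_cancel₀ (four_ne_zero (α := ℝ)) ?_)
    rw [← hβm, ← hrp] at hΔ
    linear_combination hΔ
  -- The remaining coefficients f₄ and f₂ are recovered from the linear syzygies between a cubic and
  -- its Hessian.
  have e3 : r * f₄ = c₁ * (β ^ 2 - f₀ ^ 2) - 2 * c₂ * β * f₀ := by
    have hsyz : p * f₄ + q * f₁ = m * f₃ := by rw [hp, hq, hm]; ring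
    refine mul_left_cancel₀ hf2 (mul_left_cancel₀ (pow_ne_zero 3 hr0) ?_)
    rw [← hβm, ← hrp, ← e1, ← e2] at hsyz
    linear_combination r ^ 2 * hsyz - c₁ * r ^ 3 * hqr
  have e4 : r ^ 3 * f₂ = c₁ * (β ^ 3 - 3 * β * f₀ ^ 2) - c₂ * (3 * β ^ 2 * f₀ - f₀ ^ 3) := by
    have hsyz : p * f₂ + q * f₃ = m * f₄ := by rw [hp, hq, hm]; ring
    refine mul_left_cancel₀ hf2 (mul_left_cancel₀ hr0 ?_)
    rw [← hβm, ← hrp, ← e2] at hsyz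
    linear_combination r ^ 2 * hsyz - r * (c₁ * β - c₂ * f₀) * hqr + 2 * f₀ ^ 2 * β * r * e3
  have hc : c₁ ^ 2 + c₂ ^ 2 = 1 := by
    have h1 : r ^ 2 * f₀ ^ 2 = f₃ ^ 2 - f₁ * f₄ := by rw [hrp, hp]
    rw [← e1, ← e2] at h1
    refine mul_left_cancel₀ hf2 (mul_left_cancel₀ hr2 ?_)
    linear_combination -h1 + c₁ * r ^ 2 * e3
  obtain ⟨ζ, hζ⟩ := IsAlgClosed.exists_pow_nat_eq (⟨c₁, c₂⟩ : ℂ) (n := 3) (by norm_num)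
  have hζn : Complex.normSq ζ = 1 := by
    have h1 : Complex.normSq ζ ^ 3 = 1 := by
      rw [← map_pow, hζ, Complex.normSq_mk]; linarith
    exact (pow_eq_one_iff_of_nonneg (Complex.normSq_nonneg _) (by norm_num)).1 h1
  rw [Complex.normSq_apply] at hζn
  have hpow : ∀ z w : ℂ, (ζ * z) ^ 2 * (ζ * w) = (⟨c₁, c₂⟩ : ℂ) * (z ^ 2 * w) := fun z w => by
    rw [← hζ]; ring
  have ha3 : ∀ z w : ℂ, ((⟨c₁, c₂⟩ : ℂ) * (z ^ 2 * w)).re =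
      c₁ * ((z.re ^ 2 - z.im ^ 2) * w.re - 2 * z.re * z.im * w.im) -
        c₂ * ((z.re ^ 2 - z.im ^ 2) * w.im + 2 * z.re * z.im * w.re) := fun z w => by
    simp only [pow_succ, pow_zero, one_mul, Complex.mul_re, Complex.mul_im]; ring
  refine ⟨ζ * (⟨r, 0⟩ : ℂ), ζ * b₀, ?_, ?_, ?_, ?_, ?_⟩
  · simp only [Complex.mul_re, Complex.mul_im, hb₀]
    field_simp
    linear_combination (r * f₀) * hζn
  · rw [pow_succ, hpow, ha3, ← e1]
    ring
  · rw [pow_succ, hpow, ha3, hb₀]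
    refine mul_left_cancel₀ (pow_ne_zero 3 hr0) ?_
    rw [e4]
    field_simp
    ring
  · rw [hpow, ha3, hb₀, ← e2]
    field_simp
    ring
  · rw [mul_comm, hpow, ha3, hb₀]
    refine mul_left_cancel₀ hr0 ?_
    rw [e3]
    field_simp
    ring

/-! ### Metric of a positive form -/

/-- A sign change preserving all forms `invForm`. -/
def signMap : (Fin 7 → ℝ) →ₗ[ℝ] (Fin 7 → ℝ) where
  toFun y := ![y 0, y 1, -y 2, -y 3, y 4, -y 5, -y 6]
  map_add' x y := by funext i; fin_cases i <;> simp <;> ring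
  map_smul' c y := by funext i; fin_cases i <;> simp

/-- A cyclic permutation preserving all forms `invForm`. -/
def cycMap : (Fin 7 → ℝ) →ₗ[ℝ] (Fin 7 → ℝ) where
  toFun y := ![y 0, y 3, y 1, y 2, y 6, y 4, y 5]
  map_add' x y := by funext i; fin_cases i <;> simp
  map_smul' c y := by funext i; fin_cases i <;> simp

theorem invForm_comp_signMap (f₀ f₁ f₂ f₃ f₄ : ℝ) :
    (invForm f₀ f₁ f₂ f₃ f₄).compLinearMap signMap = invForm f₀ f₁ f₂ f₃ f₄ := by
  ext v
  rw [AlternatingMap.compLinearMap_apply]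
  simp only [invForm_apply, elem_three, signMap, LinearMap.coe_mk, AddHom.coe_mk,
    Matrix.cons_val]
  ring

theorem invForm_comp_cycMap (f₀ f₁ f₂ f₃ f₄ : ℝ) :
    (invForm f₀ f₁ f₂ f₃ f₄).compLinearMap cycMap = invForm f₀ f₁ f₂ f₃ f₄ := by
  ext v
  rw [AlternatingMap.compLinearMap_apply]
  simp only [invForm_apply, elem_three, cycMap, LinearMap.coe_mk, AddHom.coe_mk,
    Matrix.cons_val]
  ring

theorem signMap_single (i : Fin 7) : signMap (Pi.single i 1) =
    (![1, 1, -1, -1, 1, -1, -1] i : ℝ) • (Pi.single i 1 : Fin 7 → ℝ) := by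
  funext j
  fin_cases i <;> fin_cases j <;> simp [signMap]

theorem cycMap_single (i : Fin 7) : cycMap (Pi.single i 1) =
    Pi.single ((![0, 2, 3, 1, 5, 6, 4] : Fin 7 → Fin 7) i) 1 := by
  funext j
  fin_cases i <;> fin_cases j <;> simp [cycMap]

/-- If `Q` identifies `stdPhi` with some `invForm`, then the metric induced by `Q` is block
diagonal. -/
theorem exists_metric {f₀ f₁ f₂ f₃ f₄ : ℝ} (Q : (Fin 7 → ℝ) ≃ₗ[ℝ] (Fin 7 → ℝ))
    (hQ : stdPhi.compLinearMap Q.toLinearMap = invForm f₀ f₁ f₂ f₃ f₄) :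
    ∃ κ α β γ : ℝ, ∀ x y, Q x ⬝ᵥ Q y = κ * (x 0 * y 0) +
      α * (x 1 * y 1 + x 2 * y 2 + x 3 * y 3) +
      β * (x 1 * y 4 + x 4 * y 1 + x 2 * y 5 + x 5 * y 2 + x 3 * y 6 + x 6 * y 3) +
      γ * (x 4 * y 4 + x 5 * y 5 + x 6 * y 6) := by
  -- A symmetry of the 3-form, conjugated by Q, stabilizes `stdPhi` and so is orthogonal: the
  -- induced metric has all the symmetries of the form.
  have hinv : ∀ M : (Fin 7 → ℝ) →ₗ[ℝ] (Fin 7 → ℝ),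
      (invForm f₀ f₁ f₂ f₃ f₄).compLinearMap M = invForm f₀ f₁ f₂ f₃ f₄ →
      ∀ x y, Q (M x) ⬝ᵥ Q (M y) = Q x ⬝ᵥ Q y := by
    intro M hM x y
    have h1 : stdPhi.compLinearMap (Q.toLinearMap ∘ₗ M ∘ₗ Q.symm.toLinearMap) = stdPhi := by
      rw [← AlternatingMap.compLinearMap_assoc, hQ, ← AlternatingMap.compLinearMap_assoc, hM, ← hQ,
        AlternatingMap.compLinearMap_assoc]
      simp
    have h2 := dot_of_stdPhi_comp h1 (Q x) (Q y)
    simpa using h2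
  set G : Fin 7 → Fin 7 → ℝ := fun i j => Q (Pi.single i 1) ⬝ᵥ Q (Pi.single j 1) with hG
  have hs : ∀ i j, (![1, 1, -1, -1, 1, -1, -1] i : ℝ) * (![1, 1, -1, -1, 1, -1, -1] j : ℝ) * G i j
      = G i j := by
    intro i j
    have := hinv signMap (invForm_comp_signMap _ _ _ _ _) (Pi.single i 1) (Pi.single j 1)
    rw [signMap_single, signMap_single, map_smul, map_smul, smul_dotProduct, dotProduct_smul,
      smul_eq_mul, smul_eq_mul, ← mul_assoc] at this
    exact this
  have hc : ∀ i j, G ((![0, 2, 3, 1, 5, 6, 4] : Fin 7 → Fin 7) i)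
      ((![0, 2, 3, 1, 5, 6, 4] : Fin 7 → Fin 7) j) = G i j := by
    intro i j
    have := hinv cycMap (invForm_comp_cycMap _ _ _ _ _) (Pi.single i 1) (Pi.single j 1)
    rwa [cycMap_single, cycMap_single] at this
  have hsymm : ∀ i j, G i j = G j i := fun i j => dotProduct_comm _ _
  have hz : ∀ i j, (![1, 1, -1, -1, 1, -1, -1] i : ℝ) * (![1, 1, -1, -1, 1, -1, -1] j : ℝ) = -1 →
      G i j = 0 := by
    intro i j h
    have := hs i j
    rw [h] at this
    linarith
  have z02 : G 0 2 = 0 := hz 0 2 (by simp)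
  have z03 : G 0 3 = 0 := hz 0 3 (by simp)
  have z05 : G 0 5 = 0 := hz 0 5 (by simp)
  have z06 : G 0 6 = 0 := hz 0 6 (by simp)
  have z12 : G 1 2 = 0 := hz 1 2 (by simp)
  have z13 : G 1 3 = 0 := hz 1 3 (by simp)
  have z15 : G 1 5 = 0 := hz 1 5 (by simp)
  have z16 : G 1 6 = 0 := hz 1 6 (by simp)
  have z24 : G 2 4 = 0 := hz 2 4 (by simp)
  have z34 : G 3 4 = 0 := hz 3 4 (by simp)
  have z45 : G 4 5 = 0 := hz 4 5 (by simp)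
  have z46 : G 4 6 = 0 := hz 4 6 (by simp)
  have z01 : G 0 1 = 0 := (hc 0 1).symm.trans z02
  have z04 : G 0 4 = 0 := (hc 0 4).symm.trans z05
  have z23 : G 2 3 = 0 := (hc 1 2).trans z12
  have z56 : G 5 6 = 0 := (hc 4 5).trans z45
  have z26 : G 2 6 = 0 := (hc 1 5).trans z15
  have z35 : G 3 5 = 0 := (hc 2 4).trans z24
  have a2 : G 2 2 = G 1 1 := hc 1 1
  have a3 : G 3 3 = G 1 1 := (hc 2 2).trans a2
  have b2 : G 2 5 = G 1 4 := hc 1 4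
  have b3 : G 3 6 = G 1 4 := (hc 2 5).trans b2
  have c2 : G 5 5 = G 4 4 := hc 4 4
  have c3 : G 6 6 = G 4 4 := (hc 5 5).trans c2
  refine ⟨G 0 0, G 1 1, G 1 4, G 4 4, fun x y => ?_⟩
  have hx : ∀ x : Fin 7 → ℝ, Q x = ∑ i, x i • Q (Pi.single i 1) := fun x => by
    conv_lhs => rw [pi_eq_sum_univ' x]
    rw [map_sum]
    refine Finset.sum_congr rfl fun i _ => ?_
    rw [map_smul]
  have hexp : Q x ⬝ᵥ Q y = ∑ i, ∑ j, x i * y j * G i j := by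
    rw [hx x, hx y, sum_dotProduct]
    refine Finset.sum_congr rfl fun i _ => ?_
    rw [dotProduct_sum]
    refine Finset.sum_congr rfl fun j _ => ?_
    rw [smul_dotProduct, dotProduct_smul, smul_eq_mul, smul_eq_mul, ← mul_assoc]
  rw [hexp]
  simp only [Fin.sum_univ_seven]
  rw [hsymm 1 0, hsymm 2 0, hsymm 3 0, hsymm 4 0, hsymm 5 0, hsymm 6 0, hsymm 2 1, hsymm 3 1,
    hsymm 4 1, hsymm 5 1, hsymm 6 1, hsymm 3 2, hsymm 4 2, hsymm 5 2, hsymm 6 2, hsymm 4 3,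
    hsymm 5 3, hsymm 6 3, hsymm 5 4, hsymm 6 4, hsymm 6 5]
  rw [z01, z02, z03, z04, z05, z06, z12, z13, z15, z16, z23, z24, z26, z34, z35, z45, z46, z56,
    a2, a3, b2, b3, c2, c3]
  ring

/-- The coefficient `f₀` of a positive form `invForm` is nonzero; if moreover the first basis vector
has length one, the coefficients satisfy an algebraic equation. -/
theorem positive_invForm {f₀ f₁ f₂ f₃ f₄ : ℝ} (Q : (Fin 7 → ℝ) ≃ₗ[ℝ] (Fin 7 → ℝ))
    (hQ : stdPhi.compLinearMap Q.toLinearMap = invForm f₀ f₁ f₂ f₃ f₄) :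
    f₀ ≠ 0 ∧ (Q (Pi.single 0 1) ⬝ᵥ Q (Pi.single 0 1) = 1 →
      4 * (f₃ ^ 2 - f₁ * f₄) * (f₄ ^ 2 - f₂ * f₃) - (f₃ * f₄ - f₁ * f₂) ^ 2 = 4 * f₀ ^ 6) := by
  obtain ⟨κ, α, β, γ, hg⟩ := exists_metric Q hQ
  have hpos : ∀ x, x ≠ 0 → 0 < Q x ⬝ᵥ Q x := by
    intro x hx
    have h1 : Q x ⬝ᵥ Q x ≠ 0 := fun h => hx (by simpa using dotProduct_self_eq_zero.1 h)
    have h2 : 0 ≤ Q x ⬝ᵥ Q x := by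
      rw [dotProduct]; exact Finset.sum_nonneg fun i _ => mul_self_nonneg _
    exact lt_of_le_of_ne h2 h1.symm
  have hκ : 0 < κ := by
    have := hpos ![1, 0, 0, 0, 0, 0, 0] (fun h => by simpa using congrFun h 0)
    rw [hg] at this; simpa using this
  have hα : 0 < α := by
    have := hpos ![0, 1, 0, 0, 0, 0, 0] (fun h => by simpa using congrFun h 1)
    rw [hg] at this; simpa using this
  have hγ : 0 < γ := by
    have := hpos ![0, 0, 0, 0, 1, 0, 0] (fun h => by simpa using congrFun h 4)
    rw [hg] at this; simpa using this
  set D := α * γ - β ^ 2 with hD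
  have hDpos : 0 < D := by
    have := hpos ![0, γ, 0, 0, -β, 0, 0] (fun h => hγ.ne' (by simpa using congrFun h 1))
    rw [hg] at this
    simp only [Matrix.cons_val] at this
    have h2 : 0 < γ * D := by rw [hD]; linarith
    exact pos_of_mul_pos_right h2 hγ.le
  -- The 3-form with an index raised is the cross product; the factor D, the determinant of the 2 ×
  -- 2 block, clears the denominators of the inverse metric.
  have hcr : ∀ u v x : Fin 7 → ℝ, (∀ z, D * invForm f₀ f₁ f₂ f₃ f₄ ![u, v, z] = Q x ⬝ᵥ Q z) →
      D • cross (Q u) (Q v) = Q x := by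
    intro u v x h
    have h1 : ∀ w, (D • cross (Q u) (Q v) - Q x) ⬝ᵥ w = 0 := by
      intro w
      have h2 := h (Q.symm w)
      rw [← hQ, AlternatingMap.compLinearMap_apply, stdPhi_apply] at h2
      simp only [Matrix.cons_val, LinearEquiv.coe_coe, LinearEquiv.apply_symm_apply] at h2
      rw [sub_dotProduct, smul_dotProduct, smul_eq_mul, h2, sub_self]
    exact sub_eq_zero.1 (dotProduct_self_eq_zero.1 (h1 _))
  have hkey : ∀ u v v' x x' : Fin 7 → ℝ, D • cross (Q u) (Q v) = Q x →
      D • cross (Q u) (Q v') = Q x' → Q x ⬝ᵥ Q x' =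
        D ^ 2 * ((Q u ⬝ᵥ Q u) * (Q v ⬝ᵥ Q v') - (Q u ⬝ᵥ Q v) * (Q u ⬝ᵥ Q v')) := by
    intro u v v' x x' h h'
    rw [← h, ← h', smul_dotProduct, dotProduct_smul, cross_dot_cross, smul_eq_mul, smul_eq_mul]
    ring
  -- The norm identity for the cross product of e₁ and e₂.
  have hf : f₀ ^ 2 = κ * D := by
    have h1 := hcr ![1, 0, 0, 0, 0, 0, 0] ![0, 1, 0, 0, 0, 0, 0]
      ![0, -β * f₀, 0, 0, α * f₀, 0, 0] (fun z => by
        rw [hg, invForm_apply]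
        simp only [elem_three, Matrix.cons_val, hD]
        ring)
    have h2 := hkey _ _ _ _ _ h1 h1
    simp only [hg, Matrix.cons_val] at h2
    have h3 : (α * D) * f₀ ^ 2 = (α * D) * (κ * D) := by
      rw [hD] at h2 ⊢; linear_combination h2
    exact mul_left_cancel₀ (mul_pos hα hDpos).ne' h3
  refine ⟨fun h => ?_, fun hunit => ?_⟩
  · rw [h] at hf
    have := mul_pos hκ hDpos
    simp only [ne_eq, OfNat.ofNat_ne_zero, not_false_eq_true, zero_pow] at hf
    linarith
  have hκ1 : κ = 1 := by
    rw [hg] at hunit; simpa using hunit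
  rw [hκ1, one_mul] at hf
  have hcr2 : ∀ s t : ℝ, D • cross (Q ![0, s, 0, 0, t, 0, 0]) (Q ![0, 0, 1, 0, 0, 0, 0]) =
      Q ![0, 0, 0, γ * (s * f₁ + t * f₃) - β * (s * f₃ + t * f₄), 0, 0,
        α * (s * f₃ + t * f₄) - β * (s * f₁ + t * f₃)] := fun s t => hcr _ _ _ fun z => by
    rw [hg, invForm_apply]
    simp only [elem_three, Matrix.cons_val, hD]
    ring
  have hcr5 : ∀ s t : ℝ, D • cross (Q ![0, s, 0, 0, t, 0, 0]) (Q ![0, 0, 0, 0, 0, 1, 0]) =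
      Q ![0, 0, 0, γ * (s * f₃ + t * f₄) - β * (s * f₄ + t * f₂), 0, 0,
        α * (s * f₄ + t * f₂) - β * (s * f₃ + t * f₄)] := fun s t => hcr _ _ _ fun z => by
    rw [hg, invForm_apply]
    simp only [elem_three, Matrix.cons_val, hD]
    ring
  -- the inner products of the covectors `(f₁, f₃)`, `(f₃, f₄)`, `(f₄, f₂)`
  set S : ℝ → ℝ → ℝ → ℝ → ℝ := fun a b c d => γ * a * c - β * (a * d + b * c) + α * b * d with hS
  have hDne : D ≠ 0 := hDpos.ne'
  have h22 : ∀ s t : ℝ, S (s * f₁ + t * f₃) (s * f₃ + t * f₄) (s * f₁ + t * f₃) (s * f₃ + t * f₄) =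
      D * ((α * s ^ 2 + 2 * β * s * t + γ * t ^ 2) * α) := fun s t => by
    have h := hkey _ _ _ _ _ (hcr2 s t) (hcr2 s t)
    simp only [hg, Matrix.cons_val] at h
    refine mul_left_cancel₀ hDne ?_
    simp only [hS, hD] at h ⊢
    linear_combination h
  have h25 : ∀ s t : ℝ, S (s * f₁ + t * f₃) (s * f₃ + t * f₄) (s * f₃ + t * f₄) (s * f₄ + t * f₂) =
      D * ((α * s ^ 2 + 2 * β * s * t + γ * t ^ 2) * β) := fun s t => by
    have h := hkey _ _ _ _ _ (hcr2 s t) (hcr5 s t)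
    simp only [hg, Matrix.cons_val] at h
    refine mul_left_cancel₀ hDne ?_
    simp only [hS, hD] at h ⊢
    linear_combination h
  have h55 : ∀ s t : ℝ, S (s * f₃ + t * f₄) (s * f₄ + t * f₂) (s * f₃ + t * f₄) (s * f₄ + t * f₂) =
      D * ((α * s ^ 2 + 2 * β * s * t + γ * t ^ 2) * γ) := fun s t => by
    have h := hkey _ _ _ _ _ (hcr5 s t) (hcr5 s t)
    simp only [hg, Matrix.cons_val] at h
    refine mul_left_cancel₀ hDne ?_
    simp only [hS, hD] at h ⊢
    linear_combination h
  have hXX := h22 1 0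
  have hXY := h25 1 0
  have hYY := h55 1 0
  have hYZ := h25 0 1
  have hZZ := h55 0 1
  -- Expanding at s = t = 1 isolates the one inner product, of the first and third covectors, that
  -- the other relations do not give.
  have hmix := h25 1 1
  simp only [hS, one_mul, zero_mul, add_zero, zero_add] at hXX hXY hYY hYZ hZZ hmix
  -- `W = γ X - 2 β Y + α Z` vanishes
  set w := γ * f₁ - 2 * β * f₃ + α * f₄ with hw
  set w' := γ * f₃ - 2 * β * f₄ + α * f₂ with hw'
  -- The squared length of W is a combination of the known inner products and sums to zero;
  -- definiteness then gives W = 0. The Hessian thereby becomes D times the metric block.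
  have hWW : γ * w ^ 2 - 2 * β * w * w' + α * w' ^ 2 = 0 := by
    rw [hw, hw']
    rw [hD] at hXX hXY hYY hYZ hZZ hmix
    linear_combination γ ^ 2 * hXX + (4 * β ^ 2) * hYY + α ^ 2 * hZZ - 4 * β * γ * hXY
      + 2 * α * γ * (hmix - hXY - hYY - hYZ) - 4 * α * β * hYZ
  have hw0 : w' = 0 ∧ w = 0 := by
    have h1 : (α * w' - β * w) ^ 2 + D * w ^ 2 = 0 := by rw [hD]; linear_combination α * hWW
    have h2 : w = 0 := by
      have : D * w ^ 2 = 0 := by nlinarith [sq_nonneg (α * w' - β * w), mul_nonneg hDpos.le (sq_nonneg w)]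
      simpa [hDne] using this
    rw [h2] at h1
    refine ⟨?_, h2⟩
    simpa [hα.ne'] using h1
  obtain ⟨hw0', hw0⟩ := hw0
  have hp : f₃ ^ 2 - f₁ * f₄ = α * D := by
    refine mul_left_cancel₀ hα.ne' ?_
    rw [hw] at hw0
    linear_combination hXX - f₁ * hw0
  have hq : f₄ ^ 2 - f₂ * f₃ = γ * D := by
    refine mul_left_cancel₀ hα.ne' ?_
    rw [hw'] at hw0'
    linear_combination hYY - f₃ * hw0'
  have hm : f₃ * f₄ - f₁ * f₂ = 2 * β * D := by
    refine mul_left_cancel₀ hα.ne' ?_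
    rw [hw] at hw0
    rw [hw'] at hw0'
    linear_combination f₃ * hw0 - f₁ * hw0' + 2 * β * hp
  rw [hp, hq, hm, show f₀ ^ 6 = (f₀ ^ 2) ^ 3 by ring, hf, hD]
  ring

end NearlyParallel
end

noncomputable section
namespace NearlyParallel

/-! ### The exterior derivative of an invariant form -/

/-- The quaternion with given coordinates. -/
def quat (r i j k : ℝ) : ℍ[ℝ] := ⟨r, i, j, k⟩

@[simp] theorem re_quat (r i j k : ℝ) : (quat r i j k).re = r := rfl
@[simp] theorem imI_quat (r i j k : ℝ) : (quat r i j k).imI = i := rfl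
@[simp] theorem imJ_quat (r i j k : ℝ) : (quat r i j k).imJ = j := rfl
@[simp] theorem imK_quat (r i j k : ℝ) : (quat r i j k).imK = k := rfl

/-- The constant frame of the tangent spaces at the points of the curve `gam`. -/
def efr : (Fin 7 → ℝ) →ₗ[ℝ] Amb where
  toFun y := (quat 0 (y 4) (y 5) (y 6), quat (y 0) (y 1) (y 2) (y 3))
  map_add' x y := by ext <;> simp
  map_smul' c y := by ext <;> simp

theorem efr_apply (y : Fin 7 → ℝ) :
    efr y = (quat 0 (y 4) (y 5) (y 6), quat (y 0) (y 1) (y 2) (y 3)) := rfl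

/-- Multiplication of the first four coordinates by `t`. -/
def scaleMap (t : ℝ) : (Fin 7 → ℝ) →ₗ[ℝ] (Fin 7 → ℝ) where
  toFun y := ![t * y 0, t * y 1, t * y 2, t * y 3, y 4, y 5, y 6]
  map_add' x y := by funext i; fin_cases i <;> simp [mul_add]
  map_smul' c y := by funext i; fin_cases i <;> simp [mul_left_comm]

theorem scaleMap_apply (t : ℝ) (y : Fin 7 → ℝ) :
    scaleMap t y = ![t * y 0, t * y 1, t * y 2, t * y 3, y 4, y 5, y 6] := rfl

theorem scaleMap_inv {t : ℝ} (ht : t ≠ 0) (y : Fin 7 → ℝ) : scaleMap t (scaleMap t⁻¹ y) = y := by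
  funext i; fin_cases i <;> simp [scaleMap_apply, ht]

/-- Relates the fields x ↦ x a, whose ℍ-directions degenerate at t = 0, to the constant frame. -/
theorem gam_mul_efr (t : ℝ) (y : Fin 7 → ℝ) : gam t * efr y = efr (scaleMap t y) := by
  ext <;> simp [gam, efr_apply, scaleMap_apply]

theorem invForm_scaleMap (f₀ f₁ f₂ f₃ f₄ t : ℝ) :
    (invForm f₀ f₁ f₂ f₃ f₄).compLinearMap (scaleMap t) =
      invForm (t ^ 2 * f₀) (t ^ 3 * f₁) f₂ (t ^ 2 * f₃) (t * f₄) := by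
  ext z
  rw [AlternatingMap.compLinearMap_apply]
  simp only [invForm_apply, elem_three, scaleMap_apply, Matrix.cons_val]
  ring

theorem fourForm_scaleMap (c g₁ g₂ g₃ g₄ t : ℝ) :
    (fourForm c g₁ g₂ g₃ g₄).compLinearMap (scaleMap t) =
      fourForm (t ^ 2 * c) (t ^ 4 * g₁) (t * g₂) (t ^ 3 * g₃) (t ^ 2 * g₄) := by
  ext z
  rw [AlternatingMap.compLinearMap_apply]
  simp only [fourForm_apply, elem_four, elem_three, scaleMap_apply, Matrix.cons_val]
  ring

/-- The commutator of quaternions, in the frame `efr`. -/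
def bracket (y z : Fin 7 → ℝ) : Fin 7 → ℝ :=
  ![0, 2 * (y 2 * z 3 - y 3 * z 2), 2 * (y 3 * z 1 - y 1 * z 3), 2 * (y 1 * z 2 - y 2 * z 1),
    2 * (y 5 * z 6 - y 6 * z 5), 2 * (y 6 * z 4 - y 4 * z 6), 2 * (y 4 * z 5 - y 5 * z 4)]

theorem efr_commutator (y z : Fin 7 → ℝ) :
    efr y * efr z - efr z * efr y = efr (bracket y z) := by
  ext <;> simp [efr_apply, bracket] <;> ring

/-- The bracket part of the formula for dφ on the fields x ↦ x a. The coefficients f₁ and f₂ drop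
out because they multiply volume forms of the two copies of sp(1). The part that differentiates the
coefficients is `invForm_wedge`. -/
theorem invForm_bracket (f₀ f₁ f₂ f₃ f₄ : ℝ) (z : Fin 4 → Fin 7 → ℝ) :
    invForm f₀ f₁ f₂ f₃ f₄ ![bracket (z 0) (z 1), z 2, z 3] -
      invForm f₀ f₁ f₂ f₃ f₄ ![bracket (z 0) (z 2), z 1, z 3] +
      invForm f₀ f₁ f₂ f₃ f₄ ![bracket (z 0) (z 3), z 1, z 2] +
      invForm f₀ f₁ f₂ f₃ f₄ ![bracket (z 1) (z 2), z 0, z 3] -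
      invForm f₀ f₁ f₂ f₃ f₄ ![bracket (z 1) (z 3), z 0, z 2] +
      invForm f₀ f₁ f₂ f₃ f₄ ![bracket (z 2) (z 3), z 0, z 1] =
    -fourForm (2 * (f₃ + f₄)) 0 0 (-2 * f₀) (2 * f₀) z := by
  simp only [invForm_apply, fourForm_apply, elem_four, elem_three, bracket, Matrix.cons_val]
  ring

theorem invForm_wedge (f₀ f₁ f₂ f₃ f₄ : ℝ) (z : Fin 4 → Fin 7 → ℝ) :
    z 0 0 * invForm f₀ f₁ f₂ f₃ f₄ ![z 1, z 2, z 3] - z 1 0 * invForm f₀ f₁ f₂ f₃ f₄ ![z 0, z 2, z 3] +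
      z 2 0 * invForm f₀ f₁ f₂ f₃ f₄ ![z 0, z 1, z 3] -
      z 3 0 * invForm f₀ f₁ f₂ f₃ f₄ ![z 0, z 1, z 2] =
    fourForm 0 (-f₁) (-f₂) (-f₃) (-f₄) z := by
  simp only [invForm_apply, fourForm_apply, elem_four, elem_three, Matrix.cons_val]
  ring

end NearlyParallel
end

/-! ### The group action along `gam` and the exterior derivative on invariant fields -/

noncomputable section
namespace NearlyParallel

theorem act_mul (q q' : Sp1) (x a : Amb) : act (q, q', 1) (x * a) = act (q, q', 1) x * a := by
  ext1 <;> simp [act, mul_assoc]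

theorem mem_tangent {x w : Amb} : w ∈ tangent x ↔ (x.1 * star w.1).re = 0 := by
  rw [tangent, Submodule.mem_prod, Submodule.mem_orthogonal_singleton_iff_inner_right,
    Quaternion.inner_def]
  simp

theorem mem_tangent_gam {t : ℝ} {w : Amb} : w ∈ tangent (gam t) ↔ w.1.re = 0 := by
  rw [mem_tangent]; simp [gam]

theorem mul_efr_mem_tangent (x : Amb) (y : Fin 7 → ℝ) : x * efr y ∈ tangent x := by
  rw [mem_tangent]; simp [efr_apply]; ring

theorem efr_mem_tangent (t : ℝ) (y : Fin 7 → ℝ) : efr y ∈ tangent (gam t) := by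
  rw [mem_tangent_gam]; rfl

theorem gam_mem_tube {t T : ℝ} (ht : t ∈ Ioo (-T) T) : gam t ∈ tube T := by
  have : |t| < T := abs_lt.2 ht
  simpa [tube, gam]

theorem gam_mem_nhd {t T : ℝ} (ht : t ∈ Ioo (-T) T) : gam t ∈ nhd T := by
  have : |t| < T := abs_lt.2 ht
  simpa [nhd, gam]

theorem isOpen_nhd (T : ℝ) : IsOpen (nhd T) :=
  (isOpen_ne_fun continuous_fst continuous_const).inter
    (isOpen_lt continuous_snd.norm continuous_const)

theorem mem_unitary_of_norm {p : ℍ[ℝ]} (hp : ‖p‖ = 1) : p ∈ unitary ℍ[ℝ] := by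
  have hn : Quaternion.normSq p = 1 := by
    rw [Quaternion.normSq_eq_norm_mul_self, hp, one_mul]
  rw [Unitary.mem_iff]
  constructor
  · rw [Quaternion.star_mul_self, hn]; rfl
  · rw [Quaternion.self_mul_star, hn]; rfl

theorem exists_act_gam {x : Amb} (hx : ‖x.1‖ = 1) :
    ∃ q q' : Sp1, act (q, q', 1) (gam ‖x.2‖) = x := by
  have hv : ∃ q' : Sp1, (q' : ℍ[ℝ]) * (‖x.2‖ : ℍ[ℝ]) = x.2 := by
    rcases eq_or_ne x.2 0 with h | h
    · exact ⟨1, by simp [h]⟩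
    · have h' : ‖x.2‖ ≠ 0 := norm_ne_zero_iff.2 h
      refine ⟨⟨‖x.2‖⁻¹ • x.2, mem_unitary_of_norm ?_⟩, ?_⟩
      · rw [norm_smul, norm_inv, norm_norm, inv_mul_cancel₀ h']
      · rw [Quaternion.mul_coe_eq_smul, smul_smul, mul_inv_cancel₀ h', one_smul]
  obtain ⟨q', hq'⟩ := hv
  exact ⟨⟨x.1, mem_unitary_of_norm hx⟩, q', by ext1 <;> simp [act, gam, hq']⟩

/-- The form `φ` is invariant under the group `G`. -/
def IsInvariant (T : ℝ) (φ : Amb → Amb [⋀^Fin 3]→L[ℝ] ℝ) : Prop :=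
  ∀ g : G, ∀ x ∈ tube T, ∀ u : Fin 3 → Amb, (∀ i, u i ∈ tangent x) →
    φ (act g x) (fun i => act g (u i)) = φ x u

variable {T : ℝ} {φ : Amb → Amb [⋀^Fin 3]→L[ℝ] ℝ}

/-- Elements (q, q', 1) act by left multiplication, which preserves the fields x ↦ x a and moves any
point of the tube to the point of `gam` of the same radius. The coefficients of φ on these fields
are thus radial. -/
theorem IsInvariant.apply_mul_efr (hφ : IsInvariant T φ) {x : Amb} (hx : x ∈ tube T)
    (y : Fin 3 → Fin 7 → ℝ) :
    φ x (fun i => x * efr (y i)) = φ (gam ‖x.2‖) (fun i => gam ‖x.2‖ * efr (y i)) := by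
  obtain ⟨q, q', h⟩ := exists_act_gam hx.1
  have ht : ‖x.2‖ ∈ Ioo (-T) T := ⟨by linarith [norm_nonneg x.2, hx.2], hx.2⟩
  rw [← hφ (q, q', 1) (gam ‖x.2‖) (gam_mem_tube ht) _ fun i => mul_efr_mem_tangent _ _]
  simp only [act_mul, h]

/-- A curve in `tube T` with given velocity. -/
theorem exists_curve {T t : ℝ} (ht : t ∈ Ioo 0 T) {w : Amb} (hw : w.1.re = 0) :
    ∃ c : ℝ → Amb, c 0 = gam t ∧ HasDerivAt c w 0 ∧ (∀ᶠ s in nhds 0, c s ∈ tube T) ∧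
      HasDerivAt (fun s => ‖(c s).2‖) w.2.re 0 := by
  -- Normalizes 1 + s w₁ back to the unit sphere; as w₁ is imaginary, r' (0) = 0 and the velocity is
  -- unaffected.
  set r : ℝ → ℝ := fun s => (Real.sqrt (1 + s ^ 2 * ‖w.1‖ ^ 2))⁻¹ with hr
  have hpos : ∀ s : ℝ, 0 < 1 + s ^ 2 * ‖w.1‖ ^ 2 := fun s => by positivity
  have hr0 : r 0 = 1 := by simp [hr]
  have hrd : HasDerivAt r 0 0 := by
    have h1 : HasDerivAt (fun s : ℝ => 1 + s ^ 2 * ‖w.1‖ ^ 2) 0 0 := by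
      simpa using (((hasDerivAt_id (0 : ℝ)).pow 2).mul_const (‖w.1‖ ^ 2)).const_add 1
    have h2 := (h1.sqrt (hpos 0).ne').inv (by simp)
    simp only [neg_zero, zero_div] at h2
    exact h2
  have h2 : HasDerivAt (fun s : ℝ => (t : ℍ[ℝ]) + s • w.2) w.2 0 := by
    simpa using ((hasDerivAt_id (0 : ℝ)).smul_const w.2).const_add (t : ℍ[ℝ])
  have h1 : HasDerivAt (fun s : ℝ => r s • (1 + s • w.1)) w.1 0 := by
    have := hrd.smul (((hasDerivAt_id (0 : ℝ)).smul_const w.1).const_add (1 : ℍ[ℝ]))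
    simpa [hr0, Pi.smul_def'] using this
  have h3 : HasDerivAt (fun s : ℝ => ‖(t : ℍ[ℝ]) + s • w.2‖) w.2.re 0 := by
    have h4 := h2.norm_sq
    have h5 := h4.sqrt (by simp [ht.1.ne'])
    simp only [Real.sqrt_sq (norm_nonneg _)] at h5
    convert h5 using 1
    have : ‖t‖ = t := by simp [abs_of_pos ht.1]
    have ht0 := ht.1.ne'
    simp [Quaternion.inner_def, this]
    field_simp
  refine ⟨fun s => (r s • (1 + s • w.1), (t : ℍ[ℝ]) + s • w.2), by simp [hr0, gam], h1.prodMk h2,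
    ?_, h3⟩
  have hc : ContinuousAt (fun s : ℝ => ‖(t : ℍ[ℝ]) + s • w.2‖) 0 := h3.continuousAt
  have hlt : ‖(t : ℍ[ℝ]) + (0 : ℝ) • w.2‖ < T := by simpa [abs_of_pos ht.1] using ht.2
  filter_upwards [hc.eventually_lt_const hlt] with s hs
  refine ⟨?_, hs⟩
  have hn : ‖1 + s • w.1‖ ^ 2 = 1 + s ^ 2 * ‖w.1‖ ^ 2 := by
    rw [norm_add_sq_real, norm_smul, mul_pow, Real.norm_eq_abs, sq_abs, inner_smul_right,
      Quaternion.inner_def]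
    simp [hw]
  change ‖r s • (1 + s • w.1)‖ = 1
  rw [norm_smul, hr]
  simp only
  rw [← hn, Real.sqrt_sq (norm_nonneg _), norm_inv, norm_norm, inv_mul_cancel₀]
  intro h
  rw [h] at hn
  have := hpos s
  rw [← hn] at this
  simp at this

theorem differentiable_mul_right (a : Amb) : Differentiable ℝ fun x : Amb => x * a :=
  differentiable_id.mul_const a

theorem fderiv_mul_right (a x w : Amb) : fderiv ℝ (fun x : Amb => x * a) x w = w * a := by
  have : (fun x : Amb => x * a) = (ContinuousLinearMap.mul ℝ Amb).flip a := by ext1; simp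
  rw [this, ContinuousLinearMap.fderiv]
  simp

/-- Invariance holds only on the tube, so the coefficient is radial only there; its derivative is
therefore taken along a curve inside the tube. -/
theorem IsInvariant.fderiv_apply_mul_efr (hφ : IsInvariant T φ) {t : ℝ} (ht : t ∈ Ioo 0 T)
    (hd : DifferentiableAt ℝ φ (gam t)) (y : Fin 3 → Fin 7 → ℝ) {κ' : ℝ}
    (hκ : HasDerivAt (fun s => φ (gam s) (fun i => gam s * efr (y i))) κ' t) {w : Amb}
    (hw : w.1.re = 0) :
    fderiv ℝ (fun x => φ x (fun i => x * efr (y i))) (gam t) w = w.2.re * κ' := by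
  obtain ⟨c, hc0, hc, hcT, hcn⟩ := exists_curve ht hw
  have hF : DifferentiableAt ℝ (fun x => φ x (fun i => x * efr (y i))) (gam t) :=
    hd.continuousAlternatingMap_apply fun i => differentiable_mul_right _ _
  rw [← hc0] at hF ⊢
  have h1 := hF.hasFDerivAt.comp_hasDerivAt 0 hc
  have hn : ‖(c 0).2‖ = t := by simp [hc0, gam, abs_of_pos ht.1]
  have h2 : HasDerivAt (fun s => φ (gam ‖(c s).2‖) (fun i => gam ‖(c s).2‖ * efr (y i)))
      (w.2.re * κ') 0 := by
    rw [← hn] at hκ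
    rw [mul_comm]
    exact hκ.comp 0 hcn
  refine h1.unique (h2.congr_of_eventuallyEq ?_)
  filter_upwards [hcT] with s hs
  exact hφ.apply_mul_efr hs y

/-- Evaluates dφ on four fields x ↦ x a by the formula with directional derivatives and Lie
brackets. The bracket of two such fields is the field of the commutator, and only the radial
direction contributes derivatives. -/
theorem IsInvariant.extDeriv_gam (hφ : IsInvariant T φ) {t : ℝ} (ht : t ∈ Ioo 0 T)
    (hd : DifferentiableAt ℝ φ (gam t)) {f₀ f₁ f₂ f₃ f₄ : ℝ → ℝ}
    (hf : ∀ s ∈ Ioo 0 T, (φ (gam s)).toAlternatingMap.compLinearMap efr =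
      invForm (f₀ s) (f₁ s) (f₂ s) (f₃ s) (f₄ s)) {d₀ d₁ d₂ d₃ d₄ : ℝ}
    (h₀ : HasDerivAt f₀ d₀ t) (h₁ : HasDerivAt f₁ d₁ t) (h₂ : HasDerivAt f₂ d₂ t)
    (h₃ : HasDerivAt f₃ d₃ t) (h₄ : HasDerivAt f₄ d₄ t) :
    (extDeriv φ (gam t)).toAlternatingMap.compLinearMap efr =
      fourForm (2 * (f₃ t + f₄ t / t)) (-(d₁ + 3 * f₁ t / t)) (-d₂)
        (-(d₃ + 2 * f₃ t / t + 2 * f₀ t / t)) (-(d₄ + f₄ t / t - 2 * f₀ t)) := by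
  have ht0 : t ≠ 0 := ht.1.ne'
  have hval : ∀ s ∈ Ioo 0 T, ∀ y : Fin 3 → Fin 7 → ℝ, φ (gam s) (fun i => gam s * efr (y i)) =
      invForm (s ^ 2 * f₀ s) (s ^ 3 * f₁ s) (f₂ s) (s ^ 2 * f₃ s) (s * f₄ s) y := by
    intro s hs y
    rw [← invForm_scaleMap, ← hf s hs]
    simp only [gam_mul_efr]
    rfl
  have hder : ∀ y : Fin 3 → Fin 7 → ℝ,
      HasDerivAt (fun s => φ (gam s) (fun i => gam s * efr (y i)))
        (invForm (2 * t * f₀ t + t ^ 2 * d₀) (3 * t ^ 2 * f₁ t + t ^ 3 * d₁) d₂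
          (2 * t * f₃ t + t ^ 2 * d₃) (f₄ t + t * d₄) y) t := by
    intro y
    have p1 : HasDerivAt (fun s : ℝ => s) 1 t := hasDerivAt_id t
    have p2 : HasDerivAt (fun s : ℝ => s ^ 2) (2 * t) t := by simpa using hasDerivAt_pow 2 t
    have p3 : HasDerivAt (fun s : ℝ => s ^ 3) (3 * t ^ 2) t := by simpa using hasDerivAt_pow 3 t
    have key : HasDerivAt (fun s => invForm (s ^ 2 * f₀ s) (s ^ 3 * f₁ s) (f₂ s) (s ^ 2 * f₃ s)
        (s * f₄ s) y) (invForm (2 * t * f₀ t + t ^ 2 * d₀) (3 * t ^ 2 * f₁ t + t ^ 3 * d₁) d₂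
          (2 * t * f₃ t + t ^ 2 * d₃) (f₄ t + t * d₄) y) t := by
      simp only [invForm_apply]
      have := (((((p2.mul h₀).mul_const (elem ![0, 1, 4] y + elem ![0, 2, 5] y +
        elem ![0, 3, 6] y)).add ((p3.mul h₁).mul_const (elem ![1, 2, 3] y))).add
        (h₂.mul_const (elem ![4, 5, 6] y))).add ((p2.mul h₃).mul_const (elem ![1, 2, 6] y -
        elem ![1, 3, 5] y + elem ![2, 3, 4] y))).add ((p1.mul h₄).mul_const (elem ![1, 5, 6] y -
        elem ![2, 4, 6] y + elem ![3, 4, 5] y))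
      exact this.congr_deriv (by ring)
    refine key.congr_of_eventuallyEq ?_
    filter_upwards [isOpen_Ioo.mem_nhds ht] with s hs using hval s hs y
  have main : ∀ z : Fin 4 → Fin 7 → ℝ, extDeriv φ (gam t) (fun i => gam t * efr (z i)) =
      fourForm (2 * (f₃ t + f₄ t / t)) (-(d₁ + 3 * f₁ t / t)) (-d₂)
        (-(d₃ + 2 * f₃ t / t + 2 * f₀ t / t)) (-(d₄ + f₄ t / t - 2 * f₀ t))
        (fun i => scaleMap t (z i)) := by
    intro z
    have hX := extDeriv_apply_vectorField (V := fun i x => x * efr (z i)) hd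
      fun i => differentiable_mul_right _ _
    have hbr : ∀ a b : Fin 7 → ℝ, VectorField.lieBracket ℝ (fun x => x * efr a)
        (fun x => x * efr b) (gam t) = gam t * efr (bracket a b) := by
      intro a b
      rw [VectorField.lieBracket, fderiv_mul_right, fderiv_mul_right, ← efr_commutator, mul_sub,
        mul_assoc, mul_assoc]
    have hfd : ∀ (i : Fin 4), fderiv ℝ (fun x => φ x (i.removeNth fun j => x * efr (z j))) (gam t)
        (gam t * efr (z i)) = t * z i 0 * invForm (2 * t * f₀ t + t ^ 2 * d₀)
          (3 * t ^ 2 * f₁ t + t ^ 3 * d₁) d₂ (2 * t * f₃ t + t ^ 2 * d₃) (f₄ t + t * d₄)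
          (i.removeNth z) := by
      intro i
      have := hφ.fderiv_apply_mul_efr ht hd (i.removeNth z) (hder _) (w := gam t * efr (z i))
        (mem_tangent_gam.1 (mul_efr_mem_tangent _ _))
      refine this.trans ?_
      rw [gam_mul_efr]
      rfl
    have hb : ∀ i j : Fin 3, φ (gam t) (Matrix.vecCons (VectorField.lieBracket ℝ
        (fun x => x * efr (z i.castSucc)) (fun x => x * efr (z j.succ)) (gam t))
        (j.removeNth <| i.castSucc.removeNth fun k => gam t * efr (z k))) =
        invForm (t ^ 2 * f₀ t) (t ^ 3 * f₁ t) (f₂ t) (t ^ 2 * f₃ t) (t * f₄ t)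
          (Matrix.vecCons (bracket (z i.castSucc) (z j.succ))
            (j.removeNth <| i.castSucc.removeNth z)) := by
      intro i j
      rw [← hval t ht, hbr]
      congr 1
      funext k
      refine Fin.cases rfl (fun _ => rfl) k
    have hS : ∀ f : Fin 3 → Fin 3 → ℝ, ∑ i, ∑ j ≥ i, f i j =
        f 0 0 + f 0 1 + f 0 2 + f 1 1 + f 1 2 + f 2 2 := by
      intro f
      have e0 : Finset.Ici (0 : Fin 3) = {0, 1, 2} := by decide
      have e1 : Finset.Ici (1 : Fin 3) = {1, 2} := by decide
      have e2 : Finset.Ici (2 : Fin 3) = {2} := by decide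
      rw [Fin.sum_univ_three, e0, e1, e2]
      simp [add_assoc]
    have r0 : (0 : Fin 4).removeNth z = ![z 1, z 2, z 3] := by funext k; fin_cases k <;> rfl
    have r1 : (1 : Fin 4).removeNth z = ![z 0, z 2, z 3] := by funext k; fin_cases k <;> rfl
    have r2 : (2 : Fin 4).removeNth z = ![z 0, z 1, z 3] := by funext k; fin_cases k <;> rfl
    have r3 : (3 : Fin 4).removeNth z = ![z 0, z 1, z 2] := by funext k; fin_cases k <;> rfl
    have q0 : ∀ a b c : Fin 7 → ℝ, (0 : Fin 3).removeNth ![a, b, c] = ![b, c] := fun a b c => by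
      funext k; fin_cases k <;> rfl
    have q1 : ∀ a b c : Fin 7 → ℝ, (1 : Fin 3).removeNth ![a, b, c] = ![a, c] := fun a b c => by
      funext k; fin_cases k <;> rfl
    have q2 : ∀ a b c : Fin 7 → ℝ, (2 : Fin 3).removeNth ![a, b, c] = ![a, b] := fun a b c => by
      funext k; fin_cases k <;> rfl
    have c0 : (0 : Fin 3).castSucc = 0 := rfl
    have c1 : (1 : Fin 3).castSucc = 1 := rfl
    have c2 : (2 : Fin 3).castSucc = 2 := rfl
    have s0 : (0 : Fin 3).succ = 1 := rfl
    have s1 : (1 : Fin 3).succ = 2 := rfl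
    have s2 : (2 : Fin 3).succ = 3 := rfl
    have hc := DFunLike.congr_fun (fourForm_scaleMap (2 * (f₃ t + f₄ t / t))
      (-(d₁ + 3 * f₁ t / t)) (-d₂) (-(d₃ + 2 * f₃ t / t + 2 * f₀ t / t))
      (-(d₄ + f₄ t / t - 2 * f₀ t)) t) z
    rw [AlternatingMap.compLinearMap_apply] at hc
    refine Eq.trans ?_ hc.symm
    have hB := invForm_bracket (t ^ 2 * f₀ t) (t ^ 3 * f₁ t) (f₂ t) (t ^ 2 * f₃ t) (t * f₄ t) z
    have hW := invForm_wedge (2 * t * f₀ t + t ^ 2 * d₀) (3 * t ^ 2 * f₁ t + t ^ 3 * d₁) d₂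
      (2 * t * f₃ t + t ^ 2 * d₃) (f₄ t + t * d₄) z
    rw [hX]
    have hS' : ∀ f : Fin (2 + 2) → ℝ, ∑ i, f i = f 0 + f 1 + f 2 + f 3 := Fin.sum_univ_four
    simp only [hfd, hb, hS, hS', r0, r1, r2, r3, q0, q1, q2, c0, c1, c2, s0, s1, s2]
    rw [fourForm_apply] at hB hW ⊢
    simp only [Fin.val_zero, Fin.val_one, Fin.val_two]
    rw [show ((3 : Fin (2 + 2)) : ℕ) = 3 from rfl]
    simp only [zsmul_eq_mul, Int.cast_pow, Int.cast_neg, Int.cast_one]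
    field_simp at hB hW ⊢
    linear_combination t * hW - hB
  ext y
  -- For t ≠ 0 the fields span the tangent space, so the identity passes to the constant frame.
  have := main fun i => scaleMap t⁻¹ (y i)
  simp only [gam_mul_efr, scaleMap_inv ht0] at this
  exact this

end NearlyParallel
end

noncomputable section
namespace NearlyParallel

/-! ### The equations of a nearly parallel structure along `gam` -/

/-- The right side is the set of differential equations in dφ = λ∗φ for the rescaled coefficients,
with h₄ and its derivative expressed through h₀ and h₃. There is no separate equation for h₀'; it
comes from those for h₃' and h₄'. -/
theorem ode_iff {lam t : ℝ} (hlam : lam ≠ 0) (ht : t ≠ 0) {h d : Fin 4 → ℝ} (h0 : h 0 ≠ 0) :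
    d = (1 / t) • singA lam h + regB lam h t ↔
      (4 * h 1 + t * d 1) / 27 = lam * dualCoeff (h 0 / 9) (-(t * h 1) / 27) (-h 2 / 27)
        (-h 3 / 27) (-(t * hFour lam h) / 27) ∧
      d 2 / 27 = -(lam * dualCoeff (h 0 / 9) (-h 2 / 27) (-(t * h 1) / 27)
        (-(t * hFour lam h) / 27) (-h 3 / 27)) ∧
      (t * d 3 + 2 * h 3 - 6 * h 0) / (27 * t) = lam * dualCoeff' (h 0 / 9) (-(t * h 1) / 27)
        (-h 2 / 27) (-h 3 / 27) (-(t * hFour lam h) / 27) ∧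
      (t * (-d 3 - lam / 3 * h 0 * d 0) + 2 * hFour lam h + 6 * h 0) / 27 =
        -(lam * dualCoeff' (h 0 / 9) (-h 2 / 27) (-(t * h 1) / 27) (-(t * hFour lam h) / 27)
          (-h 3 / 27)) := by
  set h₄ := hFour lam h with hh
  have hA : d = (1 / t) • singA lam h + regB lam h t ↔
      t * d 0 = -h 0 - 3 * h 2 * h 3 ^ 2 / h 0 ^ 4 + t * -(3 / (2 * h 0 ^ 4)) *
        (t * (h 3 - h₄) * (h 1 * h 2 + h 3 * h₄) - 2 * t ^ 3 * h 1 * h₄ ^ 2) ∧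
      t * d 1 = -4 * h 1 + lam * h 3 ^ 3 / h 0 ^ 3 + t * (lam * t / (2 * h 0 ^ 3)) *
        (h 1 ^ 2 * h 2 - 3 * h 1 * h 3 * h₄) ∧
      t * d 2 = t * (lam * t / h 0 ^ 3) *
        (h₄ * (h 2 * h 3 - t ^ 2 * h₄ ^ 2) - 1 / 2 * h 2 * (h 1 * h 2 - h 3 * h₄)) ∧
      t * d 3 = -2 * h 3 + 6 * h 0 + t * (lam * t / (2 * h 0 ^ 3)) *
        (h 1 * h 2 * h 3 + h 3 ^ 2 * h₄ - 2 * t ^ 2 * h 1 * h₄ ^ 2) := by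
    rw [funext_iff, Fin.forall_fin_succ, Fin.forall_fin_succ, Fin.forall_fin_succ,
      Fin.forall_fin_one]
    have key : ∀ i : Fin 4, d i = ((1 / t) • singA lam h + regB lam h t) i ↔
        t * d i = singA lam h i + t * regB lam h t i := fun i => by
      rw [← mul_right_inj' ht]
      simp only [Pi.add_apply, Pi.smul_apply, smul_eq_mul]
      rw [mul_add, ← mul_assoc, mul_one_div_cancel ht, one_mul]
    refine Iff.and ((key 0).trans ?_) (Iff.and ((key 1).trans ?_) (Iff.and ((key 2).trans ?_)
      ((key 3).trans ?_))) <;> simp [singA, regB, ← hh, mul_assoc]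
  rw [hA]
  have hh' : h₄ = -h 3 - lam / 6 * h 0 ^ 2 := hh
  clear_value h₄
  constructor
  · rintro ⟨H0, H1, H2, H3⟩
    refine ⟨?_, ?_, ?_, ?_⟩
    · linear_combination (norm := skip) 1 / 27 * H1
      simp only [dualCoeff]
      field_simp
      ring
    · linear_combination (norm := skip) 1 / (27 * t) * H2
      simp only [dualCoeff]
      field_simp
      ring
    · linear_combination (norm := skip) 1 / (27 * t) * H3
      simp only [dualCoeff']
      field_simp
      ring
    · linear_combination (norm := skip) -1 / 27 * (H3 + lam * h 0 / 3 * H0 - 2 * hh')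
      simp only [dualCoeff']
      field_simp
      ring
  · rintro ⟨H1, H2, H3, H4⟩
    have H3' : t * d 3 = -2 * h 3 + 6 * h 0 + t * (lam * t / (2 * h 0 ^ 3)) *
        (h 1 * h 2 * h 3 + h 3 ^ 2 * h₄ - 2 * t ^ 2 * h 1 * h₄ ^ 2) := by
      linear_combination (norm := skip) 27 * t * H3
      simp only [dualCoeff']
      field_simp
      ring
    refine ⟨?_, ?_, ?_, H3'⟩
    -- As h₄' = -h₃' - (λ/3) h₀ h₀', adding the last two equations leaves h₀' with coefficient a
    -- multiple of λ h₀, which is nonzero.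
    · linear_combination (norm := skip) -3 / (lam * h 0) * (27 * H4 + H3' - 2 * hh')
      simp only [dualCoeff']
      field_simp
      ring
    · linear_combination (norm := skip) 27 * H1
      simp only [dualCoeff]
      field_simp
      ring
    · linear_combination (norm := skip) 27 * t * H2
      simp only [dualCoeff]
      field_simp
      ring

end NearlyParallel
end

noncomputable section
namespace NearlyParallel

open scoped Matrix

/-! ### Adapted frames -/

/-- The linear isomorphism `efr` onto the tangent space at a point of the curve `gam`. -/
def efrEquiv (t : ℝ) : (Fin 7 → ℝ) ≃ₗ[ℝ] tangent (gam t) where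
  toFun y := ⟨efr y, efr_mem_tangent t y⟩
  map_add' x y := Subtype.ext (map_add efr x y)
  map_smul' c x := Subtype.ext (map_smul efr c x)
  invFun w := ![(w : Amb).2.re, (w : Amb).2.imI, (w : Amb).2.imJ, (w : Amb).2.imK,
    (w : Amb).1.imI, (w : Amb).1.imJ, (w : Amb).1.imK]
  left_inv y := by funext i; fin_cases i <;> rfl
  right_inv w := by
    have h0 : (w : Amb).1.re = 0 := mem_tangent_gam.1 w.2
    apply Subtype.ext
    simp only [efr_apply, Matrix.cons_val]
    ext <;> simp [h0]

theorem coe_efrEquiv (t : ℝ) (y : Fin 7 → ℝ) : (efrEquiv t y : Amb) = efr y := rfl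

theorem efr_single_zero : efr (Pi.single 0 1) = (0, 1) := by
  ext <;> simp [efr_apply]

theorem pull_comp_symm {k : ℕ} {t : ℝ} (L : (Fin 7 → ℝ) ≃ₗ[ℝ] tangent (gam t))
    (α : Amb [⋀^Fin k]→L[ℝ] ℝ) :
    (pull L α).compLinearMap ((efrEquiv t).trans L.symm).toLinearMap =
      α.toAlternatingMap.compLinearMap efr := by
  ext y
  simp [pull, coe_efrEquiv]

theorem compLinearMap_left_inj {k : ℕ} (Q : (Fin 7 → ℝ) ≃ₗ[ℝ] (Fin 7 → ℝ))
    {α β : (Fin 7 → ℝ) [⋀^Fin k]→ₗ[ℝ] ℝ}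
    (h : α.compLinearMap Q.toLinearMap = β.compLinearMap Q.toLinearMap) : α = β := by
  ext y
  have := DFunLike.congr_fun h fun i => Q.symm (y i)
  simpa [AlternatingMap.compLinearMap_apply] using this

/-- The algebraic equation satisfied by the coefficients of a positive form `invForm` for which the
first basis vector has length one. -/
def NormalEq (f₀ f₁ f₂ f₃ f₄ : ℝ) : Prop :=
  4 * (f₃ ^ 2 - f₁ * f₄) * (f₄ ^ 2 - f₂ * f₃) - (f₃ * f₄ - f₁ * f₂) ^ 2 = 4 * f₀ ^ 6

/-- The Hodge dual of `invForm f₀ f₁ f₂ f₃ f₄`. -/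
def dualForm (f₀ f₁ f₂ f₃ f₄ : ℝ) : (Fin 7 → ℝ) [⋀^Fin 4]→ₗ[ℝ] ℝ :=
  fourForm (f₀ ^ 2) (dualCoeff f₀ f₁ f₂ f₃ f₄) (-dualCoeff f₀ f₂ f₁ f₄ f₃)
    (dualCoeff' f₀ f₁ f₂ f₃ f₄) (-dualCoeff' f₀ f₂ f₁ f₄ f₃)

theorem exists_normalEquiv {f₀ f₁ f₂ f₃ f₄ : ℝ} (hf : f₀ ≠ 0) (hΔ : NormalEq f₀ f₁ f₂ f₃ f₄) :
    ∃ N : (Fin 7 → ℝ) ≃ₗ[ℝ] (Fin 7 → ℝ),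
      stdPhi.compLinearMap N.toLinearMap = invForm f₀ f₁ f₂ f₃ f₄ ∧
      stdPsi.compLinearMap N.toLinearMap = dualForm f₀ f₁ f₂ f₃ f₄ ∧
      N (Pi.single 0 1) = Pi.single 0 1 := by
  obtain ⟨a, b, h0, h1, h2, h3, h4⟩ := exists_normal hf hΔ
  have hinj := normalMap_injective (a := a) (b := b) (by rwa [h0])
  have hto : (LinearEquiv.ofInjectiveEndo _ hinj).toLinearMap = normalMap a b := rfl
  refine ⟨LinearEquiv.ofInjectiveEndo _ hinj, ?_, ?_, ?_⟩
  · rw [hto, stdPhi_comp_normalMap, h0, h1, h2, h3, h4]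
  · rw [hto, stdPsi_comp_normalMap, dualForm]
    obtain ⟨g1, g2, g3, g4⟩ := dualCoeff_normal h0 h1 h2 h3 h4 hf
    rw [g1, g2, g3, g4, h0]
  · rw [LinearEquiv.coe_ofInjectiveEndo, normalMap_apply]
    funext i
    fin_cases i <;> simp

/-- Two identifications with `stdPhi` differ by an element of its stabilizer, so the dual form and
the length of γ' may be computed with the explicit normal map. -/
theorem dualForm_of_stdPhi_comp {f₀ f₁ f₂ f₃ f₄ : ℝ} (hf : f₀ ≠ 0)
    (hΔ : NormalEq f₀ f₁ f₂ f₃ f₄) (Q : (Fin 7 → ℝ) ≃ₗ[ℝ] (Fin 7 → ℝ))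
    (hQ : stdPhi.compLinearMap Q.toLinearMap = invForm f₀ f₁ f₂ f₃ f₄) :
    stdPsi.compLinearMap Q.toLinearMap = dualForm f₀ f₁ f₂ f₃ f₄ ∧
      Q (Pi.single 0 1) ⬝ᵥ Q (Pi.single 0 1) = 1 := by
  obtain ⟨N, hN, hN', hN0⟩ := exists_normalEquiv hf hΔ
  have hcomp : (N.symm.trans Q).toLinearMap ∘ₗ N.toLinearMap = Q.toLinearMap :=
    LinearMap.ext fun y => by simp
  have hA : stdPhi.compLinearMap (N.symm.trans Q).toLinearMap = stdPhi := by
    apply compLinearMap_left_inj N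
    rw [AlternatingMap.compLinearMap_assoc, hcomp, hN, hQ]
  constructor
  · rw [← hN', ← hcomp, ← AlternatingMap.compLinearMap_assoc, stdPsi_comp hA]
  · have := dot_of_stdPhi_comp hA (Pi.single 0 1) (Pi.single 0 1)
    have hs : N.symm (Pi.single 0 1) = Pi.single 0 1 := by rw [LinearEquiv.symm_apply_eq, hN0]
    simpa [hs] using this

section

variable {t f₀ f₁ f₂ f₃ f₄ : ℝ} {φ : Amb [⋀^Fin 3]→L[ℝ] ℝ}

theorem stdPhi_comp_of_isAdapted
    (hφ : φ.toAlternatingMap.compLinearMap efr = invForm f₀ f₁ f₂ f₃ f₄)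
    {L : (Fin 7 → ℝ) ≃ₗ[ℝ] tangent (gam t)} (hL : IsAdapted φ L) :
    stdPhi.compLinearMap ((efrEquiv t).trans L.symm).toLinearMap = invForm f₀ f₁ f₂ f₃ f₄ := by
  rw [← hφ, ← pull_comp_symm L, hL]

theorem exists_isAdapted (t : ℝ)
    (hφ : φ.toAlternatingMap.compLinearMap efr = invForm f₀ f₁ f₂ f₃ f₄) (hf : f₀ ≠ 0)
    (hΔ : NormalEq f₀ f₁ f₂ f₃ f₄) :
    ∃ L : (Fin 7 → ℝ) ≃ₗ[ℝ] tangent (gam t), IsAdapted φ L := by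
  obtain ⟨N, hN, -, -⟩ := exists_normalEquiv hf hΔ
  refine ⟨N.symm.trans (efrEquiv t), compLinearMap_left_inj N ?_⟩
  rw [hN, ← hφ]
  ext y
  simp [pull, coe_efrEquiv]

theorem pull_eq_smul_stdPsi_iff
    (hφ : φ.toAlternatingMap.compLinearMap efr = invForm f₀ f₁ f₂ f₃ f₄) (hf : f₀ ≠ 0)
    (hΔ : NormalEq f₀ f₁ f₂ f₃ f₄) {L : (Fin 7 → ℝ) ≃ₗ[ℝ] tangent (gam t)} (hL : IsAdapted φ L)
    (lam : ℝ) (β : Amb [⋀^Fin 4]→L[ℝ] ℝ) :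
    pull L β = lam • stdPsi ↔
      β.toAlternatingMap.compLinearMap efr = lam • dualForm f₀ f₁ f₂ f₃ f₄ := by
  have h := (dualForm_of_stdPhi_comp hf hΔ _ (stdPhi_comp_of_isAdapted hφ hL)).1
  rw [← h, ← pull_comp_symm L]
  constructor
  · intro h'; rw [h']; rfl
  · intro h'; exact compLinearMap_left_inj _ h'

theorem symm_apply_unit (L : (Fin 7 → ℝ) ≃ₗ[ℝ] tangent (gam t)) {y : Fin 7 → ℝ}
    (hy : (L y : Amb) = (0, 1)) : (efrEquiv t).trans L.symm (Pi.single 0 1) = y := by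
  rw [LinearEquiv.trans_apply, LinearEquiv.symm_apply_eq]
  apply Subtype.ext
  rw [hy, coe_efrEquiv, efr_single_zero]

theorem sum_sq_eq_one (hφ : φ.toAlternatingMap.compLinearMap efr = invForm f₀ f₁ f₂ f₃ f₄)
    (hf : f₀ ≠ 0) (hΔ : NormalEq f₀ f₁ f₂ f₃ f₄) {L : (Fin 7 → ℝ) ≃ₗ[ℝ] tangent (gam t)}
    (hL : IsAdapted φ L) {y : Fin 7 → ℝ} (hy : (L y : Amb) = (0, 1)) : ∑ i, y i ^ 2 = 1 := by
  have h := (dualForm_of_stdPhi_comp hf hΔ _ (stdPhi_comp_of_isAdapted hφ hL)).2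
  rw [symm_apply_unit L hy] at h
  simpa [dotProduct, sq] using h

theorem ne_zero_of_isAdapted (hφ : φ.toAlternatingMap.compLinearMap efr = invForm f₀ f₁ f₂ f₃ f₄)
    {L : (Fin 7 → ℝ) ≃ₗ[ℝ] tangent (gam t)} (hL : IsAdapted φ L) : f₀ ≠ 0 :=
  (positive_invForm _ (stdPhi_comp_of_isAdapted hφ hL)).1

theorem normalEq_of_isAdapted
    (hφ : φ.toAlternatingMap.compLinearMap efr = invForm f₀ f₁ f₂ f₃ f₄)
    {L : (Fin 7 → ℝ) ≃ₗ[ℝ] tangent (gam t)} (hL : IsAdapted φ L)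
    (hu : ∀ y : Fin 7 → ℝ, (L y : Amb) = (0, 1) → ∑ i, y i ^ 2 = 1) :
    NormalEq f₀ f₁ f₂ f₃ f₄ := by
  refine (positive_invForm _ (stdPhi_comp_of_isAdapted hφ hL)).2 ?_
  have h := hu ((efrEquiv t).trans L.symm (Pi.single 0 1))
    (by simp [coe_efrEquiv, efr_single_zero])
  simpa [dotProduct, sq] using h

end

/-! ### The frame along `gam` -/

/-- The coordinates of the vectors `frameVec` in the frame `efr`. -/
def frameMap (t : ℝ) : (Fin 7 → ℝ) →ₗ[ℝ] (Fin 7 → ℝ) where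
  toFun y := ![y 0, -3 * t * y 1, -3 * t * y 2, -3 * t * y 3, -3 * y 4, -3 * y 5, -3 * y 6]
  map_add' x y := by funext i; fin_cases i <;> simp <;> ring
  map_smul' c y := by funext i; fin_cases i <;> simp <;> ring

theorem frameMap_apply (t : ℝ) (y : Fin 7 → ℝ) : frameMap t y =
    ![y 0, -3 * t * y 1, -3 * t * y 2, -3 * t * y 3, -3 * y 4, -3 * y 5, -3 * y 6] := rfl

/-- At (1, t) the element (X, -2X, X) induces (0, -3tX) and (-2X, X, X) induces (-3X, 0). This is
the source of the factors 9 and 27 below. -/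
theorem frame_eq (t : ℝ) : frame t = efr ∘ₗ frameMap t := by
  refine LinearMap.ext fun y => ?_
  rw [frame, Fintype.linearCombination_apply, Fin.sum_univ_seven, LinearMap.comp_apply,
    frameMap_apply, efr_apply]
  simp only [frameVec, Matrix.cons_val]
  have i0 : imUnit 0 = quat 0 1 0 0 := by simp [imUnit, quat]; rfl
  have i1 : imUnit 1 = quat 0 0 1 0 := by simp [imUnit, quat]; rfl
  have i2 : imUnit 2 = quat 0 0 0 1 := by simp [imUnit, quat]; rfl
  rw [i0, i1, i2]
  ext <;> simp [fundamental, jPlus, jMinus, gam] <;> ring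

theorem frameMap_surjective {t : ℝ} (ht : t ≠ 0) (y : Fin 7 → ℝ) : frameMap t
    ![y 0, -(y 1 / (3 * t)), -(y 2 / (3 * t)), -(y 3 / (3 * t)), -(y 4 / 3), -(y 5 / 3),
      -(y 6 / 3)] = y := by
  funext i
  fin_cases i <;> simp [frameMap_apply] <;> field_simp

theorem invForm_frameMap (f₀ f₁ f₂ f₃ f₄ t : ℝ) :
    (invForm f₀ f₁ f₂ f₃ f₄).compLinearMap (frameMap t) = invForm (9 * t * f₀)
      (-27 * t ^ 3 * f₁) (-27 * f₂) (-27 * t ^ 2 * f₃) (-27 * t * f₄) := by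
  ext y
  rw [AlternatingMap.compLinearMap_apply]
  simp only [invForm_apply, elem_three, frameMap_apply, Matrix.cons_val]
  ring

theorem comp_frame_eq_invForm_iff {t : ℝ} (ht : t ≠ 0) (φ : Amb [⋀^Fin 3]→L[ℝ] ℝ)
    (f₀ f₁ f₂ f₃ f₄ : ℝ) :
    φ.toAlternatingMap.compLinearMap (frame t) = invForm f₀ f₁ f₂ f₃ f₄ ↔
      φ.toAlternatingMap.compLinearMap efr = invForm (f₀ / (9 * t)) (-f₁ / (27 * t ^ 3))
        (-f₂ / 27) (-f₃ / (27 * t ^ 2)) (-f₄ / (27 * t)) := by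
  have h : invForm f₀ f₁ f₂ f₃ f₄ = (invForm (f₀ / (9 * t)) (-f₁ / (27 * t ^ 3))
      (-f₂ / 27) (-f₃ / (27 * t ^ 2)) (-f₄ / (27 * t))).compLinearMap (frameMap t) := by
    rw [invForm_frameMap]
    congr 1 <;> field_simp
  rw [h, frame_eq, ← AlternatingMap.compLinearMap_assoc]
  constructor
  · intro h'
    ext y
    have := DFunLike.congr_fun h' fun i => ![y i 0, -(y i 1 / (3 * t)), -(y i 2 / (3 * t)),
      -(y i 3 / (3 * t)), -(y i 4 / 3), -(y i 5 / 3), -(y i 6 / 3)]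
    simpa only [AlternatingMap.compLinearMap_apply, frameMap_surjective ht] using this
  · intro h'; rw [h']

theorem fourForm_inj {c g₁ g₂ g₃ g₄ c' g₁' g₂' g₃' g₄' : ℝ}
    (h : fourForm c g₁ g₂ g₃ g₄ = fourForm c' g₁' g₂' g₃' g₄') :
    c = c' ∧ g₁ = g₁' ∧ g₂ = g₂' ∧ g₃ = g₃' ∧ g₄ = g₄' := by
  have key : ∀ i j k l : Fin 7, fourForm c g₁ g₂ g₃ g₄ ![Pi.single i 1, Pi.single j 1,
      Pi.single k 1, Pi.single l 1] = fourForm c' g₁' g₂' g₃' g₄' ![Pi.single i 1, Pi.single j 1,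
      Pi.single k 1, Pi.single l 1] := fun i j k l => by rw [h]
  have h0 := key 1 4 2 5
  have h1 := key 0 1 2 3
  have h2 := key 0 4 5 6
  have h3 := key 0 1 2 6
  have h4 := key 0 1 5 6
  simp [fourForm_apply, elem_four, elem_three] at h0 h1 h2 h3 h4
  exact ⟨h0, h1, h2, h3, h4⟩

theorem smul_fourForm (r c g₁ g₂ g₃ g₄ : ℝ) : r • fourForm c g₁ g₂ g₃ g₄ =
    fourForm (r * c) (r * g₁) (r * g₂) (r * g₃) (r * g₄) := by
  ext y
  rw [AlternatingMap.smul_apply, fourForm_apply, fourForm_apply, smul_eq_mul]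
  ring

end NearlyParallel
end

noncomputable section
namespace NearlyParallel

/-! ### From nearly parallel structures to solutions of the singular initial value problem -/

/-- The value of a `3`-form on three vectors of the frame `efr`. -/
def coeff (i j k : Fin 7) (α : Amb [⋀^Fin 3]→L[ℝ] ℝ) : ℝ :=
  α ![efr (Pi.single i 1), efr (Pi.single j 1), efr (Pi.single k 1)]

theorem coeff_of_eq_invForm {α : Amb [⋀^Fin 3]→L[ℝ] ℝ} {f₀ f₁ f₂ f₃ f₄ : ℝ}
    (h : α.toAlternatingMap.compLinearMap efr = invForm f₀ f₁ f₂ f₃ f₄) :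
    coeff 0 1 4 α = f₀ ∧ coeff 1 2 3 α = f₁ ∧ coeff 4 5 6 α = f₂ ∧ coeff 1 2 6 α = f₃ ∧
      coeff 1 5 6 α = f₄ := by
  have key : ∀ i j k : Fin 7, coeff i j k α = invForm f₀ f₁ f₂ f₃ f₄
      ![Pi.single i 1, Pi.single j 1, Pi.single k 1] := fun i j k => by
    rw [← h, AlternatingMap.compLinearMap_apply, coeff]
    change α _ = α _
    congr 1
    funext l
    fin_cases l <;> rfl
  simp only [key]
  refine ⟨?_, ?_, ?_, ?_, ?_⟩ <;> simp [invForm_apply, elem_three]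

theorem contDiff_gam : ContDiff ℝ ∞ gam := by
  have : gam = fun t : ℝ => ((1 : ℍ[ℝ]), t • (1 : ℍ[ℝ])) := by
    funext t; ext <;> simp [gam]
  rw [this]
  fun_prop

section

variable {T : ℝ} {φ : Amb → Amb [⋀^Fin 3]→L[ℝ] ℝ}

theorem contDiffOn_apply_gam {n : ℕ} {φ : Amb → Amb [⋀^Fin n]→L[ℝ] ℝ}
    (hφ : ContDiffOn ℝ ∞ φ (nhd T)) (v : Fin n → Amb) :
    ContDiffOn ℝ ∞ (fun t => φ (gam t) v) (Ioo (-T) T) := by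
  have h : ContDiffOn ℝ ∞ (fun t => φ (gam t)) (Ioo (-T) T) :=
    hφ.comp contDiff_gam.contDiffOn fun _ ht => gam_mem_nhd ht
  have h' : ContDiff ℝ ∞ (ContinuousAlternatingMap.apply ℝ Amb ℝ v) :=
    ContinuousLinearMap.contDiff _
  exact h'.comp_contDiffOn h

/-- The element (1, -1, 1) sends `gam t` to `gam (-t)` and is -1 on the second factor. It makes f₁
and f₄ odd and the other coefficients even. -/
theorem IsInvariant.comp_neg (hφ : IsInvariant T φ) {t : ℝ} (ht : t ∈ Ioo (-T) T) :
    (φ (gam (-t))).toAlternatingMap.compLinearMap efr =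
      ((φ (gam t)).toAlternatingMap.compLinearMap efr).compLinearMap (scaleMap (-1)) := by
  ext y
  have h := hφ (1, -1, 1) (gam t) (gam_mem_tube ht) (fun i => efr (scaleMap (-1) (y i)))
    fun i => efr_mem_tangent _ _
  have hm : ((-1 : Sp1) : ℍ[ℝ]) = -1 := rfl
  have e1 : act (1, -1, 1) (gam t) = gam (-t) := by ext1 <;> simp [act, gam, hm]
  have e2 : ∀ i, act (1, -1, 1) (efr (scaleMap (-1) (y i))) = efr (y i) := fun i => by
    ext <;> simp [act, efr_apply, scaleMap_apply, hm]
  simp only [e1, e2] at h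
  exact h

/-- The shape of the form is known for t > 0; it extends to t < 0 by the reflection and to t = 0 by
continuity. -/
theorem IsInvariant.eq_invForm (hT : 0 < T) (hφ : IsInvariant T φ)
    (hs : ContDiffOn ℝ ∞ φ (nhd T))
    (hf : ∀ t ∈ Ioo 0 T, ∃ f₀ f₁ f₂ f₃ f₄ : ℝ,
      (φ (gam t)).toAlternatingMap.compLinearMap efr = invForm f₀ f₁ f₂ f₃ f₄)
    {t : ℝ} (ht : t ∈ Ioo (-T) T) :
    (φ (gam t)).toAlternatingMap.compLinearMap efr = invForm (coeff 0 1 4 (φ (gam t)))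
      (coeff 1 2 3 (φ (gam t))) (coeff 4 5 6 (φ (gam t))) (coeff 1 2 6 (φ (gam t)))
      (coeff 1 5 6 (φ (gam t))) := by
  have heq : ∀ {s : ℝ} {f₀ f₁ f₂ f₃ f₄ : ℝ},
      (φ (gam s)).toAlternatingMap.compLinearMap efr = invForm f₀ f₁ f₂ f₃ f₄ →
      (φ (gam s)).toAlternatingMap.compLinearMap efr = invForm (coeff 0 1 4 (φ (gam s)))
      (coeff 1 2 3 (φ (gam s))) (coeff 4 5 6 (φ (gam s))) (coeff 1 2 6 (φ (gam s)))
      (coeff 1 5 6 (φ (gam s))) := by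
    intro s f₀ f₁ f₂ f₃ f₄ h
    obtain ⟨h0, h1, h2, h3, h4⟩ := coeff_of_eq_invForm h
    rw [h0, h1, h2, h3, h4, h]
  have hpos : ∀ s ∈ Ioo 0 T, (φ (gam s)).toAlternatingMap.compLinearMap efr =
      invForm (coeff 0 1 4 (φ (gam s))) (coeff 1 2 3 (φ (gam s))) (coeff 4 5 6 (φ (gam s)))
      (coeff 1 2 6 (φ (gam s))) (coeff 1 5 6 (φ (gam s))) := by
    intro s hs
    obtain ⟨f₀, f₁, f₂, f₃, f₄, h⟩ := hf s hs
    exact heq h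
  rcases lt_trichotomy t 0 with h | h | h
  · have ht' : -t ∈ Ioo 0 T := ⟨by linarith, by linarith [ht.1]⟩
    have h1 := hφ.comp_neg (t := -t) ⟨by linarith [ht.2], by linarith [ht.1]⟩
    rw [neg_neg, hpos _ ht', invForm_scaleMap] at h1
    exact heq h1
  · subst h
    ext y
    have hc : ∀ v : Fin 3 → Amb, ContinuousOn (fun t => φ (gam t) v) (Ioo (-T) T) :=
      fun v => (contDiffOn_apply_gam hs v).continuousOn
    have hcc : ∀ i j k : Fin 7, ContinuousOn (fun t => coeff i j k (φ (gam t))) (Ioo (-T) T) :=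
      fun i j k => hc _
    set D : ℝ → ℝ := fun t => φ (gam t) (fun i => efr (y i)) -
      invForm (coeff 0 1 4 (φ (gam t))) (coeff 1 2 3 (φ (gam t))) (coeff 4 5 6 (φ (gam t)))
      (coeff 1 2 6 (φ (gam t))) (coeff 1 5 6 (φ (gam t))) y with hD
    have hDc : ContinuousAt D 0 := by
      refine ContinuousOn.continuousAt (s := Ioo (-T) T) ?_ (isOpen_Ioo.mem_nhds ht)
      simp only [hD, invForm_apply]
      exact (hc _).sub ((((((hcc _ _ _).mul continuousOn_const).add
        ((hcc _ _ _).mul continuousOn_const)).add ((hcc _ _ _).mul continuousOn_const)).add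
        ((hcc _ _ _).mul continuousOn_const)).add ((hcc _ _ _).mul continuousOn_const))
    have hD0 : ∀ᶠ s in nhdsWithin (0 : ℝ) (Ioi 0), D s = 0 := by
      filter_upwards [Ioo_mem_nhdsGT hT] with s hs
      exact sub_eq_zero.2 (DFunLike.congr_fun (hpos s hs) y)
    have h0 : D 0 = 0 := tendsto_nhds_unique_of_eventuallyEq
      (hDc.tendsto.mono_left nhdsWithin_le_nhds) tendsto_const_nhds hD0
    exact sub_eq_zero.1 h0
  · exact hpos t ⟨h, ht.2⟩

theorem IsInvariantNP.equations {lam t : ℝ} (hφ : IsInvariantNP lam T φ) (ht : t ∈ Ioo 0 T)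
    {f₀ f₁ f₂ f₃ f₄ : ℝ → ℝ}
    (hf : ∀ s ∈ Ioo 0 T, (φ (gam s)).toAlternatingMap.compLinearMap efr =
      invForm (f₀ s) (f₁ s) (f₂ s) (f₃ s) (f₄ s))
    (hu : ∀ L : (Fin 7 → ℝ) ≃ₗ[ℝ] tangent (gam t), IsAdapted (φ (gam t)) L →
      ∀ y : Fin 7 → ℝ, (L y : Amb) = (0, 1) → ∑ i, y i ^ 2 = 1)
    {d₀ d₁ d₂ d₃ d₄ : ℝ}
    (h₀ : HasDerivAt f₀ d₀ t) (h₁ : HasDerivAt f₁ d₁ t) (h₂ : HasDerivAt f₂ d₂ t)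
    (h₃ : HasDerivAt f₃ d₃ t) (h₄ : HasDerivAt f₄ d₄ t) :
    2 * (f₃ t + f₄ t / t) = lam * f₀ t ^ 2 ∧
      -(d₁ + 3 * f₁ t / t) = lam * dualCoeff (f₀ t) (f₁ t) (f₂ t) (f₃ t) (f₄ t) ∧
      -d₂ = lam * -dualCoeff (f₀ t) (f₂ t) (f₁ t) (f₄ t) (f₃ t) ∧
      -(d₃ + 2 * f₃ t / t + 2 * f₀ t / t) =
        lam * dualCoeff' (f₀ t) (f₁ t) (f₂ t) (f₃ t) (f₄ t) ∧
      -(d₄ + f₄ t / t - 2 * f₀ t) = lam * -dualCoeff' (f₀ t) (f₂ t) (f₁ t) (f₄ t) (f₃ t) := by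
  have ht' : t ∈ Ioo (-T) T := ⟨by linarith [ht.1, ht.2], ht.2⟩
  obtain ⟨L, hL⟩ := hφ.positive _ (gam_mem_tube ht')
  have hn := normalEq_of_isAdapted (hf t ht) hL (hu L hL)
  have h1 := (pull_eq_smul_stdPsi_iff (hf t ht) (ne_zero_of_isAdapted (hf t ht) hL) hn hL lam _).1
    (hφ.nearly_parallel _ (gam_mem_tube ht') L hL)
  have hd : DifferentiableAt ℝ φ (gam t) :=
    (hφ.smooth.contDiffAt ((isOpen_nhd T).mem_nhds (gam_mem_nhd ht'))).differentiableAt (by simp)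
  rw [IsInvariant.extDeriv_gam hφ.invariant ht hd hf h₀ h₁ h₂ h₃ h₄, dualForm, smul_fourForm] at h1
  exact fourForm_inj h1

end

end NearlyParallel
end

/-! ### Behaviour at t = 0 and the system satisfied by h -/

noncomputable section
namespace NearlyParallel

theorem hasDerivAt_of_contDiffOn {E : Type*} [NormedAddCommGroup E] [NormedSpace ℝ E] {T t : ℝ}
    {g : ℝ → E} (hg : ContDiffOn ℝ ∞ g (Ioo (-T) T)) (ht : t ∈ Ioo (-T) T) :
    HasDerivAt g (deriv g t) t :=
  ((hg.contDiffAt (isOpen_Ioo.mem_nhds ht)).differentiableAt (by simp)).hasDerivAt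

/-- An even function which satisfies the differential equation for `t > 0` satisfies it for
`t ≠ 0`. -/
theorem hasDerivAt_neg_of_isEvenOn {lam T t : ℝ} {h : ℝ → Fin 4 → ℝ} (he : IsEvenOn T h)
    (ht : -t ∈ Ioo (-T) T)
    (hd : HasDerivAt h ((1 / t) • singA lam (h t) + regB lam (h t) t) t) :
    HasDerivAt h ((1 / -t) • singA lam (h (-t)) + regB lam (h (-t)) (-t)) (-t) := by
  have ht' : t ∈ Ioo (-T) T := ⟨by linarith [ht.2], by linarith [ht.1]⟩
  have h1 : HasDerivAt (fun s => h (-s)) ((-1 : ℝ) • ((1 / t) • singA lam (h t) + regB lam (h t) t))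
      (-t) := by
    rw [← neg_neg t] at hd
    have := hd.scomp (-t) (hasDerivAt_neg (-t))
    rw [neg_neg] at this
    exact this
  have h2 := h1.congr_of_eventuallyEq (f₁ := h) (by
    filter_upwards [isOpen_Ioo.mem_nhds ht] with s hs using (he s hs).symm)
  refine h2.congr_deriv ?_
  rw [he t ht']
  funext i
  fin_cases i <;> simp [singA, regB] <;> ring

/-- The initial value of a smooth solution of the singular differential equation. -/
theorem init_of_ode {lam T : ℝ} (hT : 0 < T) {h : ℝ → Fin 4 → ℝ}
    (hs : ContDiffOn ℝ ∞ h (Ioo (-T) T)) (h0 : h 0 0 ≠ 0)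
    (hd : ∀ t ∈ Ioo 0 T, deriv h t = (1 / t) • singA lam (h t) + regB lam (h t) t) :
    h 0 = ![h 0 0, 27 / 4 * lam, -(h 0 0 ^ 3 / 27), 3 * h 0 0] := by
  have ht : (0 : ℝ) ∈ Ioo (-T) T := ⟨by linarith, hT⟩
  have hc : ContinuousAt h 0 := (hs.continuousOn).continuousAt (isOpen_Ioo.mem_nhds ht)
  have hdc : ContinuousAt (deriv h) 0 :=
    (hs.continuousOn_deriv_of_isOpen isOpen_Ioo (by simp)).continuousAt (isOpen_Ioo.mem_nhds ht)
  have hci : ∀ i, ContinuousAt (fun t => h t i) 0 := fun i =>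
    (continuous_apply i).continuousAt.comp hc
  have hdi : ∀ i, ContinuousAt (fun t => deriv h t i) 0 := fun i =>
    (continuous_apply i).continuousAt.comp hdc
  -- In A(h) = t h' - t B(h, t) the right side tends to 0, so A(h(0)) = 0; components 0, 1 and 3
  -- determine h(0) from h₀(0).
  have key : ∀ i : Fin 4, ContinuousAt (fun t => singA lam (h t) i) 0 →
      ContinuousAt (fun t => regB lam (h t) t i) 0 → singA lam (h 0) i = 0 := by
    intro i hA hB
    have hD : ContinuousAt (fun t => t * deriv h t i - t * regB lam (h t) t i) 0 :=
      (continuousAt_id.mul (hdi i)).sub (continuousAt_id.mul hB)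
    have hD0 : ∀ᶠ s in nhdsWithin (0 : ℝ) (Ioi 0),
        s * deriv h s i - s * regB lam (h s) s i = singA lam (h s) i := by
      filter_upwards [Ioo_mem_nhdsGT hT] with s hs
      have hs0 : s ≠ 0 := hs.1.ne'
      rw [hd s hs]
      simp only [Pi.add_apply, Pi.smul_apply, smul_eq_mul]
      field_simp
      ring
    have := tendsto_nhds_unique_of_eventuallyEq (hA.tendsto.mono_left nhdsWithin_le_nhds)
      (hD.tendsto.mono_left nhdsWithin_le_nhds) (hD0.mono fun _ h => h.symm)
    simpa using this
  have hc0 := hci 0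
  have hc1 := hci 1
  have hc2 := hci 2
  have hc3 := hci 3
  have hn : ∀ (c : ℝ) (n : ℕ), c ≠ 0 → c * h 0 0 ^ n ≠ 0 := fun c n hc =>
    mul_ne_zero hc (pow_ne_zero n h0)
  have hn' : ∀ n : ℕ, h 0 0 ^ n ≠ 0 := fun n => pow_ne_zero n h0
  have k0 := key 0 (by
      simp only [singA, Matrix.cons_val]
      fun_prop (disch := exact hn' _))
    (by
      simp only [regB, hFour, Matrix.cons_val]
      fun_prop (disch := exact hn _ _ (by norm_num)))
  have k1 := key 1 (by
      simp only [singA, Matrix.cons_val]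
      fun_prop (disch := exact hn' _))
    (by
      simp only [regB, hFour, Matrix.cons_val]
      fun_prop (disch := exact hn _ _ (by norm_num)))
  have k3 := key 3 (by
      simp only [singA, Matrix.cons_val]
      fun_prop)
    (by
      simp only [regB, hFour, Matrix.cons_val]
      fun_prop (disch := exact hn _ _ (by norm_num)))
  simp only [singA, Matrix.cons_val] at k0 k1 k3
  have e3 : h 0 3 = 3 * h 0 0 := by linarith
  rw [e3] at k0 k1
  field_simp at k0 k1
  funext i
  fin_cases i
  · rfl
  · simp only [Fin.mk_one, Matrix.cons_val]; linarith
  · simp only [Fin.reduceFinMk, Matrix.cons_val]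
    linarith
  · exact e3

theorem exists_solution_of_definesNP {lam : ℝ} (hlam : lam ≠ 0) {T : ℝ} (hT : 0 < T)
    {f : Fin 5 → ℝ → ℝ} (hf : DefinesNP lam T f) :
    ∃ a : ℝ, a ≠ 0 ∧ ∃ h : ℝ → Fin 4 → ℝ, IsSingularSolution lam a T h ∧ IsEvenOn T h ∧
      ∀ t ∈ Ioo 0 T, f 0 t = t * h t 0 ∧ f 1 t = t ^ 4 * h t 1 ∧ f 2 t = h t 2 ∧
        f 3 t = t ^ 2 * h t 3 ∧ f 4 t = t ^ 2 * hFour lam (h t) := by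
  obtain ⟨φ, hφ, hfr, hu⟩ := hf
  have hinv : IsInvariant T φ := hφ.invariant
  have hfr' := fun t (ht : t ∈ Ioo 0 T) =>
    (comp_frame_eq_invForm_iff ht.1.ne' (φ (gam t)) _ _ _ _ _).1 (hfr t ht)
  have hsub : ∀ {t}, t ∈ Ioo 0 T → t ∈ Ioo (-T) T := fun ht => ⟨by linarith [ht.1], ht.2⟩
  have hneg : ∀ {t}, t ∈ Ioo (-T) T → -t ∈ Ioo (-T) T :=
    fun ht => ⟨by linarith [ht.2], by linarith [ht.1]⟩
  have h00 : (0 : ℝ) ∈ Ioo (-T) T := ⟨by linarith, hT⟩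
  have hall := fun t (ht : t ∈ Ioo (-T) T) => hinv.eq_invForm hT hφ.smooth
    (fun t ht => ⟨_, _, _, _, _, hfr' t ht⟩) ht
  have hcs : ∀ i j k : Fin 7, ContDiffOn ℝ ∞ (fun t => coeff i j k (φ (gam t))) (Ioo (-T) T) :=
    fun i j k => contDiffOn_apply_gam hφ.smooth _
  -- parity of the coefficients
  have hpar := fun t (ht : t ∈ Ioo (-T) T) => by
    have := hinv.comp_neg ht
    rw [hall t ht, invForm_scaleMap] at this
    exact coeff_of_eq_invForm this
  obtain ⟨k1, hk1s, hk1, hk1e⟩ := exists_eq_mul_of_odd (hcs 1 2 3) fun t ht => by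
    rw [(hpar t ht).2.1]; ring
  obtain ⟨k4, hk4s, hk4, hk4e⟩ := exists_eq_mul_of_odd (hcs 1 5 6) fun t ht => by
    rw [(hpar t ht).2.2.2.2]; ring
  set h : ℝ → Fin 4 → ℝ := fun t => ![9 * coeff 0 1 4 (φ (gam t)), -27 * k1 t,
    -27 * coeff 4 5 6 (φ (gam t)), -27 * coeff 1 2 6 (φ (gam t))] with hh
  have hhs : ContDiffOn ℝ ∞ h (Ioo (-T) T) := by
    rw [contDiffOn_pi]
    intro i
    fin_cases i
    · exact contDiffOn_const.mul (hcs _ _ _)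
    · exact contDiffOn_const.mul hk1s
    · exact contDiffOn_const.mul (hcs _ _ _)
    · exact contDiffOn_const.mul (hcs _ _ _)
  have hhe : IsEvenOn T h := by
    intro t ht
    obtain ⟨p0, -, p2, p3, -⟩ := hpar t ht
    simp only [hh, p0, p2, p3, hk1e t ht]
    norm_num
  -- Positivity is used at t = 0 too, where `efr` is still a frame; it gives a ≠ 0.
  have hne : ∀ t ∈ Ioo (-T) T, h t 0 ≠ 0 := by
    intro t ht
    obtain ⟨L, hL⟩ := hφ.positive _ (gam_mem_tube ht)
    exact mul_ne_zero (by norm_num) (ne_zero_of_isAdapted (hall t ht) hL)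
  have hform : ∀ t ∈ Ioo 0 T, (φ (gam t)).toAlternatingMap.compLinearMap efr =
      invForm (h t 0 / 9) (-(t * h t 1) / 27) (-h t 2 / 27) (-h t 3 / 27) (t * k4 t) := by
    intro t ht
    rw [hall t (hsub ht), hk1 t (hsub ht), hk4 t (hsub ht)]
    congr 1 <;> simp [hh]
    ring
  have hd : ∀ t ∈ Ioo (-T) T, HasDerivAt h (deriv h t) t := fun t ht =>
    hasDerivAt_of_contDiffOn hhs ht
  have hd' : ∀ t ∈ Ioo (-T) T, ∀ i, HasDerivAt (fun t => h t i) (deriv h t i) t :=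
    fun t ht => hasDerivAt_pi.1 (hd t ht)
  have hdf : ∀ t ∈ Ioo (-T) T, HasDerivAt (fun s => h s 0 / 9) (deriv h t 0 / 9) t ∧
      HasDerivAt (fun s => -(s * h s 1) / 27) (-(h t 1 + t * deriv h t 1) / 27) t ∧
      HasDerivAt (fun s => -h s 2 / 27) (-deriv h t 2 / 27) t ∧
      HasDerivAt (fun s => -h s 3 / 27) (-deriv h t 3 / 27) t := by
    intro t ht
    refine ⟨(hd' t ht 0).div_const 9, ?_, (hd' t ht 2).neg.div_const 27,
      (hd' t ht 3).neg.div_const 27⟩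
    have := (((hasDerivAt_id t).mul (hd' t ht 1)).neg).div_const 27
    simpa using this
  -- The component of dφ = λ∗φ without e¹ is algebraic and identifies the last coefficient with h₄.
  have hh4 : ∀ t ∈ Ioo 0 T, t * k4 t = -(t * hFour lam (h t)) / 27 := by
    intro t ht
    obtain ⟨d0, d1, d2, d3⟩ := hdf t (hsub ht)
    have h4 := (hasDerivAt_id t).mul (hasDerivAt_of_contDiffOn hk4s (hsub ht))
    have e := (hφ.equations ht hform (hu t ht) d0 d1 d2 d3 h4).1
    have ht0 := ht.1.ne'
    rw [mul_div_cancel_left₀ _ ht0] at e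
    simp only [hFour]
    linear_combination t / 2 * e
  have hform' : ∀ t ∈ Ioo 0 T, (φ (gam t)).toAlternatingMap.compLinearMap efr =
      invForm (h t 0 / 9) (-(t * h t 1) / 27) (-h t 2 / 27) (-h t 3 / 27)
        (-(t * hFour lam (h t)) / 27) := fun t ht => by rw [hform t ht, hh4 t ht]
  have hode : ∀ t ∈ Ioo 0 T, deriv h t = (1 / t) • singA lam (h t) + regB lam (h t) t := by
    intro t ht
    have ht0 := ht.1.ne'
    obtain ⟨d0, d1, d2, d3⟩ := hdf t (hsub ht)
    have d4 : HasDerivAt (fun s => -(s * hFour lam (h s)) / 27)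
        (-(hFour lam (h t) + t * (-deriv h t 3 - lam / 6 * (2 * h t 0 * deriv h t 0))) / 27) t := by
      have h4 : HasDerivAt (fun s => hFour lam (h s))
          (-deriv h t 3 - lam / 6 * (2 * h t 0 * deriv h t 0)) t := by
        have := (hd' t (hsub ht) 3).neg.sub (((hd' t (hsub ht) 0).pow 2).const_mul (lam / 6))
        exact this.congr_deriv (by simp)
      have := (((hasDerivAt_id t).mul h4).neg).div_const 27
      simpa using this
    obtain ⟨-, e1, e2, e3, e4⟩ := hφ.equations ht hform' (hu t ht) d0 d1 d2 d3 d4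
    refine (ode_iff hlam ht0 (hne t (hsub ht))).2 ⟨?_, ?_, ?_, ?_⟩
    · rw [← e1]; field_simp; ring
    · linear_combination e2
    · rw [← e3]; field_simp; ring
    · rw [← mul_neg, ← e4]; field_simp; ring
  refine ⟨h 0 0, hne 0 h00, h, ⟨hhs, hne, ?_, init_of_ode hT hhs (hne 0 h00) hode⟩, hhe, ?_⟩
  · intro t ht ht0
    rcases lt_or_gt_of_ne ht0 with h0 | h0
    · have ht' : -t ∈ Ioo 0 T := ⟨by linarith, by linarith [ht.1]⟩
      have := hasDerivAt_neg_of_isEvenOn (lam := lam) (t := -t) hhe (by rwa [neg_neg])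
        (by rw [← hode _ ht']; exact hd _ (hsub ht'))
      rwa [neg_neg] at this
    · rw [← hode t ⟨h0, ht.2⟩]; exact hd t ht
  · intro t ht
    have ht0 := ht.1.ne'
    obtain ⟨a0, a1, a2, a3, a4⟩ := coeff_of_eq_invForm (hfr' t ht)
    obtain ⟨b0, b1, b2, b3, b4⟩ := coeff_of_eq_invForm (hform' t ht)
    rw [a0] at b0
    rw [a1] at b1
    rw [a2] at b2
    rw [a3] at b3
    rw [a4] at b4
    field_simp at b0 b1 b2 b3 b4
    refine ⟨?_, ?_, ?_, ?_, ?_⟩ <;> linarith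

end NearlyParallel
end

noncomputable section
namespace NearlyParallel

/-! ### A first integral -/

/-- The polynomial whose vanishing is equivalent to `NormalEq`. -/
def normalPoly (lam t : ℝ) (h : Fin 4 → ℝ) : ℝ :=
  4 * (h 3 ^ 2 - t ^ 2 * h 1 * hFour lam h) * (t ^ 2 * hFour lam h ^ 2 - h 2 * h 3) -
    t ^ 2 * (h 3 * hFour lam h - h 1 * h 2) ^ 2 - 4 * h 0 ^ 6

theorem normalEq_iff (lam t : ℝ) (h : Fin 4 → ℝ) :
    NormalEq (h 0 / 9) (-(t * h 1) / 27) (-h 2 / 27) (-h 3 / 27) (-(t * hFour lam h) / 27) ↔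
      normalPoly lam t h = 0 := by
  rw [NormalEq, normalPoly, ← sub_eq_zero]
  constructor
  · intro H; linear_combination 27 ^ 4 * H
  · intro H; linear_combination 1 / 27 ^ 4 * H

/-- With fᵢ the unscaled coefficients, t⁶ `normalPoly` is the defect of the discriminant equation in
f₀, …, f₄, and the system conserves it. -/
theorem hasDerivAt_normalPoly {lam t : ℝ} (ht : t ≠ 0) {h : ℝ → Fin 4 → ℝ} (h0 : h t 0 ≠ 0)
    (hd : HasDerivAt h ((1 / t) • singA lam (h t) + regB lam (h t) t) t) :
    HasDerivAt (fun s => s ^ 6 * normalPoly lam s (h s)) 0 t := by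
  have hi := hasDerivAt_pi.1 hd
  generalize hD : (1 / t) • singA lam (h t) + regB lam (h t) t = d at hi
  have i0 := hi 0
  have i1 := hi 1
  have i2 := hi 2
  have i3 := hi 3
  have i4 : HasDerivAt (fun s => hFour lam (h s)) (-d 3 - lam / 6 * (2 * h t 0 * d 0)) t := by
    have := i3.neg.sub ((i0.pow 2).const_mul (lam / 6))
    exact this.congr_deriv (by simp)
  have p : ∀ n : ℕ, HasDerivAt (fun s : ℝ => s ^ n) (n * t ^ (n - 1)) t := fun n =>
    hasDerivAt_pow n t
  have key := (p 6).mul (((((i3.pow 2).sub (((p 2).mul i1).mul i4)).const_mul 4).mul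
    (((p 2).mul (i4.pow 2)).sub (i2.mul i3))).sub
    ((p 2).mul (((i3.mul i4).sub (i1.mul i2)).pow 2)) |>.sub ((i0.pow 6).const_mul 4))
  refine key.congr_deriv ?_
  -- Eliminating λ makes h₄ an independent variable, after which the claim is an identity of
  -- rational functions.
  have hl : lam = -6 * (h t 3 + hFour lam (h t)) / h t 0 ^ 2 := by
    rw [hFour]; field_simp; ring
  subst hD
  simp only [Pi.add_apply, Pi.smul_apply, Pi.sub_apply, Pi.mul_apply, Pi.pow_apply, smul_eq_mul,
    singA, regB, Matrix.cons_val]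
  generalize hFour lam (h t) = h₄ at *
  subst hl
  generalize h t 0 = x0 at *
  generalize h t 1 = x1 at *
  generalize h t 2 = x2 at *
  generalize h t 3 = x3 at *
  field_simp
  ring

/-- The first integral vanishes at 0 thanks to the factor t⁶, hence the polynomial vanishes for t >
0. At t = 0 the initial value is used instead. -/
theorem IsSingularSolution.normalPoly_eq_zero {lam a T : ℝ} {h : ℝ → Fin 4 → ℝ}
    (hh : IsSingularSolution lam a T h) {t : ℝ} (ht : t ∈ Ico 0 T) :
    normalPoly lam t (h t) = 0 := by
  rcases ht.1.eq_or_lt with rfl | h0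
  · simp [normalPoly, hh.init]
    ring
  · have hc : ContinuousOn (fun s => s ^ 6 * normalPoly lam s (h s)) (Icc 0 t) := by
      have hsub : Icc 0 t ⊆ Ioo (-T) T := fun s hs => ⟨by linarith [hs.1, ht.1, ht.2],
        by linarith [hs.2, ht.2]⟩
      have hi : ∀ i, ContinuousOn (fun s => h s i) (Icc 0 t) := fun i =>
        (continuous_apply i).comp_continuousOn (hh.smooth.continuousOn.mono hsub)
      have h0 := hi 0
      have h1 := hi 1
      have h2 := hi 2
      have h3 := hi 3
      unfold normalPoly hFour
      fun_prop
    have hd : ∀ s ∈ Ioo 0 t, HasDerivAt (fun s => s ^ 6 * normalPoly lam s (h s)) 0 s := by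
      intro s hs
      have hs' : s ∈ Ioo (-T) T := ⟨by linarith [ht.2, hs.1], by linarith [hs.2, ht.2]⟩
      exact hasDerivAt_normalPoly hs.1.ne' (hh.ne_zero s hs') (hh.ode s hs' hs.1.ne')
    obtain ⟨c, -, hc'⟩ := exists_hasDerivAt_eq_slope _ (fun _ => 0) h0 hc hd
    have hne := h0.ne'
    simpa [hne, eq_comm (a := (0 : ℝ))] using hc'

end NearlyParallel
end

noncomputable section
namespace NearlyParallel

/-! ### Smoothness of maps into spaces of alternating forms -/

section

variable {E : Type*} [NormedAddCommGroup E] [NormedSpace ℝ E] [FiniteDimensional ℝ E] {n : ℕ}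

/-- A map into a space of alternating forms is smooth if its evaluations are smooth. -/
theorem contDiffOn_of_apply {F : Type*} [NormedAddCommGroup F] [NormedSpace ℝ F] {s : Set F}
    {φ : F → E [⋀^Fin n]→L[ℝ] ℝ} (h : ∀ u, ContDiffOn ℝ ∞ (fun x => φ x u) s) :
    ContDiffOn ℝ ∞ φ s := by
  let b := Module.finBasis ℝ E
  let ev : (E [⋀^Fin n]→L[ℝ] ℝ) →ₗ[ℝ] ((Fin n → Fin (Module.finrank ℝ E)) → ℝ) :=
    { toFun := fun f v => f fun i => b (v i)
      map_add' := fun _ _ => rfl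
      map_smul' := fun _ _ => rfl }
  have hinj : Function.Injective ev := by
    intro f g hfg
    apply ContinuousAlternatingMap.toAlternatingMap_injective
    exact Module.Basis.ext_alternating b fun v _ => congrFun hfg v
  obtain ⟨r, hr⟩ := ev.exists_leftInverse_of_injective (LinearMap.ker_eq_bot.2 hinj)
  have : φ = fun x => r.toContinuousLinearMap (ev (φ x)) := by
    funext x
    exact (LinearMap.congr_fun hr (φ x)).symm
  rw [this]
  exact r.toContinuousLinearMap.contDiff.comp_contDiffOn (contDiffOn_pi.2 fun v => h _)

end

/-! ### The invariant form of a solution -/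

/-- The coordinates, in the frame `efr`, of the projection of an element of `ℍ²`. -/
def toSeven : Amb →ₗ[ℝ] (Fin 7 → ℝ) where
  toFun z := ![z.2.re, z.2.imI, z.2.imJ, z.2.imK, z.1.imI, z.1.imJ, z.1.imK]
  map_add' x y := by funext i; fin_cases i <;> simp
  map_smul' c y := by funext i; fin_cases i <;> simp

theorem toSeven_apply (z : Amb) :
    toSeven z = ![z.2.re, z.2.imI, z.2.imJ, z.2.imK, z.1.imI, z.1.imJ, z.1.imK] := rfl

theorem toSeven_efr (y : Fin 7 → ℝ) : toSeven (efr y) = y := by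
  funext i; fin_cases i <;> rfl

/-- The form `invForm` as a continuous alternating map. -/
def invFormL (f₀ f₁ f₂ f₃ f₄ : ℝ) : (Fin 7 → ℝ) [⋀^Fin 3]→L[ℝ] ℝ where
  toMultilinearMap := (invForm f₀ f₁ f₂ f₃ f₄).toMultilinearMap
  map_eq_zero_of_eq' := (invForm f₀ f₁ f₂ f₃ f₄).map_eq_zero_of_eq'
  cont := by
    change Continuous fun v => invForm f₀ f₁ f₂ f₃ f₄ v
    simp only [invForm_apply, elem_three]
    fun_prop

/-- The contraction of the volume form of `ℝ⁴ = ℍ` with `v`. -/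
def volForm (v : ℍ[ℝ]) : (Fin 7 → ℝ) [⋀^Fin 3]→ₗ[ℝ] ℝ :=
  v.re • elem ![1, 2, 3] - v.imI • elem ![0, 2, 3] + v.imJ • elem ![0, 1, 3]
    - v.imK • elem ![0, 1, 2]

theorem volForm_apply (v : ℍ[ℝ]) (y : Fin 3 → Fin 7 → ℝ) :
    volForm v y = v.re * elem ![1, 2, 3] y - v.imI * elem ![0, 2, 3] y
      + v.imJ * elem ![0, 1, 3] y - v.imK * elem ![0, 1, 2] y := rfl

/-- The form `volForm` as a continuous alternating map. -/
def volFormL (v : ℍ[ℝ]) : (Fin 7 → ℝ) [⋀^Fin 3]→L[ℝ] ℝ where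
  toMultilinearMap := (volForm v).toMultilinearMap
  map_eq_zero_of_eq' := (volForm v).map_eq_zero_of_eq'
  cont := by
    change Continuous fun y => volForm v y
    simp only [volForm_apply, elem_three]
    fun_prop

/-- The linear map `u ↦ a u`, in coordinates. -/
def coordMap (a : Amb) : Amb →L[ℝ] (Fin 7 → ℝ) :=
  toSeven.toContinuousLinearMap ∘L ContinuousLinearMap.mul ℝ Amb a

/-- An invariant `3`-form on `ℍ²`, given by radial functions. -/
def radialForm (m g₁ f₂ f₃ g₄ : ℝ → ℝ) (x : Amb) : Amb [⋀^Fin 3]→L[ℝ] ℝ :=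
  (invFormL (m ‖x.2‖) 0 (f₂ ‖x.2‖) 0 (g₄ ‖x.2‖)).compContinuousLinearMap (coordMap (star x)) +
    (f₃ ‖x.2‖) • (invFormL (-1) 0 0 1 0).compContinuousLinearMap (coordMap (star x.1, 1)) +
    (g₁ ‖x.2‖) • (volFormL x.2).compContinuousLinearMap (coordMap (star x.1, 1))

theorem radialForm_apply (m g₁ f₂ f₃ g₄ : ℝ → ℝ) (x : Amb) (u : Fin 3 → Amb) :
    radialForm m g₁ f₂ f₃ g₄ x u =
      invForm (m ‖x.2‖) 0 (f₂ ‖x.2‖) 0 (g₄ ‖x.2‖) (fun i => toSeven (star x * u i)) +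
      f₃ ‖x.2‖ * invForm (-1) 0 0 1 0 (fun i => toSeven ((star x.1, 1) * u i)) +
      g₁ ‖x.2‖ * volForm x.2 (fun i => toSeven ((star x.1, 1) * u i)) := rfl

/-- Shows what smoothness across the zero section costs: the sum of the coefficients f₀ and f₃ must
be t² times an even function, and f₁ and f₄ must be t times even functions. -/
theorem radialForm_gam (m g₁ f₂ f₃ g₄ : ℝ → ℝ) {t : ℝ} (ht : 0 ≤ t) :
    (radialForm m g₁ f₂ f₃ g₄ (gam t)).toAlternatingMap.compLinearMap efr =
      invForm (t ^ 2 * m t - f₃ t) (t * g₁ t) (f₂ t) (f₃ t) (t * g₄ t) := by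
  ext y
  have hn : ‖(gam t).2‖ = t := by simp [gam, abs_of_nonneg ht]
  have h1 : star (gam t) = gam t := by ext1 <;> simp [gam]
  have h2 : ((star (gam t).1, 1) : Amb) = 1 := by ext1 <;> simp [gam]
  have h3 := radialForm_apply m g₁ f₂ f₃ g₄ (gam t) fun i => efr (y i)
  rw [hn, h1, h2] at h3
  simp only [one_mul, gam_mul_efr, toSeven_efr] at h3
  have h4 := DFunLike.congr_fun (invForm_scaleMap (m t) 0 (f₂ t) 0 (g₄ t) t) y
  rw [AlternatingMap.compLinearMap_apply] at h4
  rw [h4] at h3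
  refine Eq.trans h3 ?_
  rw [volForm_apply, invForm_apply, invForm_apply, invForm_apply]
  simp [gam]
  ring

theorem contDiffOn_invForm {F : Type*} [NormedAddCommGroup F] [NormedSpace ℝ F] {s : Set F}
    {f₀ f₁ f₂ f₃ f₄ : F → ℝ} {z : F → Fin 3 → Fin 7 → ℝ} (h₀ : ContDiffOn ℝ ∞ f₀ s)
    (h₁ : ContDiffOn ℝ ∞ f₁ s) (h₂ : ContDiffOn ℝ ∞ f₂ s) (h₃ : ContDiffOn ℝ ∞ f₃ s)
    (h₄ : ContDiffOn ℝ ∞ f₄ s) (hz : ContDiffOn ℝ ∞ z s) :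
    ContDiffOn ℝ ∞ (fun x => invForm (f₀ x) (f₁ x) (f₂ x) (f₃ x) (f₄ x) (z x)) s := by
  simp only [invForm_apply, elem_three]
  fun_prop

theorem contDiffOn_volForm {F : Type*} [NormedAddCommGroup F] [NormedSpace ℝ F] {s : Set F}
    {v : F → ℍ[ℝ]} {z : F → Fin 3 → Fin 7 → ℝ} (h₀ : ContDiffOn ℝ ∞ (fun x => (v x).re) s)
    (h₁ : ContDiffOn ℝ ∞ (fun x => (v x).imI) s) (h₂ : ContDiffOn ℝ ∞ (fun x => (v x).imJ) s)
    (h₃ : ContDiffOn ℝ ∞ (fun x => (v x).imK) s) (hz : ContDiffOn ℝ ∞ z s) :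
    ContDiffOn ℝ ∞ (fun x => volForm (v x) (z x)) s := by
  simp only [volForm_apply, elem_three]
  fun_prop

theorem contDiffOn_radialForm {T : ℝ} {m g₁ f₂ f₃ g₄ : ℝ → ℝ}
    (hm : ContDiffOn ℝ ∞ m (Ioo (-T) T)) (hme : ∀ t ∈ Ioo (-T) T, m (-t) = m t)
    (h₁ : ContDiffOn ℝ ∞ g₁ (Ioo (-T) T)) (h₁e : ∀ t ∈ Ioo (-T) T, g₁ (-t) = g₁ t)
    (h₂ : ContDiffOn ℝ ∞ f₂ (Ioo (-T) T)) (h₂e : ∀ t ∈ Ioo (-T) T, f₂ (-t) = f₂ t)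
    (h₃ : ContDiffOn ℝ ∞ f₃ (Ioo (-T) T)) (h₃e : ∀ t ∈ Ioo (-T) T, f₃ (-t) = f₃ t)
    (h₄ : ContDiffOn ℝ ∞ g₄ (Ioo (-T) T)) (h₄e : ∀ t ∈ Ioo (-T) T, g₄ (-t) = g₄ t) :
    ContDiffOn ℝ ∞ (radialForm m g₁ f₂ f₃ g₄) (nhd T) := by
  have hr : ∀ {g : ℝ → ℝ}, ContDiffOn ℝ ∞ g (Ioo (-T) T) → (∀ t ∈ Ioo (-T) T, g (-t) = g t) →
      ContDiffOn ℝ ∞ (fun x : Amb => g ‖x.2‖) (nhd T) := fun hg hge =>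
    (contDiffOn_radial hg hge).comp contDiff_snd.contDiffOn fun x hx => hx.2
  have hst : ContDiff ℝ ∞ (fun q : ℍ[ℝ] => star q) :=
    ({ toFun := star, map_add' := star_add, map_smul' := fun r q => Quaternion.star_smul r q } :
      ℍ[ℝ] →ₗ[ℝ] ℍ[ℝ]).toContinuousLinearMap.contDiff
  have hA : ∀ u : Fin 3 → Amb, ContDiffOn ℝ ∞ (fun x : Amb => fun i => toSeven (star x * u i))
      (nhd T) := fun u => by
    have h : ∀ i, ContDiff ℝ ∞ fun x : Amb => toSeven.toContinuousLinearMap (star x * u i) :=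
      fun i => (ContinuousLinearMap.contDiff _).comp
        (((hst.comp contDiff_fst).prodMk (hst.comp contDiff_snd)).mul contDiff_const)
    exact (contDiff_pi.2 h).contDiffOn
  have hB : ∀ u : Fin 3 → Amb, ContDiffOn ℝ ∞
      (fun x : Amb => fun i => toSeven (((star x.1, 1) : Amb) * u i)) (nhd T) := fun u => by
    have h : ∀ i, ContDiff ℝ ∞
        fun x : Amb => toSeven.toContinuousLinearMap (((star x.1, 1) : Amb) * u i) :=
      fun i => (ContinuousLinearMap.contDiff _).comp
        (((hst.comp contDiff_fst).prodMk contDiff_const).mul contDiff_const)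
    exact (contDiff_pi.2 h).contDiffOn
  have hV : ∀ j : Fin 7, ContDiffOn ℝ ∞ (fun x : Amb => toSeven x j) (nhd T) := fun j =>
    (contDiff_pi.1 (toSeven.toContinuousLinearMap.contDiff (n := ∞)) j).contDiffOn
  refine contDiffOn_of_apply fun u => ?_
  simp only [radialForm_apply]
  exact ((contDiffOn_invForm (hr hm hme) contDiffOn_const (hr h₂ h₂e) contDiffOn_const
    (hr h₄ h₄e) (hA u)).add ((hr h₃ h₃e).mul (contDiffOn_invForm contDiffOn_const contDiffOn_const
    contDiffOn_const contDiffOn_const contDiffOn_const (hB u)))).add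
    ((hr h₁ h₁e).mul (contDiffOn_volForm (hV 0) (hV 1) (hV 2) (hV 3) (hB u)))

end NearlyParallel
end

noncomputable section
namespace NearlyParallel

/-! ### Invariance of `radialForm` -/

section

variable {b c : ℍ[ℝ]}

theorem conj_mul_conj (hc : star c * c = 1) (x y : ℍ[ℝ]) :
    (c * x * star c) * (c * y * star c) = c * (x * y) * star c := by
  calc _ = c * x * (star c * c) * y * star c := by simp only [mul_assoc]
    _ = _ := by rw [hc, mul_one]; simp only [mul_assoc]

theorem re_mul_comm (x y : ℍ[ℝ]) : (x * y).re = (y * x).re := by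
  simp; ring

theorem re_conj (hc : star c * c = 1) (x : ℍ[ℝ]) : (c * x * star c).re = x.re := by
  rw [re_mul_comm, ← mul_assoc, hc, one_mul]

theorem im_conj (hc : star c * c = 1) (hc' : c * star c = 1) (x : ℍ[ℝ]) :
    (c * x * star c).im = c * x.im * star c := by
  have h : ∀ y : ℍ[ℝ], y.im = y - (y.re : ℍ[ℝ]) := fun y => by
    ext <;> simp
  rw [h, h x, re_conj hc, mul_sub, sub_mul, Quaternion.mul_coe_eq_smul, smul_mul_assoc, hc']
  congr 1
  ext <;> simp

/-- The form is a combination of real parts of products of quaternions, which conjugation by a unit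
c does not change. -/
theorem invForm_toSeven_conj (hc : star c * c = 1) (hc' : c * star c = 1) (f₀ f₂ f₄ : ℝ)
    (z : Fin 3 → Amb) :
    invForm f₀ 0 f₂ 0 f₄ (fun i => toSeven (c * (z i).1 * star c, c * (z i).2 * star c)) =
      invForm f₀ 0 f₂ 0 f₄ (fun i => toSeven (z i)) := by
  have key : ∀ z : Fin 3 → Amb, invForm f₀ 0 f₂ 0 f₄ (fun i => toSeven (z i)) =
      -(f₀ * ((z 0).2.re * (((z 1).2.im * (z 2).1.im).re - ((z 1).1.im * (z 2).2.im).re) +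
        (z 1).2.re * (((z 2).2.im * (z 0).1.im).re - ((z 2).1.im * (z 0).2.im).re) +
        (z 2).2.re * (((z 0).2.im * (z 1).1.im).re - ((z 0).1.im * (z 1).2.im).re)) +
      f₂ * ((z 0).1.im * (z 1).1.im * (z 2).1.im).re +
      f₄ * (((z 0).2.im * (z 1).1.im * (z 2).1.im).re + ((z 0).1.im * (z 1).2.im * (z 2).1.im).re +
        ((z 0).1.im * (z 1).1.im * (z 2).2.im).re)) := by
    intro z
    rw [invForm_apply]
    simp only [elem_three, toSeven_apply, Matrix.cons_val]
    simp
    ring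
  rw [key, key]
  simp only [im_conj hc hc', conj_mul_conj hc, re_conj hc]

/-- The second components enter only through products ȳ z, from which the left factor b cancels.
This piece needs no factor of v, so it is smooth and nonzero at v = 0. -/
theorem invForm_toSeven_conj' (hb : star b * b = 1) (hc : star c * c = 1) (z : Fin 3 → Amb) :
    invForm (-1) 0 0 1 0 (fun i => toSeven (c * (z i).1 * star c, b * (z i).2 * star c)) =
      invForm (-1) 0 0 1 0 (fun i => toSeven (z i)) := by
  have key : ∀ z : Fin 3 → Amb, invForm (-1) 0 0 1 0 (fun i => toSeven (z i)) =
      ((((z 0).1 * (star (z 1).2 * (z 2).2)).re - ((z 0).1 * (star (z 2).2 * (z 1).2)).re) +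
        (((z 1).1 * (star (z 2).2 * (z 0).2)).re - ((z 1).1 * (star (z 0).2 * (z 2).2)).re) +
        (((z 2).1 * (star (z 0).2 * (z 1).2)).re - ((z 2).1 * (star (z 1).2 * (z 0).2)).re)) / 2 := by
    intro z
    rw [invForm_apply]
    simp only [elem_three, toSeven_apply, Matrix.cons_val]
    simp
    ring
  have h : ∀ x y : ℍ[ℝ], star (b * x * star c) * (b * y * star c) = c * (star x * y) * star c := by
    intro x y
    calc _ = c * star x * (star b * b) * y * star c := by
          simp only [star_mul, star_star, mul_assoc]
      _ = _ := by rw [hb, mul_one]; simp only [mul_assoc]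
  rw [key, key]
  simp only [h, conj_mul_conj hc, re_conj hc]

/-- Products x ȳ cancel the right factor and are conjugated by b, which real parts do not see. -/
theorem volForm_toSeven_conj (hb : star b * b = 1) (hc : star c * c = 1) (v : ℍ[ℝ])
    (z z' : Fin 3 → Amb) (hz : ∀ i, (z' i).2 = b * (z i).2 * star c) :
    volForm (b * v * star c) (fun i => toSeven (z' i)) = volForm v (fun i => toSeven (z i)) := by
  have key : ∀ (v : ℍ[ℝ]) (z : Fin 3 → Amb), volForm v (fun i => toSeven (z i)) =
      (((v * star (z 2).2) * ((z 1).2 * star (z 0).2)).re -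
        ((v * star (z 0).2) * ((z 1).2 * star (z 2).2)).re) / 2 := by
    intro v z
    rw [volForm_apply]
    simp only [elem_three, toSeven_apply, Matrix.cons_val]
    simp
    ring
  have h : ∀ x y : ℍ[ℝ], (b * x * star c) * star (b * y * star c) = b * (x * star y) * star b := by
    intro x y
    calc _ = b * x * (star c * c) * star y * star b := by
          simp only [star_mul, star_star, mul_assoc]
      _ = _ := by rw [hc, mul_one]; simp only [mul_assoc]
  rw [key, key]
  simp only [hz, h, conj_mul_conj hb, re_conj hb]

end

theorem norm_act_snd (g : G) (x : Amb) : ‖(act g x).2‖ = ‖x.2‖ := by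
  simp [act]

theorem radialForm_act (m g₁ f₂ f₃ g₄ : ℝ → ℝ) (g : G) (x : Amb) (u : Fin 3 → Amb) :
    radialForm m g₁ f₂ f₃ g₄ (act g x) (fun i => act g (u i)) = radialForm m g₁ f₂ f₃ g₄ x u := by
  have hs : ∀ q : Sp1, star (q : ℍ[ℝ]) * q = 1 := fun q => Unitary.star_mul_self_of_mem q.2
  have hs' : ∀ q : Sp1, (q : ℍ[ℝ]) * star (q : ℍ[ℝ]) = 1 :=
    fun q => Unitary.mul_star_self_of_mem q.2
  obtain ⟨q₁, q₂, q₃⟩ := g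
  have h : ∀ (q : Sp1) (x y : ℍ[ℝ]), star ((q : ℍ[ℝ]) * x * star (q₃ : ℍ[ℝ])) *
      ((q : ℍ[ℝ]) * y * star (q₃ : ℍ[ℝ])) = q₃ * (star x * y) * star (q₃ : ℍ[ℝ]) := by
    intro q x y
    calc _ = (q₃ : ℍ[ℝ]) * star x * (star (q : ℍ[ℝ]) * q) * y * star (q₃ : ℍ[ℝ]) := by
          simp only [star_mul, star_star, mul_assoc]
      _ = _ := by rw [hs, mul_one]; simp only [mul_assoc]
  have h1 : ∀ u : Amb, star (act (q₁, q₂, q₃) x) * act (q₁, q₂, q₃) u =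
      ((q₃ : ℍ[ℝ]) * (star x * u).1 * star (q₃ : ℍ[ℝ]),
        (q₃ : ℍ[ℝ]) * (star x * u).2 * star (q₃ : ℍ[ℝ])) := fun u =>
    Prod.ext (h q₁ x.1 u.1) (h q₂ x.2 u.2)
  have h2 : ∀ u : Amb, ((star (act (q₁, q₂, q₃) x).1, 1) : Amb) * act (q₁, q₂, q₃) u =
      ((q₃ : ℍ[ℝ]) * (((star x.1, 1) : Amb) * u).1 * star (q₃ : ℍ[ℝ]),
        (q₂ : ℍ[ℝ]) * (((star x.1, 1) : Amb) * u).2 * star (q₃ : ℍ[ℝ])) := fun u =>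
    Prod.ext (h q₁ x.1 u.1) (by simp [act])
  rw [radialForm_apply, radialForm_apply, norm_act_snd]
  simp only [h1, h2]
  rw [invForm_toSeven_conj (hs q₃) (hs' q₃), invForm_toSeven_conj' (hs q₂) (hs q₃)]
  congr 2
  exact volForm_toSeven_conj (hs q₂) (hs q₃) x.2 _ _ fun i => rfl

end NearlyParallel
end

noncomputable section
namespace NearlyParallel

/-! ### Transport by the group action -/

theorem act_add (g : G) (x y : Amb) : act g (x + y) = act g x + act g y := by
  ext1 <;> simp [act, mul_add, add_mul]

theorem act_smul (g : G) (c : ℝ) (x : Amb) : act g (c • x) = c • act g x := by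
  ext1 <;> simp [act]

/-- The linear map `act g`. -/
def actL (g : G) : Amb →L[ℝ] Amb :=
  LinearMap.toContinuousLinearMap
    { toFun := act g
      map_add' := act_add g
      map_smul' := act_smul g }

theorem actL_apply (g : G) (x : Amb) : actL g x = act g x := rfl

theorem act_inv_act (g : G) (x : Amb) : act g⁻¹ (act g x) = x := by
  have hs : ∀ q : Sp1, star (q : ℍ[ℝ]) * q = 1 := fun q => Unitary.star_mul_self_of_mem q.2
  have hi : ∀ q : Sp1, ((q⁻¹ : Sp1) : ℍ[ℝ]) = star (q : ℍ[ℝ]) := fun q => rfl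
  have key : ∀ (q r : Sp1) (y : ℍ[ℝ]), star (q : ℍ[ℝ]) * ((q : ℍ[ℝ]) * y * star (r : ℍ[ℝ])) *
      (r : ℍ[ℝ]) = y := by
    intro q r y
    calc _ = (star (q : ℍ[ℝ]) * q) * y * (star (r : ℍ[ℝ]) * r) := by simp only [mul_assoc]
      _ = y := by rw [hs, hs, one_mul, mul_one]
  ext1 <;> simp [act, hi, key]

theorem act_act_inv (g : G) (x : Amb) : act g (act g⁻¹ x) = x := by
  have := act_inv_act g⁻¹ x
  rwa [inv_inv] at this

theorem act_mem_tangent (g : G) {x w : Amb} (hw : w ∈ tangent x) : act g w ∈ tangent (act g x) := by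
  rw [mem_tangent] at hw ⊢
  have hs : ∀ q : Sp1, star (q : ℍ[ℝ]) * q = 1 := fun q => Unitary.star_mul_self_of_mem q.2
  have h : (act g x).1 * star (act g w).1 =
      (g.1 : ℍ[ℝ]) * (x.1 * star w.1) * star (g.1 : ℍ[ℝ]) := by
    calc _ = (g.1 : ℍ[ℝ]) * x.1 * (star (g.2.2 : ℍ[ℝ]) * g.2.2) * star w.1 * star (g.1 : ℍ[ℝ]) := by
          simp only [act, star_mul, star_star, mul_assoc]
      _ = _ := by rw [hs, mul_one]; simp only [mul_assoc]
  rw [h, re_conj (hs _), hw]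

/-- The linear isomorphism of tangent spaces induced by `act g`. -/
def actEquiv (g : G) (x : Amb) : tangent x ≃ₗ[ℝ] tangent (act g x) where
  toFun w := ⟨act g w, act_mem_tangent g w.2⟩
  map_add' v w := Subtype.ext (act_add g v w)
  map_smul' c w := Subtype.ext (act_smul g c w)
  invFun w := ⟨act g⁻¹ w, by simpa only [act_inv_act] using act_mem_tangent g⁻¹ w.2⟩
  left_inv w := Subtype.ext (act_inv_act g w)
  right_inv w := Subtype.ext (act_act_inv g w)

theorem pull_trans_actEquiv {k : ℕ} (g : G) {x : Amb} (L : (Fin 7 → ℝ) ≃ₗ[ℝ] tangent x)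
    (α : Amb [⋀^Fin k]→L[ℝ] ℝ) :
    pull (L.trans (actEquiv g x)) α = pull L (α.compContinuousLinearMap (actL g)) := by
  ext y
  simp only [pull, AlternatingMap.compLinearMap_apply, LinearMap.comp_apply, LinearEquiv.coe_coe,
    LinearEquiv.trans_apply, Submodule.subtype_apply, ContinuousAlternatingMap.coe_toAlternatingMap,
    ContinuousAlternatingMap.compContinuousLinearMap_apply]
  rfl

section

variable {φ : Amb → Amb [⋀^Fin 3]→L[ℝ] ℝ} {T : ℝ}

/-- Translates of `gam t` with t ≥ 0 fill the tube, and d commutes with pull-back by the linear maps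
`act g`. Invariance is assumed on all vectors of ℍ², so that φ equals its pull-back as a form on the
ambient space. -/
theorem isInvariantNP_of_gam {lam : ℝ} (hs : ContDiffOn ℝ ∞ φ (nhd T))
    (hact : ∀ (g : G) (x : Amb) (u : Fin 3 → Amb), φ (act g x) (fun i => act g (u i)) = φ x u)
    (hpos : ∀ t ∈ Ico 0 T, ∃ L : (Fin 7 → ℝ) ≃ₗ[ℝ] tangent (gam t), IsAdapted (φ (gam t)) L)
    (hnp : ∀ t ∈ Ico 0 T, ∀ L : (Fin 7 → ℝ) ≃ₗ[ℝ] tangent (gam t), IsAdapted (φ (gam t)) L →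
      pull L (extDeriv φ (gam t)) = lam • stdPsi) : IsInvariantNP lam T φ := by
  have hcomp : ∀ (g : G) (x : Amb), (φ (act g x)).compContinuousLinearMap (actL g) = φ x := by
    intro g x
    ext u
    exact hact g x u
  have hgam : ∀ x ∈ tube T, ∃ (g : G) (t : ℝ), t ∈ Ico 0 T ∧ act g (gam t) = x := by
    intro x hx
    obtain ⟨q, q', h⟩ := exists_act_gam hx.1
    exact ⟨_, _, ⟨norm_nonneg _, hx.2⟩, h⟩
  have hsub : ∀ t ∈ Ico 0 T, t ∈ Ioo (-T) T := fun t ht => ⟨by linarith [ht.1, ht.2], ht.2⟩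
  refine ⟨hs, fun g x _ u _ => hact g x u, ?_, ?_⟩
  · intro x hx
    obtain ⟨g, t, ht, rfl⟩ := hgam x hx
    obtain ⟨L, hL⟩ := hpos t ht
    refine ⟨L.trans (actEquiv g (gam t)), ?_⟩
    rw [IsAdapted, pull_trans_actEquiv, hcomp]
    exact hL
  · intro x hx L hL
    obtain ⟨g, t, ht, rfl⟩ := hgam x hx
    obtain ⟨L, rfl⟩ : ∃ L' : (Fin 7 → ℝ) ≃ₗ[ℝ] tangent (gam t),
        L = L'.trans (actEquiv g (gam t)) :=
      ⟨L.trans (actEquiv g (gam t)).symm, by ext1 y; simp⟩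
    rw [IsAdapted, pull_trans_actEquiv, hcomp] at hL
    have hd : DifferentiableAt ℝ φ (actL g (gam t)) := by
      refine (hs.contDiffAt ((isOpen_nhd T).mem_nhds ?_)).differentiableAt (by simp)
      refine ⟨fun h => ?_, by rw [actL_apply, norm_act_snd]; exact (gam_mem_nhd (hsub t ht)).2⟩
      have := hx.1
      rw [actL_apply] at h
      simp [h] at this
    have hp := extDeriv_pullback (r := 2) hd (actL g).contDiff.contDiffAt (by simp)
    simp only [ContinuousLinearMap.fderiv, actL_apply, hcomp] at hp
    rw [pull_trans_actEquiv, ← hp]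
    exact hnp t ht L hL

theorem continuousAt_extDeriv_gam (hs : ContDiffOn ℝ ∞ φ (nhd T)) {t : ℝ} (ht : t ∈ Ioo (-T) T)
    (v : Fin 4 → Amb) : ContinuousAt (fun s => extDeriv φ (gam s) v) t := by
  have h3 : ∀ i : Fin 4, ContinuousAt
      (fun s => fderiv ℝ (fun x => φ x (i.removeNth v)) (gam s) (v i)) t := by
    intro i
    have h5 : ContDiff ℝ ∞ (ContinuousAlternatingMap.apply ℝ Amb ℝ (i.removeNth v)) :=
      ContinuousLinearMap.contDiff _
    have h6 : ContDiffOn ℝ ∞ (fun x => φ x (i.removeNth v)) (nhd T) := h5.comp_contDiffOn hs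
    have h1 : ContinuousAt (fderiv ℝ (fun x => φ x (i.removeNth v))) (gam t) :=
      (h6.continuousOn_fderiv_of_isOpen (isOpen_nhd T) (by simp)).continuousAt
        ((isOpen_nhd T).mem_nhds (gam_mem_nhd ht))
    have h2 : ContinuousAt (fun s => fderiv ℝ (fun x => φ x (i.removeNth v)) (gam s)) t :=
      h1.comp contDiff_gam.continuous.continuousAt
    exact h2.clm_apply continuousAt_const
  have h6 : (fun s => ∑ i : Fin 4, (-1 : ℤ) ^ (i : ℕ) •
      fderiv ℝ (fun x => φ x (i.removeNth v)) (gam s) (v i)) =ᶠ[nhds t]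
        fun s => extDeriv φ (gam s) v := by
    filter_upwards [isOpen_Ioo.mem_nhds ht] with s hs'
    rw [extDeriv_apply ((hs.contDiffAt ((isOpen_nhd T).mem_nhds
      (gam_mem_nhd hs'))).differentiableAt (by simp))]
  refine ContinuousAt.congr ?_ h6
  exact tendsto_finsetSum _ fun i _ => (h3 i).const_smul ((-1 : ℤ) ^ (i : ℕ))

end

end NearlyParallel
end

noncomputable section
namespace NearlyParallel

/-! ### From solutions of the singular initial value problem to nearly parallel structures -/

/-- For t > 0 this is `ode_iff` together with the definition of h₄. At t = 0, where the moving
fields degenerate, both sides are continuous and the equation follows as a limit. -/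
theorem IsSingularSolution.extDeriv_eq {lam a T : ℝ} (hlam : lam ≠ 0) {h : ℝ → Fin 4 → ℝ}
    (hh : IsSingularSolution lam a T h) {φ : Amb → Amb [⋀^Fin 3]→L[ℝ] ℝ}
    (hs : ContDiffOn ℝ ∞ φ (nhd T)) (hφ : IsInvariant T φ)
    (hform : ∀ t ∈ Ico 0 T, (φ (gam t)).toAlternatingMap.compLinearMap efr =
      invForm (h t 0 / 9) (-(t * h t 1) / 27) (-h t 2 / 27) (-h t 3 / 27)
        (-(t * hFour lam (h t)) / 27)) {t : ℝ} (ht : t ∈ Ico 0 T) :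
    (extDeriv φ (gam t)).toAlternatingMap.compLinearMap efr =
      lam • dualForm (h t 0 / 9) (-(t * h t 1) / 27) (-h t 2 / 27) (-h t 3 / 27)
        (-(t * hFour lam (h t)) / 27) := by
  have hsub : ∀ {t}, t ∈ Ico 0 T → t ∈ Ioo (-T) T := fun ht => ⟨by linarith [ht.1, ht.2], ht.2⟩
  have hpos : ∀ t ∈ Ioo 0 T, (extDeriv φ (gam t)).toAlternatingMap.compLinearMap efr =
      lam • dualForm (h t 0 / 9) (-(t * h t 1) / 27) (-h t 2 / 27) (-h t 3 / 27)
        (-(t * hFour lam (h t)) / 27) := by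
    intro t ht
    have ht' : t ∈ Ioo (-T) T := hsub ⟨ht.1.le, ht.2⟩
    have ht0 := ht.1.ne'
    have hd : DifferentiableAt ℝ φ (gam t) :=
      (hs.contDiffAt ((isOpen_nhd T).mem_nhds (gam_mem_nhd ht'))).differentiableAt (by simp)
    have ode := hh.ode t ht' ht0
    generalize hD : (1 / t) • singA lam (h t) + regB lam (h t) t = d at ode
    obtain ⟨e1, e2, e3, e4⟩ := (ode_iff hlam ht0 (hh.ne_zero t ht')).1 hD.symm
    have hi := hasDerivAt_pi.1 ode
    have d1 : HasDerivAt (fun s => -(s * h s 1) / 27) (-(h t 1 + t * d 1) / 27) t := by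
      have := (((hasDerivAt_id t).mul (hi 1)).neg).div_const 27
      exact this.congr_deriv (by simp)
    have d4 : HasDerivAt (fun s => -(s * hFour lam (h s)) / 27)
        (-(hFour lam (h t) + t * (-d 3 - lam / 6 * (2 * h t 0 * d 0))) / 27) t := by
      have h4 : HasDerivAt (fun s => hFour lam (h s))
          (-d 3 - lam / 6 * (2 * h t 0 * d 0)) t := by
        have := (hi 3).neg.sub (((hi 0).pow 2).const_mul (lam / 6))
        exact this.congr_deriv (by simp)
      have := (((hasDerivAt_id t).mul h4).neg).div_const 27
      exact this.congr_deriv (by simp)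
    rw [hφ.extDeriv_gam ht hd (fun s hs => hform s ⟨hs.1.le, hs.2⟩) ((hi 0).div_const 9) d1
      ((hi 2).neg.div_const 27) ((hi 3).neg.div_const 27) d4, dualForm, smul_fourForm]
    congr 1
    · rw [hFour]; field_simp; ring
    · rw [← e1]; field_simp; ring
    · rw [mul_neg, ← e2]; ring
    · rw [← e3]; field_simp; ring
    · rw [mul_neg, ← e4]; field_simp; ring
  rcases ht.1.eq_or_lt with rfl | h0
  · have hT : 0 < T := ht.2
    have hi : ∀ i, ContinuousAt (fun s => h s i) 0 := fun i =>
      (continuous_apply i).continuousAt.comp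
        (hh.smooth.continuousOn.continuousAt (isOpen_Ioo.mem_nhds (hsub ht)))
    ext y
    have h1 := continuousAt_extDeriv_gam hs (hsub ht) fun i => efr (y i)
    have h2 : ContinuousAt (fun t => (lam • dualForm (h t 0 / 9) (-(t * h t 1) / 27) (-h t 2 / 27)
        (-h t 3 / 27) (-(t * hFour lam (h t)) / 27)) y) 0 := by
      have hn : 2 * (h 0 0 / 9) ^ 3 ≠ 0 :=
        mul_ne_zero two_ne_zero (pow_ne_zero 3 (div_ne_zero (hh.ne_zero 0 (hsub ht)) (by norm_num)))
      have c0 := hi 0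
      have c1 := hi 1
      have c2 := hi 2
      have c3 := hi 3
      simp only [AlternatingMap.smul_apply, dualForm, fourForm_apply, dualCoeff, dualCoeff', hFour]
      fun_prop (disch := exact hn)
    have hlim : Filter.Tendsto _ (nhdsWithin (0 : ℝ) (Ioi 0)) _ :=
      h1.tendsto.mono_left nhdsWithin_le_nhds
    have key := tendsto_nhds_unique_of_eventuallyEq hlim
      (h2.tendsto.mono_left nhdsWithin_le_nhds) (by
        filter_upwards [Ioo_mem_nhdsGT hT] with s hs
        exact DFunLike.congr_fun (hpos s hs) y)
    exact key
  · exact hpos t ⟨h0, ht.2⟩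

theorem definesNP_of_solution {lam : ℝ} (hlam : lam ≠ 0) {T : ℝ}
    {f : Fin 5 → ℝ → ℝ} {a : ℝ} {h : ℝ → Fin 4 → ℝ}
    (hh : IsSingularSolution lam a T h) (he : IsEvenOn T h)
    (hf : ∀ t ∈ Ioo 0 T, f 0 t = t * h t 0 ∧ f 1 t = t ^ 4 * h t 1 ∧ f 2 t = h t 2 ∧
        f 3 t = t ^ 2 * h t 3 ∧ f 4 t = t ^ 2 * hFour lam (h t)) :
    DefinesNP lam T f := by
  have hsub : ∀ {t}, t ∈ Ico 0 T → t ∈ Ioo (-T) T := fun ht => ⟨by linarith [ht.1, ht.2], ht.2⟩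
  have hs : ∀ i, ContDiffOn ℝ ∞ (fun t => h t i) (Ioo (-T) T) := contDiffOn_pi.1 hh.smooth
  have he' : ∀ i, ∀ t ∈ Ioo (-T) T, h (-t) i = h t i := fun i t ht => congrFun (he t ht) i
  -- The sum of the coefficients f₀ and f₃ in the frame `efr` is (3h₀ - h₃)/27; it is even and
  -- vanishes at 0 because h₃(0) = 3a, so it is t² m with m smooth and even.
  obtain ⟨m, hms, hm, hme⟩ := exists_eq_sq_mul_of_even (g := fun t => (3 * h t 0 - h t 3) / 27)
    (((contDiffOn_const.mul (hs 0)).sub (hs 3)).div_const 27)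
    (fun t ht => by simp only [he' _ t ht]) (by simp [hh.init])
  set φ := radialForm m (fun t => -h t 1 / 27) (fun t => -h t 2 / 27) (fun t => -h t 3 / 27)
    (fun t => -hFour lam (h t) / 27) with hφ
  have hsm : ContDiffOn ℝ ∞ φ (nhd T) := by
    refine contDiffOn_radialForm hms hme ((hs 1).neg.div_const 27) ?_ ((hs 2).neg.div_const 27) ?_
      ((hs 3).neg.div_const 27) ?_
      (((hs 3).neg.sub (contDiffOn_const.mul ((hs 0).pow 2))).neg.div_const 27) ?_
    · exact fun t ht => by simp only [he' _ t ht]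
    · exact fun t ht => by simp only [he' _ t ht]
    · exact fun t ht => by simp only [he' _ t ht]
    · exact fun t ht => by simp only [he t ht]
  have hact : ∀ (g : G) (x : Amb) (u : Fin 3 → Amb),
      φ (act g x) (fun i => act g (u i)) = φ x u := radialForm_act _ _ _ _ _
  have hform : ∀ t ∈ Ico 0 T, (φ (gam t)).toAlternatingMap.compLinearMap efr =
      invForm (h t 0 / 9) (-(t * h t 1) / 27) (-h t 2 / 27) (-h t 3 / 27)
        (-(t * hFour lam (h t)) / 27) := by
    intro t ht
    rw [hφ, radialForm_gam _ _ _ _ _ ht.1, ← hm t (hsub ht)]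
    congr 1 <;> ring
  have hn : ∀ t ∈ Ico 0 T, NormalEq (h t 0 / 9) (-(t * h t 1) / 27) (-h t 2 / 27) (-h t 3 / 27)
      (-(t * hFour lam (h t)) / 27) := fun t ht =>
    (normalEq_iff lam t (h t)).2 (hh.normalPoly_eq_zero ht)
  have hne : ∀ t ∈ Ico 0 T, h t 0 / 9 ≠ 0 := fun t ht =>
    div_ne_zero (hh.ne_zero t (hsub ht)) (by norm_num)
  refine ⟨φ, isInvariantNP_of_gam hsm hact
    (fun t ht => exists_isAdapted t (hform t ht) (hne t ht) (hn t ht)) ?_, ?_, ?_⟩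
  · intro t ht L hL
    rw [pull_eq_smul_stdPsi_iff (hform t ht) (hne t ht) (hn t ht) hL]
    exact hh.extDeriv_eq hlam hsm (fun g x _ u _ => hact g x u) hform ht
  · intro t ht
    have ht0 := ht.1.ne'
    rw [comp_frame_eq_invForm_iff ht0, hform t ⟨ht.1.le, ht.2⟩]
    obtain ⟨e0, e1, e2, e3, e4⟩ := hf t ht
    rw [e0, e1, e2, e3, e4]
    congr 1 <;> field_simp
  · intro t ht L hL y hy
    have ht' : t ∈ Ico 0 T := ⟨ht.1.le, ht.2⟩
    exact sum_sq_eq_one (hform t ht') (hne t ht') (hn t ht') hL hy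

end NearlyParallel
end

/-! ### Proof of the proposition -/

theorem mainTheorem4 (lam : ℝ) (hlam : lam ≠ 0) :
    (∀ T : ℝ, 0 < T → ∀ f : Fin 5 → ℝ → ℝ,
      NearlyParallel.DefinesNP lam T f ↔
        ∃ a : ℝ, a ≠ 0 ∧ ∃ h : ℝ → Fin 4 → ℝ,
          NearlyParallel.IsSingularSolution lam a T h ∧
          NearlyParallel.IsEvenOn T h ∧
          ∀ t ∈ Set.Ioo 0 T,
            f 0 t = t * h t 0 ∧ f 1 t = t ^ 4 * h t 1 ∧ f 2 t = h t 2 ∧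
            f 3 t = t ^ 2 * h t 3 ∧ f 4 t = t ^ 2 * NearlyParallel.hFour lam (h t)) ∧
    (∀ a : ℝ, a ≠ 0 →
      (∃ ε : ℝ, 0 < ε ∧ ∃ h : ℝ → Fin 4 → ℝ, NearlyParallel.IsSingularSolution lam a ε h) ∧
      (∀ ε : ℝ, 0 < ε → ∀ h h' : ℝ → Fin 4 → ℝ,
        NearlyParallel.IsSingularSolution lam a ε h →
        NearlyParallel.IsSingularSolution lam a ε h' → Set.EqOn h h' (Set.Ioo (-ε) ε)) ∧
      (∀ ε : ℝ, 0 < ε → ∀ h : ℝ → Fin 4 → ℝ,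
        NearlyParallel.IsSingularSolution lam a ε h → NearlyParallel.IsEvenOn ε h)) := by
  refine ⟨fun T hT f => ⟨fun hf => NearlyParallel.exists_solution_of_definesNP hlam hT hf, ?_⟩,
    fun a ha => ⟨NearlyParallel.exists_isSingularSolution ha, ?_, ?_⟩⟩
  · rintro ⟨a, ha, h, hh, he, hf⟩
    exact NearlyParallel.definesNP_of_solution hlam hh he hf
  · exact fun ε hε h h' hh hh' => hh.eqOn hh'
  · exact fun ε hε h hh => hh.isEvenOn
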